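/- All posets are finite. An embedding of a poset $\mathcal Q=(Q,\le^Q)$ into a poset $\mathcal P=(P,\le^P)$ is an injective map $e:Q\to P$ with $q\le^Q q'\iff e(q)\le^P e(q')$ for all $q,q'\in Q$; $\mathrm{width}(\mathcal P)$ is the maximum cardinality of an antichain of $\mathcal P$. The problem EMBEDDING takes two posets $\mathcal Q,\mathcal P$, given by their sizes and order matrices, has the parameter $(\mathrm{width}(\mathcal P),|Q|)$, and asks whether $\mathcal Q$ embeds into $\mathcal P$. Running times are numbers of steps of a random access machine with addition, truncated subtraction, indirect addressing and jumps, each at unit cost. Theorem. (1) EMBEDDING is fixed-parameter tractable: there are an algorithm, a computable function $g$ and a constant $c$ such that the algorithm decides every instance $(\mathcal Q,\mathcal P)$ of encoding length $N$ in time at most $g(\mathrm{width}(\mathcal P),|Q|)\cdot N^{c}$. (2) More precisely, EMBEDDING can be solved in time $O\big(\mathrm{width}(\mathcal P)^{|Q|}\cdot|Q|^4\cdot|P|^4\big)$, and in time $O(1)$ if $Q$ or $P$ is empty. (3) Let $(C_1,\dots,C_k)$ be a partition of $P$ into nonempty chains (for instance with $k=\mathrm{width}(\mathcal P)$) and let $f:Q\to\{1,\dots,k\}$.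 Call an embedding $e$ of $\mathcal Q$ into $\mathcal P$ compatible with $f$ if $e(q)\in C_{f(q)}$ for all $q\in Q$. Let $I$ be the constraint satisfaction instance with a variable $x_q$ for every $q\in Q$, with values in $P$, with the unary constraint $x_q\in C_{f(q)}$ for every $q\in Q$, and, for all ordered pairs of distinct $q,q'\in Q$, with the constraint that $(x_q,x_{q'})$ belongs to the set of all $(p,p')\in C_{f(q)}\times C_{f(q')}$ such that $p\le^P p'\iff q\le^Q q'$ and $p'\le^P p\iff q'\le^Q q$. Then: - $I$ can be computed from $\mathcal Q$, $\mathcal P$, $(C_1,\dots,C_k)$ and $f$ in time $O\big((|Q|\cdot|P|)^2\big)$ (in time $O(1)$ if $Q$ is empty), where the constraint relations are listed tuple by tuple; - the solutions of $I$ are exactly the maps $x_q\mapsto e(q)$ for the embeddings $e$ of $\mathcal Q$ into $\mathcal P$ that are compatible with $f$; - every constraint relation of $I$ is closed under the componentwise binary operation $\min_L$ for every linear order $L$ on $P$ that extends $\le^P$; in particular, $I$ is closed under a min polymorphism. -/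

import Mathlib

/-! ### Random access machines with uniform cost -/

namespace RAM

/-- Instructions of a random access machine. `R` is the register file, `M` the memory; both hold
natural numbers, and memory is addressed indirectly, through registers. -/
inductive Instr where
  /-- `R[d] := k` -/
  | const (d k : ℕ)
  /-- `R[d] := R[a]` -/
  | copy (d a : ℕ)
  /-- `R[d] := R[a] + R[b]` -/
  | add (d a b : ℕ)
  /-- `R[d] := max (R[a] - R[b]) 0` -/
  | sub (d a b : ℕ)
  /-- `R[d] := M[R[a]]` -/
  | load (d a : ℕ)
  /-- `M[R[a]] := R[b]` -/
  | store (a b : ℕ)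
  /-- jump to instruction `l` -/
  | jump (l : ℕ)
  /-- jump to instruction `l` if `R[a] = 0` -/
  | jumpZero (a l : ℕ)

/-- A program is a finite list of instructions, numbered from `0`. -/
abbrev Program := List Instr

structure Config where
  pc : ℕ
  reg : ℕ → ℕ
  mem : ℕ → ℕ

/-- The effect of one instruction. -/
def Instr.exec : Instr → Config → Config
  | .const d k, c => ⟨c.pc + 1, Function.update c.reg d k, c.mem⟩
  | .copy d a, c => ⟨c.pc + 1, Function.update c.reg d (c.reg a), c.mem⟩
  | .add d a b, c => ⟨c.pc + 1, Function.update c.reg d (c.reg a + c.reg b), c.mem⟩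
  | .sub d a b, c => ⟨c.pc + 1, Function.update c.reg d (c.reg a - c.reg b), c.mem⟩
  | .load d a, c => ⟨c.pc + 1, Function.update c.reg d (c.mem (c.reg a)), c.mem⟩
  | .store a b, c => ⟨c.pc + 1, c.reg, Function.update c.mem (c.reg a) (c.reg b)⟩
  | .jump l, c => ⟨l, c.reg, c.mem⟩
  | .jumpZero a l, c => ⟨if c.reg a = 0 then l else c.pc + 1, c.reg, c.mem⟩

/-- The machine has halted when the program counter points outside the program. -/
def Program.Halted (A : Program) (c : Config) : Prop := A.length ≤ c.pc

/-- One step of the computation, of cost one; a halted configuration does not change. -/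
def Program.step (A : Program) (c : Config) : Config :=
  match A[c.pc]? with
  | some i => i.exec c
  | none => c

/-- The initial configuration: the input is in the memory cells `0, 1, 2, …`, and all other
cells and all registers are zero. -/
def init (input : List ℕ) : Config := ⟨0, fun _ => 0, fun i => input.getD i 0⟩

/-- On the given input, `A` halts after at most `T` steps, with `R[0] = 1` if `yes` holds and
with `R[0] = 0` if it does not. -/
def Program.DecidesWithin (A : Program) (input : List ℕ) (yes : Prop) (T : ℕ) : Prop :=
  ∃ t ≤ T, A.Halted (A.step^[t] (init input)) ∧
    (yes → (A.step^[t] (init input)).reg 0 = 1) ∧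
    (¬ yes → (A.step^[t] (init input)).reg 0 = 0)

/-- On the given input, `A` halts after at most `T` steps, with the list `output` in a block of
consecutive memory cells whose first address is in `R[0]` and whose length is in `R[1]`. -/
def Program.ComputesWithin (A : Program) (input output : List ℕ) (T : ℕ) : Prop :=
  ∃ t ≤ T, A.Halted (A.step^[t] (init input)) ∧
    (A.step^[t] (init input)).reg 1 = output.length ∧
    ∀ (i : ℕ) (h : i < output.length),
      (A.step^[t] (init input)).mem ((A.step^[t] (init input)).reg 0 + i) = output[i]

end RAM

/-! ### Parameterized problems -/

/-- A parameterized decision problem with parameters in `κ`: its instances, their encoding as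
machine inputs, their parameter, and the set of yes-instances. -/
structure ParamProblem (κ : Type) where
  Inst : Type 1
  encode : Inst → List ℕ
  param : Inst → κ
  Yes : Inst → Prop

/-- Every instance `x` with parameter `k` is decided in time `f k * |x| ^ c`, where `f` is
computable and `c` is constant. -/
def ParamProblem.FixedParameterTractable {κ : Type} [Primcodable κ] (X : ParamProblem κ) : Prop :=
  ∃ (A : RAM.Program) (f : κ → ℕ) (c : ℕ), Computable f ∧
    ∀ x : X.Inst, A.DecidesWithin (X.encode x) (X.Yes x) (f (X.param x) * (X.encode x).length ^ c)

/-! ### Finite posets and the embedding problem -/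

/-- The width of a (finite) poset: the largest cardinality of an antichain. -/
noncomputable def posetWidth (α : Type) [PartialOrder α] : ℕ :=
  sSup {k | ∃ A : Finset α, IsAntichain (· ≤ ·) (A : Set α) ∧ A.card = k}

/-- A finite poset whose elements are numbered `0, …, size - 1`, in an arbitrary way that need not
respect the order, so that it can be given to a machine. -/
structure FinPoset where
  carrier : Type
  [order : PartialOrder carrier]
  size : ℕ
  label : carrier ≃ Fin size

instance : CoeSort FinPoset Type := ⟨FinPoset.carrier⟩

instance (P : FinPoset) : PartialOrder P := P.order

namespace FinPoset

noncomputable def width (P : FinPoset) : ℕ := posetWidth P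

/-- The linear order `L` extends the order of `P`. -/
def IsLinearExtension (P : FinPoset) (L : LinearOrder P) : Prop :=
  ∀ a b : P, P.order.le a b → L.le a b

/-- The elements, in the order of their labels. -/
def elems (P : FinPoset) : List P := (List.finRange P.size).map P.label.symm

open Classical in
/-- The order relation as a 0/1 matrix, row by row: entry `i * size + j` is `1` iff
element `i` is at most element `j`. -/
noncomputable def matrix (P : FinPoset) : List ℕ :=
  List.ofFn fun t : Fin (P.size * P.size) =>
    if P.label.symm t.divNat ≤ P.label.symm t.modNat then 1 else 0

end FinPoset

/-- Given finite posets `Q` and `P`, with parameter `(width P, |Q|)`: is there an embedding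
of `Q` into `P`? -/
noncomputable def embeddingProblem : ParamProblem (ℕ × ℕ) where
  Inst := FinPoset × FinPoset
  encode := fun x => [x.1.size, x.2.size] ++ x.1.matrix ++ x.2.matrix
  param := fun x => (x.2.width, x.1.size)
  Yes := fun x => Nonempty (x.1 ↪o x.2)

/-! ### Chain partitions and compatible embeddings -/

/-- A partition of a poset into a tuple of `k` chains. -/
structure ChainPartition (α : Type) [PartialOrder α] (k : ℕ) where
  part : Fin k → Set α
  nonempty : ∀ i, (part i).Nonempty
  disjoint : ∀ i j, i ≠ j → Disjoint (part i) (part j)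
  cover : ∀ a, ∃ i, a ∈ part i
  chain : ∀ i, IsChain (· ≤ ·) (part i)

/-- The embedding `e` sends every `q` into the chain with index `f q`. -/
def CompatibleWith {α β : Type} [PartialOrder α] [PartialOrder β] {k : ℕ}
    (C : ChainPartition β k) (f : α → Fin k) (e : α ↪o β) : Prop :=
  ∀ q, e q ∈ C.part (f q)

/-! ### Constraint satisfaction problems -/

/-- A constraint: a scope (a tuple of distinct variables) and a relation of the same arity, given
by the list of its tuples. -/
structure Constraint (V D : Type) where
  arity : ℕ
  scope : Fin arity → V
  scope_injective : Function.Injective scope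
  rel : List (Fin arity → D)

/-- A CSP instance with variables `V` and domain `D`. -/
structure CSP (V D : Type) where
  constraints : List (Constraint V D)

def CSP.IsSolution {V D : Type} (I : CSP V D) (τ : V → D) : Prop :=
  ∀ c ∈ I.constraints, (fun j => τ (c.scope j)) ∈ c.rel

/-- The `n`-ary operation `φ` is a polymorphism of the constraint `c`. -/
def Constraint.ClosedUnder {V D : Type} {n : ℕ} (c : Constraint V D) (φ : (Fin n → D) → D) :
    Prop :=
  ∀ t : Fin n → (Fin c.arity → D), (∀ i, t i ∈ c.rel) → (fun j => φ (fun i => t i j)) ∈ c.rel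

/-- The `n`-ary operation `φ` is a polymorphism of all constraints of `I`. -/
def CSP.ClosedUnder {V D : Type} {n : ℕ} (I : CSP V D) (φ : (Fin n → D) → D) : Prop :=
  ∀ c ∈ I.constraints, c.ClosedUnder φ

/-- The binary minimum operation of a linear order on `D`. -/
def minOp {D : Type} (L : LinearOrder D) (x : Fin 2 → D) : D := L.min (x 0) (x 1)

/-- `φ` is a min operation: the minimum with respect to some linear ordering of `D`. -/
def IsMinOp {D : Type} (φ : (Fin 2 → D) → D) : Prop := ∃ L : LinearOrder D, φ = minOp L

/-- The encoding of a constraint: arity, scope, number of tuples, tuples. -/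
def Constraint.encode {V D : Type} {v d : ℕ} (eV : V ≃ Fin v) (eD : D ≃ Fin d)
    (c : Constraint V D) : List ℕ :=
  c.arity :: (List.ofFn fun j => (eV (c.scope j) : ℕ)) ++
    c.rel.length :: c.rel.flatMap fun t => List.ofFn fun j => (eD (t j) : ℕ)

/-- The encoding of a CSP instance: numbers of variables, domain elements and constraints, then
the constraints. -/
def CSP.encode {V D : Type} {v d : ℕ} (eV : V ≃ Fin v) (eD : D ≃ Fin d) (I : CSP V D) : List ℕ :=
  [v, d, I.constraints.length] ++ I.constraints.flatMap (Constraint.encode eV eD)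

/-! ### The CSP instance of a chain assignment -/

section Assignment

variable (Q P : FinPoset) {k : ℕ} (C : ChainPartition P k) (f : Q → Fin k)

open Classical in
/-- The constraint that the value of the variable `q` lies in the chain `C_{f q}`; it expresses
that this chain is the domain of the variable `q`. -/
noncomputable def domainConstraint (q : Q) : Constraint Q P where
  arity := 1
  scope := ![q]
  scope_injective := Function.injective_of_subsingleton _
  rel := (P.elems.filter fun p => p ∈ C.part (f q)).map fun p => ![p]

open Classical in
/-- The constraint on two distinct variables `q`, `q'`: the pairs in `C_{f q} × C_{f q'}` that are
ordered in `P` in the same way as `(q, q')` is in `Q`. -/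
noncomputable def orderConstraint (q q' : Q) (h : q ≠ q') : Constraint Q P where
  arity := 2
  scope := ![q, q']
  scope_injective := by
    intro i j hij
    fin_cases i <;> fin_cases j <;> simp_all
  rel := ((P.elems ×ˢ P.elems).filter fun x =>
      x.1 ∈ C.part (f q) ∧ x.2 ∈ C.part (f q') ∧
        (x.1 ≤ x.2 ↔ q ≤ q') ∧ (x.2 ≤ x.1 ↔ q' ≤ q)).map fun x => ![x.1, x.2]

open Classical in
/-- The CSP instance of the chain assignment `f`: the variables are the elements of `Q`, the values
are elements of `P`. -/
noncomputable def assignmentCSP : CSP Q P where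
  constraints := Q.elems.map (domainConstraint Q P C f) ++
    (Q.elems ×ˢ Q.elems).filterMap fun x =>
      if h : x.1 ≠ x.2 then some (orderConstraint Q P C f x.1 x.2 h) else none

open Classical in
/-- The encoding of `(Q, P, C, f)`: the sizes, the two order matrices, the 0/1 membership
matrix of the chains row by row, and the values of `f`. -/
noncomputable def encodeAssignment : List ℕ :=
  [Q.size, P.size, k] ++ Q.matrix ++ P.matrix ++
    (List.ofFn fun t : Fin (k * P.size) =>
      if P.label.symm t.modNat ∈ C.part t.divNat then 1 else 0) ++
    Q.elems.map fun q => (f q : ℕ)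

end Assignment

/-!
For pairs taken from two chains, the relation "`(p, p')` is ordered like `(q, q')`" is closed under
componentwise minima. A linear extension agrees with the order on every chain, which makes its
minimum a polymorphism; and once the domains of the variables are arc consistent and nonempty,
sending each variable to the least element of its domain is an embedding.

An embedding of `Q` into `P` sends every element of `Q` into one of the chains of a fixed
decomposition of `P`. With at most `width P` chains there are at most `width P ^ |Q|` assignments
of chains, and enforcing arc consistency decides each of them.

Such a decomposition is found by an auction. Each element that owns nothing bids for an element
above it, always for a cheapest one, whose price rises by one and which its former owner loses; it
stops bidding when even the cheapest one costs `|P| + 1`. In the end some price in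
`{1, …, |P| + 1}` is carried by no element, and cutting at this price gives an antichain with at
least as many members as there are elements without an owner. These elements are the minima of the
chains that the owners form.

The machine programs are compiled from a language whose loops have bounds that are fixed when they
start, so that their cost is at most a constant times the largest product of nested loop bounds.
-/

/-! ### Arc consistency -/

/-- The pair `(a, a')` is ordered in the same way as `(x, x')`: this is the relation of the order
constraints. -/
def OrderedAlike {α β : Type*} [LE α] [LE β] (a a' : α) (x x' : β) : Prop :=
  (a ≤ a' ↔ x ≤ x') ∧ (a' ≤ a ↔ x' ≤ x)

theorem OrderedAlike.mix {α β : Type*} [Preorder α] [LE β] {a a' b b' : α} {x x' : β}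
    (ha : OrderedAlike a a' x x') (hb : OrderedAlike b b' x x') (h : a ≤ b) (h' : b' ≤ a') :
    OrderedAlike a b' x x' :=
  ⟨⟨fun l => ha.1.1 (l.trans h'), fun l => h.trans (hb.1.2 l)⟩,
    ⟨fun l => hb.2.1 (l.trans h), fun l => h'.trans (ha.2.2 l)⟩⟩

theorem exists_isLeast_of_isChain {α : Type*} [PartialOrder α] {s : Set α}
    (chain : IsChain (· ≤ ·) s) (fin : s.Finite) (ne : s.Nonempty) : ∃ a, IsLeast s a := by
  obtain ⟨a, ha⟩ := fin.exists_minimal ne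
  exact ⟨a, ha.prop, fun b hb => (chain.total ha.prop hb).elim id (ha.le_of_le hb)⟩

theorem exists_orderEmbedding_of_arcConsistent {α β : Type*} [PartialOrder α] [PartialOrder β]
    (D : β → Set α) (fin : ∀ x, (D x).Finite) (ne : ∀ x, (D x).Nonempty)
    (chain : ∀ x, IsChain (· ≤ ·) (D x))
    (arcConsistent : ∀ x x', ∀ a ∈ D x, ∃ a' ∈ D x', OrderedAlike a a' x x') :
    ∃ e : β ↪o α, ∀ x, IsLeast (D x) (e x) := by
  choose e he using fun x => exists_isLeast_of_isChain (chain x) (fin x) (ne x)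
  refine ⟨OrderEmbedding.ofMapLEIff e fun x x' => ?_, he⟩
  obtain ⟨a', ha', alike⟩ := arcConsistent x x' _ (he x).1
  obtain ⟨a, ha, alike'⟩ := arcConsistent x' x _ (he x').1
  exact (alike.mix alike'.symm ((he x).2 ha) ((he x').2 ha')).1

/-! ### Auctions -/

section Auction

variable {α : Type*} {r : α → α → Prop} {owner : α → Option α} {price : α → ℕ} {lim : ℕ}

/-- A state of an auction in which `a` bids for the objects `b` with `r a b`. The last condition
makes the owners content, up to one unit, with what they have. -/
structure IsAuction (r : α → α → Prop) (lim : ℕ) (owner : α → Option α) (price : α → ℕ) :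
    Prop where
  rel : ∀ {a b}, a ∈ owner b → r a b
  unique : ∀ {a b b'}, a ∈ owner b → a ∈ owner b' → b = b'
  owned : ∀ {b}, price b ≠ 0 → ∃ a, a ∈ owner b
  price_le : ∀ b, price b ≤ lim
  content : ∀ {a b c}, a ∈ owner b → r a c → price b ≤ price c + 1

/-- The bidder `a` owns an object or cannot afford one. -/
def Settled (r : α → α → Prop) (lim : ℕ) (owner : α → Option α) (price : α → ℕ) (a : α) : Prop :=
  (∃ b, a ∈ owner b) ∨ ∀ b, r a b → lim ≤ price b

namespace IsAuction

theorem bid [DecidableEq α] (h : IsAuction r lim owner price) {a b : α}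
    (not_owner : ∀ b', a ∉ owner b') (hab : r a b) (affordable : price b < lim)
    (cheapest : ∀ b', r a b' → price b ≤ price b') :
    IsAuction r lim (Function.update owner b (some a)) (Function.update price b (price b + 1)) where
  rel {a' b'} ha' := by
    rcases eq_or_ne b' b with rfl | hb
    · rw [Function.update_self, Option.mem_some_iff] at ha'
      exact ha' ▸ hab
    · exact h.rel (by rwa [Function.update_of_ne hb] at ha')
  unique {a' b₁ b₂} h₁ h₂ := by
    simp only [Function.update_apply] at h₁ h₂
    have := @h.unique a' b₁ b₂
    grind
  owned {b'} hb' := by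
    rcases eq_or_ne b' b with rfl | hb
    · exact ⟨a, Function.update_self _ _ _⟩
    · simp only [Function.update_of_ne hb] at hb' ⊢
      exact h.owned hb'
  price_le b' := by
    have := h.price_le b'
    grind
  content {a' b₁ b₂} h₁ h₂ := by
    have := @h.content a' b₁ b₂
    have := cheapest b₂
    grind

open Classical in
theorem card_unowned_add_card_le (h : IsAuction r lim owner price) {A : Finset α}
    (hr : ∀ {a b}, r a b → a ∈ A ∧ b ∈ A) (L : ℕ) :
    (A.filter fun b => owner b = none).card + (A.filter fun b => L < price b).card ≤
      (A.filter fun a => ∀ b, a ∈ owner b → L < price b).card := by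
  set unowned := A.filter fun b => owner b = none
  set high := A.filter fun b => L < price b
  set bidders := A.filter fun a => ∀ b, a ∈ owner b → L < price b
  have low_owned : (A \ bidders).card ≤ (A \ (unowned ∪ high)).card := by
    refine Finset.card_le_card_of_surjOn (fun b => (owner b).getD b) fun a ha => ?_
    obtain ⟨haA, hb⟩ := Finset.mem_sdiff.mp ha
    obtain ⟨b, hb, hbL⟩ : ∃ b, owner b = some a ∧ price b ≤ L := by
      simpa [bidders, haA] using hb
    refine ⟨b, ?_, by simp [hb]⟩
    simp [unowned, high, (hr (h.rel hb)).2, hb, hbL]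
  have disjoint : Disjoint unowned high := by
    refine Finset.disjoint_filter.mpr fun b _ hb hLb => ?_
    obtain ⟨a, ha⟩ := h.owned (Nat.ne_zero_of_lt hLb)
    exact Option.not_mem_none a (hb ▸ ha)
  have bidders_subset : bidders ⊆ A := Finset.filter_subset _ _
  have union_subset : unowned ∪ high ⊆ A :=
    Finset.union_subset (Finset.filter_subset _ _) (Finset.filter_subset _ _)
  have card_union := Finset.card_union_of_disjoint disjoint
  rw [Finset.card_sdiff_of_subset bidders_subset, Finset.card_sdiff_of_subset union_subset]
    at low_owned
  have := Finset.card_le_card bidders_subset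
  have := Finset.card_le_card union_subset
  omega

/-- Let `L` be a price that nothing has. Bidders who own nothing, or something above `L`, can only
bid for objects above `L`. Hence those of them that are not themselves above `L` are an
antichain. -/
theorem exists_isAntichain (h : IsAuction r lim owner price) {A : Finset α}
    (hr : ∀ {a b}, r a b → a ∈ A ∧ b ∈ A) (hlim : A.card < lim)
    (settled : ∀ a ∈ A, Settled r lim owner price a) :
    ∃ S ⊆ A, IsAntichain r (S : Set α) ∧ (A.filter fun b => owner b = none).card ≤ S.card := by
  classical
  obtain ⟨L, hL, gap⟩ : ∃ L ∈ Finset.Icc 1 lim, L ∉ A.image price :=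
    Finset.exists_mem_notMem_of_card_lt_card
      (Finset.card_image_le.trans_lt (by rwa [Nat.card_Icc, Nat.add_sub_cancel]))
  rw [Finset.mem_Icc] at hL
  set high := A.filter fun b => L < price b
  set bidders := A.filter fun a => ∀ b, a ∈ owner b → L < price b
  have bids_high {a b : α} (ha : a ∈ bidders) (hab : r a b) : b ∈ high := by
    refine Finset.mem_filter.mpr ⟨(hr hab).2, ?_⟩
    have hb : price b ≠ L := fun e => gap (Finset.mem_image.mpr ⟨b, (hr hab).2, e⟩)
    rw [Finset.mem_filter] at ha
    rcases settled a ha.1 with ⟨b', hb'⟩ | poor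
    · have := h.content hb' hab
      have := ha.2 b' hb'
      omega
    · have := poor b hab
      omega
  refine ⟨bidders \ high, Finset.sdiff_subset.trans (Finset.filter_subset _ _),
    fun a ha b hb _ hab => ?_, ?_⟩
  · exact (Finset.mem_sdiff.mp hb).2 (bids_high (Finset.mem_sdiff.mp ha).1 hab)
  · have : _ + high.card ≤ bidders.card := h.card_unowned_add_card_le hr L
    have := Finset.le_card_sdiff high bidders
    omega

end IsAuction

end Auction

/-! ### Descent -/

/-- A step from `d` to `d'` that keeps the invariant `I`, and that changes `d` only if `d` does not
have the desired property `R`, and then to a value of smaller measure. -/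
def Descends {δ : Type*} (I : δ → Prop) (μ : δ → ℕ) (R : δ → Prop) (d d' : δ) : Prop :=
  I d → I d' ∧ ((R d ∧ d' = d) ∨ (¬ R d ∧ μ d' < μ d))

namespace Descends

variable {δ : Type*} {I : δ → Prop} {μ : δ → ℕ} {R R' : δ → Prop} {d d' d'' : δ}

theorem le (h : Descends I μ R d d') (hd : I d) : μ d' ≤ μ d := by
  rcases (h hd).2 with ⟨-, rfl⟩ | ⟨-, h⟩
  exacts [le_rfl, h.le]

theorem trans (h : Descends I μ R d d') (h' : Descends I μ R' d' d'') :
    Descends I μ (fun d => R d ∧ R' d) d d'' := by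
  intro hd
  obtain ⟨hd', ⟨hR, rfl⟩ | ⟨hR, lt⟩⟩ := h hd
  · exact (h' hd').imp_right fun h' =>
      h'.imp (fun h' => ⟨⟨hR, h'.1⟩, h'.2⟩) fun h' => ⟨fun h => h'.1 h.2, h'.2⟩
  · exact ⟨(h' hd').1, .inr ⟨fun h => hR h.1, (h'.le hd').trans_lt lt⟩⟩

theorem congr (h : Descends I μ R d d') (hR : R d ↔ R' d) : Descends I μ R' d d' := by
  simpa only [Descends, hR] using h

end Descends

/-! ### Chains -/

theorem isFixedPt_iterate_card {α : Type*} {r : α → α → Prop} [IsStrictOrder α r] {A : Finset α}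
    {f : α → α} (hA : ∀ a ∈ A, f a ∈ A) (hf : ∀ a, f a ≠ a → r (f a) a) {a : α} (ha : a ∈ A) :
    Function.IsFixedPt f (f^[A.card] a) := by
  classical
  have below (m : ℕ) : ∀ a ∈ A, (A.filter (r · a)).card ≤ m → Function.IsFixedPt f (f^[m] a) := by
    induction m with
    | zero =>
      intro a ha hm
      by_contra hfa
      have : f a ∈ A.filter (r · a) := Finset.mem_filter.mpr ⟨hA a ha, hf a hfa⟩
      simp_all
    | succ m ih =>
      intro a ha hm
      rw [Function.iterate_succ_apply]
      by_cases hfa : f a = a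
      · rw [hfa, Function.iterate_fixed hfa]
        exact hfa
      refine ih (f a) (hA a ha) (Nat.le_of_lt_succ (lt_of_lt_of_le (Finset.card_lt_card ?_) hm))
      refine (Finset.ssubset_iff_of_subset fun b hb => ?_).mpr ⟨f a, ?_, ?_⟩
      · rw [Finset.mem_filter] at hb ⊢
        exact ⟨hb.1, _root_.trans hb.2 (hf a hfa)⟩
      · exact Finset.mem_filter.mpr ⟨hA a ha, hf a hfa⟩
      · simp [irrefl (f a)]
  exact below _ a ha (Finset.card_filter_le _ _)

namespace IsAuction

variable {α : Type*} {r : α → α → Prop} [IsStrictOrder α r] {owner : α → Option α} {price : α → ℕ}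
  {lim : ℕ}

theorem comparable_of_iterate_eq (h : IsAuction r lim owner price) {m m' : ℕ} {a b : α}
    (hab : (fun c => (owner c).getD c)^[m] a = (fun c => (owner c).getD c)^[m'] b) :
    a = b ∨ r a b ∨ r b a := by
  let Owns (a b : α) : Prop := a ∈ owner b
  have root_reaches (m : ℕ) (a : α) :
      Relation.ReflTransGen Owns ((fun c => (owner c).getD c)^[m] a) a := by
    induction m generalizing a with
    | zero => exact .refl
    | succ m ih =>
      rw [Function.iterate_succ_apply]
      refine (ih _).trans ?_
      rcases ha : owner a with _ | b
      · exact .refl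
      · exact .single ha
  have owns_le : Owns ≤ r := fun _ _ => h.rel
  have rel_of_reaches {a b : α} (hab : Relation.ReflTransGen Owns a b) : a = b ∨ r a b := by
    rcases Relation.reflTransGen_iff_eq_or_transGen.mp hab with rfl | hab
    · exact .inl rfl
    · exact .inr (Relation.transGen_minimal owns_le _ _ hab)
  rcases Relation.ReflTransGen.total_of_right_unique (r := Owns) (fun _ _ _ => h.unique)
    (hab ▸ root_reaches m a) (root_reaches m' b) with hab | hba
  · exact (rel_of_reaches hab).imp_right .inl
  · exact (rel_of_reaches hba).elim (fun e => .inl e.symm) fun h => .inr (.inr h)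

end IsAuction

/-! ### A loop language on top of random access machines -/

namespace RAM

/-- The variables of loop programs. Variable number `i` is kept in register `i`. -/
inductive Var where
  | res | len | base | aux | nQ | nP | nC | offQ | offP | offC | offF | lim | rounds | sweeps
  | total | own | best | low | carry | iP | jP | iQ | jQ | iR | iT | cur | found | full
  | out | start | mark | count | num
  deriving DecidableEq

/-- The names of the arrays that are interleaved in the memory above the address `base`. -/
inductive Arr where
  | owner | price | root | head | idx | dom | mulQ | mulP | mulD
  deriving DecidableEq

/-- The register of a variable. -/
def Var.reg (x : Var) : ℕ := x.ctorIdx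

/-- The position of the entries of an array within each block of `16` memory cells. -/
def Arr.offset (j : Arr) : ℕ := j.ctorIdx

theorem Var.reg_lt (x : Var) : x.reg < 64 := by cases x <;> decide

theorem Var.reg_injective : Function.Injective Var.reg := by
  have ofNat_reg : Function.LeftInverse Var.ofNat Var.reg := fun x => by cases x <;> rfl
  exact ofNat_reg.injective

theorem Arr.offset_lt (j : Arr) : j.offset < 16 := by cases j <;> decide

theorem Arr.offset_injective : Function.Injective Arr.offset := by
  have ofNat_offset : Function.LeftInverse Arr.ofNat Arr.offset := fun j => by cases j <;> rfl
  exact ofNat_offset.injective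

/-- The states of loop programs: the values of the variables and the contents of the memory. -/
@[ext]
structure St where
  v : Var → ℕ
  m : ℕ → ℕ

namespace St

/-- Assignment to a variable. -/
def setv (s : St) (x : Var) (n : ℕ) : St := ⟨Function.update s.v x n, s.m⟩

/-- Assignment to a memory cell. -/
def sto (s : St) (a n : ℕ) : St := ⟨s.v, Function.update s.m a n⟩

/-- Entry `i` of the array `j`: the arrays share the memory above `base` with a stride of `16`. -/
def arr (s : St) (j : Arr) (i : ℕ) : ℕ := s.m (s.v .base + 16 * i + j.offset)

/-- Assignment to entry `i` of the array `j`. -/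
def aset (s : St) (j : Arr) (i n : ℕ) : St := s.sto (s.v .base + 16 * i + j.offset) n

variable (s : St)

@[simp] theorem setv_v (x y : Var) (n : ℕ) : (s.setv x n).v y = if y = x then n else s.v y := by
  simp only [setv, Function.update_apply]

@[simp] theorem setv_m (x : Var) (n : ℕ) : (s.setv x n).m = s.m := rfl

@[simp] theorem sto_v (a n : ℕ) : (s.sto a n).v = s.v := rfl

@[simp] theorem sto_m (a n b : ℕ) : (s.sto a n).m b = if b = a then n else s.m b := by
  simp only [sto, Function.update_apply]

@[simp] theorem setv_arr {x : Var} (hx : x ≠ .base) (n : ℕ) : (s.setv x n).arr = s.arr := by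
  funext j i
  simp [arr, hx.symm]

@[simp] theorem aset_v (j : Arr) (i n : ℕ) : (s.aset j i n).v = s.v := rfl

@[simp] theorem aset_arr_self (j : Arr) (i n : ℕ) :
    (s.aset j i n).arr j = Function.update (s.arr j) i n := by
  funext i'
  simp [arr, aset, Function.update_apply]

@[simp] theorem aset_arr_ne {j j' : Arr} (h : j' ≠ j) (i n : ℕ) :
    (s.aset j i n).arr j' = s.arr j' := by
  funext i'
  have := j.offset_lt
  have := j'.offset_lt
  have := Arr.offset_injective.ne h
  simp only [arr, aset, sto_v, sto_m]
  exact if_neg (by omega)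

theorem aset_m (j : Arr) (i n : ℕ) {a : ℕ} (h : a < s.v .base) : (s.aset j i n).m a = s.m a := by
  simp only [aset, sto_m]
  exact if_neg (by omega)

end St

/-- Expressions; as a condition, an expression holds if its value is not zero. -/
inductive Exp where
  | c (n : ℕ)
  | v (x : Var)
  | add (e f : Exp)
  | sub (e f : Exp)
  | get (e : Exp)

namespace Exp

/-- The value of an expression. -/
def eval (s : St) : Exp → ℕ
  | c n => n
  | v x => s.v x
  | add e f => e.eval s + f.eval s
  | sub e f => e.eval s - f.eval s
  | get e => s.m (e.eval s)

/-- The expression is true as a condition. -/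
abbrev Holds (e : Exp) (s : St) : Prop := e.eval s ≠ 0

def double (e : Exp) : Exp := add e e

/-- The address of entry `e` of the array `j`. -/
def addr (j : Arr) (e : Exp) : Exp :=
  add (add (v .base) e.double.double.double.double) (c j.offset)

/-- Entry `e` of the array `j`. -/
def aget (j : Arr) (e : Exp) : Exp := get (addr j e)

def not (e : Exp) : Exp := sub (c 1) e

def or (e f : Exp) : Exp := add e f

def and (e f : Exp) : Exp := not (or (not e) (not f))

def iff (e f : Exp) : Exp := or (and e f) (and (not e) (not f))

def lt (e f : Exp) : Exp := sub f e

def eq (e f : Exp) : Exp := not (or (lt e f) (lt f e))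

variable (s : St) (e f : Exp)

@[simp] theorem eval_c (n : ℕ) : (c n).eval s = n := rfl
@[simp] theorem eval_v (x : Var) : (v x).eval s = s.v x := rfl
@[simp] theorem eval_add : (add e f).eval s = e.eval s + f.eval s := rfl
@[simp] theorem eval_sub : (sub e f).eval s = e.eval s - f.eval s := rfl
@[simp] theorem eval_get : (get e).eval s = s.m (e.eval s) := rfl

theorem eval_addr (j : Arr) : (addr j e).eval s = s.v .base + 16 * e.eval s + j.offset := by
  simp only [addr, double, eval_add, eval_v, eval_c]
  omega

@[simp] theorem eval_aget (j : Arr) : (aget j e).eval s = s.arr j (e.eval s) := by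
  simp only [aget, eval_get, eval_addr, St.arr]

@[simp] theorem holds_not : (not e).Holds s ↔ ¬ e.Holds s := by
  simp only [Holds, not, eval_sub, eval_c]
  omega

@[simp] theorem holds_or : (or e f).Holds s ↔ e.Holds s ∨ f.Holds s := by
  simp only [Holds, or, eval_add]
  omega

@[simp] theorem holds_and : (and e f).Holds s ↔ e.Holds s ∧ f.Holds s := by
  simp only [and, holds_not, holds_or, not_or, not_not]

@[simp] theorem holds_iff : (iff e f).Holds s ↔ (e.Holds s ↔ f.Holds s) := by
  simp only [iff, holds_and, holds_or, holds_not]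
  tauto

@[simp] theorem holds_lt : (lt e f).Holds s ↔ e.eval s < f.eval s := by
  simp only [Holds, lt, eval_sub]
  omega

@[simp] theorem holds_eq : (eq e f).Holds s ↔ e.eval s = f.eval s := by
  simp only [eq, holds_not, holds_or, holds_lt]
  omega

end Exp

/-- Loop programs. -/
inductive Cmd where
  | skip
  | assign (x : Var) (e : Exp)
  | store (e f : Exp)
  | aset (j : Arr) (e f : Exp)
  | seq (c d : Cmd)
  /-- if `e` holds then `c` else `d` -/
  | ite (e : Exp) (c d : Cmd)
  /-- for `x = 0, …, y - 1` do `c`; the value of `y` is read once, and the loop counter is not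
  affected by assignments to `x` -/
  | loop (x y : Var) (c : Cmd)

/-- The state before round `i` of a loop with counter `x` and body `f`. -/
def St.iter (f : St → St) (x : Var) (s : St) : ℕ → St
  | 0 => s
  | i + 1 => f ((s.iter f x i).setv x i)

namespace Cmd

/-- The state in which a program terminates. -/
def run : Cmd → St → St
  | skip, s => s
  | assign x e, s => s.setv x (e.eval s)
  | store e f, s => s.sto (e.eval s) (f.eval s)
  | aset j e f, s => s.aset j (e.eval s) (f.eval s)
  | seq c d, s => d.run (c.run s)
  | ite e c d, s => if e.Holds s then c.run s else d.run s
  | .loop x y c, s => s.iter c.run x (s.v y)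

/-- The number of executed commands and tests. -/
def cost : Cmd → St → ℕ
  | skip, _ => 0
  | assign _ _, _ => 1
  | store _ _, _ => 1
  | aset _ _ _, _ => 1
  | seq c d, s => c.cost s + d.cost (c.run s)
  | ite e c d, s => 1 + if e.Holds s then c.cost s else d.cost s
  | .loop x y c, s =>
      1 + ∑ i ∈ Finset.range (s.v y), (1 + c.cost ((s.iter c.run x i).setv x i))

/-- Sequential composition of a list of programs. -/
def block : List Cmd → Cmd
  | [] => skip
  | c :: l => seq c (block l)

section run

variable (s : St)

@[simp] theorem run_skip : skip.run s = s := rfl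

@[simp] theorem run_assign (x : Var) (e : Exp) : (assign x e).run s = s.setv x (e.eval s) := rfl

@[simp] theorem run_store (e f : Exp) : (store e f).run s = s.sto (e.eval s) (f.eval s) := rfl

@[simp] theorem run_aset (j : Arr) (e f : Exp) :
    (aset j e f).run s = s.aset j (e.eval s) (f.eval s) := rfl

@[simp] theorem run_ite (e : Exp) (c d : Cmd) :
    (ite e c d).run s = if e.Holds s then c.run s else d.run s := rfl

@[simp] theorem run_block_nil : (block []).run s = s := rfl

@[simp] theorem run_block_cons (c : Cmd) (l : List Cmd) :
    (block (c :: l)).run s = (block l).run (c.run s) := rfl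

end run

/-! ### Frames -/

/-- Does the program assign to the variable `x`? -/
def writes (x : Var) : Cmd → Bool
  | skip => false
  | assign y _ => y = x
  | store _ _ => false
  | aset _ _ _ => false
  | seq c d => c.writes x || d.writes x
  | ite _ c d => c.writes x || d.writes x
  | .loop y _ c => y = x || c.writes x

/-- Does the program write to the array `j`? -/
def writesArr (j : Arr) : Cmd → Bool
  | aset j' _ _ => j' = j
  | seq c d => c.writesArr j || d.writesArr j
  | ite _ c d => c.writesArr j || d.writesArr j
  | .loop _ _ c => c.writesArr j
  | _ => false

/-- Does the program change the memory by `store`, or the variable `base`? -/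
def raw : Cmd → Bool
  | assign y _ => y = .base
  | store _ _ => true
  | seq c d => c.raw || d.raw
  | ite _ c d => c.raw || d.raw
  | .loop y _ c => y = .base || c.raw
  | _ => false

/-- The states `s` and `s'` agree on all that is not written by the program `c`. -/
structure Frame (c : Cmd) (s s' : St) : Prop where
  v : ∀ x, c.writes x = false → s'.v x = s.v x
  base : c.raw = false → s'.v .base = s.v .base
  m : c.raw = false → ∀ a < s.v .base, s'.m a = s.m a
  arr : c.raw = false → ∀ j, c.writesArr j = false → s'.arr j = s.arr j

namespace Frame

variable {c d : Cmd} {s s₁ s₂ s₃ : St}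

theorem refl (c : Cmd) (s : St) : Frame c s s :=
  ⟨fun _ _ => rfl, fun _ => rfl, fun _ _ _ => rfl, fun _ _ _ => rfl⟩

theorem trans (h₁ : Frame c s₁ s₂) (h₂ : Frame c s₂ s₃) : Frame c s₁ s₃ where
  v x hx := (h₂.v x hx).trans (h₁.v x hx)
  base hc := (h₂.base hc).trans (h₁.base hc)
  m hc a ha := (h₂.m hc a (by rwa [h₁.base hc])).trans (h₁.m hc a ha)
  arr hc j hj := (h₂.arr hc j hj).trans (h₁.arr hc j hj)

theorem mono (h : Frame c s₁ s₂) (hv : ∀ x, d.writes x = false → c.writes x = false)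
    (hr : d.raw = false → c.raw = false)
    (ha : ∀ j, d.writesArr j = false → c.writesArr j = false) : Frame d s₁ s₂ where
  v x hx := h.v x (hv x hx)
  base hc := h.base (hr hc)
  m hc := h.m (hr hc)
  arr hc j hj := h.arr (hr hc) j (ha j hj)

theorem setv {x : Var} (n : ℕ) (hv : ∀ y, c.writes y = false → x ≠ y)
    (hr : c.raw = false → x ≠ .base) : Frame c s (s.setv x n) where
  v y hy := by rw [St.setv_v, if_neg (hv y hy).symm]
  base hc := by rw [St.setv_v, if_neg (hr hc).symm]
  m _ _ _ := rfl
  arr hc j _ := by rw [St.setv_arr _ (hr hc)]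

theorem iter (x y : Var) (hc : ∀ s, Frame c s (c.run s)) (i : ℕ) :
    Frame (.loop x y c) s (s.iter c.run x i) := by
  induction i with
  | zero => exact refl _ s
  | succ i ih =>
    refine ih.trans (trans (setv i ?_ ?_) ((hc _).mono ?_ ?_ ?_)) <;>
      simp +contextual [writes, raw, writesArr]

theorem run (c : Cmd) (s : St) : Frame c s (c.run s) := by
  induction c generalizing s with
  | skip => exact refl _ s
  | assign x e => exact setv _ (by simp [writes]) (by simp [raw])
  | store e f => exact ⟨fun _ _ => rfl, fun _ => rfl, nofun, nofun⟩
  | aset j e f =>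
    refine ⟨fun _ _ => rfl, fun _ => rfl, fun _ a ha => St.aset_m _ _ _ _ ha, fun _ j' hj => ?_⟩
    exact St.aset_arr_ne _ (Ne.symm (of_decide_eq_false hj)) _ _
  | seq c d ihc ihd =>
    refine trans ((ihc s).mono ?_ ?_ ?_) ((ihd _).mono ?_ ?_ ?_) <;>
      simp +contextual [writes, raw, writesArr]
  | ite e c d ihc ihd =>
    rw [run_ite]
    split_ifs
    · exact (ihc s).mono (by simp +contextual [writes]) (by simp +contextual [raw])
        (by simp +contextual [writesArr])
    · exact (ihd s).mono (by simp +contextual [writes]) (by simp +contextual [raw])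
        (by simp +contextual [writesArr])
  | loop x y c ih => exact iter x y ih _

theorem loop_setv {x y : Var} (h : Frame (.loop x y c) s s₁) (i : ℕ) :
    Frame (.loop x y c) s (s₁.setv x i) := by
  refine h.trans (.setv i ?_ ?_) <;> simp +contextual [writes, raw]

end Frame

variable {c : Cmd} {s : St}

theorem run_v {x : Var} (h : c.writes x = false) : (c.run s).v x = s.v x :=
  (Frame.run c s).v x h

theorem run_m (h : c.raw = false) {a : ℕ} (ha : a < s.v .base) : (c.run s).m a = s.m a :=
  (Frame.run c s).m h a ha

theorem run_arr (h : c.raw = false) {j : Arr} (hj : c.writesArr j = false) :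
    (c.run s).arr j = s.arr j :=
  (Frame.run c s).arr h j hj

theorem run_loop_induction {x y : Var} (I : ℕ → St → Prop) (zero : I 0 s)
    (succ : ∀ i s', i < s.v y → Frame (.loop x y c) s s' → I i s' →
      I (i + 1) (c.run (s'.setv x i))) :
    I (s.v y) ((Cmd.loop x y c).run s) := by
  have all_rounds : ∀ i ≤ s.v y, I i (s.iter c.run x i) := by
    intro i
    induction i with
    | zero => exact fun _ => zero
    | succ i ih =>
      exact fun hi => succ i _ hi (.iter x y (Frame.run c) i) (ih (Nat.le_of_succ_le hi))
  exact all_rounds _ le_rfl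

/-! ### Running times -/

/-- Is `y` the bound of a loop of the program? -/
def bounds (y : Var) : Cmd → Bool
  | seq c d => c.bounds y || d.bounds y
  | ite _ c d => c.bounds y || d.bounds y
  | .loop _ z c => z = y || c.bounds y
  | _ => false

/-- The number of constructors, with loops counted with weight two. -/
def size : Cmd → ℕ
  | seq c d => c.size + d.size
  | ite _ c d => 1 + (c.size + d.size)
  | .loop _ _ c => c.size + 2
  | _ => 1

/-- The largest product of loop bounds along a nest of loops, with `σ y` in place of `y`. -/
def nest (σ : Var → ℕ) : Cmd → ℕ
  | seq c d => max (c.nest σ) (d.nest σ)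
  | ite _ c d => max (c.nest σ) (d.nest σ)
  | .loop _ y c => σ y * c.nest σ
  | _ => 1

theorem one_le_nest {σ : Var → ℕ} (h : ∀ y, c.bounds y = true → 1 ≤ σ y) : 1 ≤ c.nest σ := by
  induction c with
  | seq c d ihc _ | ite _ c d ihc _ =>
    exact le_max_of_le_left (ihc fun y hy => h y (by simp [bounds, hy]))
  | loop x y c ih =>
    exact Nat.mul_pos (h y (by simp [bounds])) (ih fun z hz => h z (by simp [bounds, hz]))
  | _ => exact le_rfl

theorem cost_loop_le {x y : Var} {B : ℕ}
    (h : ∀ i, c.cost ((s.iter c.run x i).setv x i) ≤ B) :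
    (Cmd.loop x y c).cost s ≤ 1 + s.v y * (1 + B) := by
  refine Nat.add_le_add_left ((Finset.sum_le_card_nsmul _ _ _ fun i _ =>
    Nat.add_le_add_left (h i) 1).trans ?_) 1
  simp

theorem cost_ite_le_add {e : Exp} {B B' : ℕ} (hc : c.cost s ≤ B) (hd : d.cost s ≤ B') :
    (ite e c d).cost s ≤ 1 + (B + B') := by
  refine Nat.add_le_add_left ?_ 1
  split_ifs
  exacts [le_add_right hc, le_add_left hd]

theorem iter_setv_v {x y : Var} (hy : y ≠ x) (hc : c.writes y = false) (i : ℕ) :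
    ((s.iter c.run x i).setv x i).v y = s.v y := by
  rw [St.setv_v, if_neg hy]
  exact (Frame.iter (s := s) x x (Frame.run c) i).v y (by simp [writes, hc, hy.symm])

theorem cost_le {σ : Var → ℕ} (hc : ∀ y, c.bounds y = true → c.writes y = false)
    (h₁ : ∀ y, c.bounds y = true → 1 ≤ σ y) (hs : ∀ y, c.bounds y = true → s.v y ≤ σ y) :
    c.cost s ≤ c.size * c.nest σ := by
  induction c generalizing s with
  | seq c d ihc ihd =>
    simp only [bounds, writes, Bool.or_eq_true, Bool.or_eq_false_iff] at hc h₁ hs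
    have cost_c := @ihc s (fun y hy => (hc y (.inl hy)).1) (fun y hy => h₁ y (.inl hy))
      fun y hy => hs y (.inl hy)
    have cost_d := @ihd (c.run s) (fun y hy => (hc y (.inr hy)).2) (fun y hy => h₁ y (.inr hy))
      fun y hy => (run_v (hc y (.inr hy)).1).trans_le (hs y (.inr hy))
    calc c.cost s + d.cost (c.run s) ≤ c.size * c.nest σ + d.size * d.nest σ := by gcongr
      _ ≤ c.size * (c.seq d).nest σ + d.size * (c.seq d).nest σ := by
        gcongr
        exacts [le_max_left _ _, le_max_right _ _]
      _ = (c.seq d).size * (c.seq d).nest σ := (add_mul _ _ _).symm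
  | ite e c d ihc ihd =>
    have one_le := one_le_nest h₁
    simp only [bounds, writes, Bool.or_eq_true, Bool.or_eq_false_iff] at hc h₁ hs
    have cost_c := @ihc s (fun y hy => (hc y (.inl hy)).1) (fun y hy => h₁ y (.inl hy))
      fun y hy => hs y (.inl hy)
    have cost_d := @ihd s (fun y hy => (hc y (.inr hy)).2) (fun y hy => h₁ y (.inr hy))
      fun y hy => hs y (.inr hy)
    calc (ite e c d).cost s ≤ 1 + (c.size * c.nest σ + d.size * d.nest σ) :=
          cost_ite_le_add cost_c cost_d
      _ ≤ (ite e c d).nest σ + (c.size * (ite e c d).nest σ + d.size * (ite e c d).nest σ) := by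
          gcongr
          exacts [le_max_left _ _, le_max_right _ _]
      _ = (ite e c d).size * (ite e c d).nest σ := by simp only [size]; ring
  | loop x y c ih =>
    simp only [bounds, writes, Bool.or_eq_true, Bool.or_eq_false_iff, decide_eq_true_eq,
      decide_eq_false_iff_not] at hc h₁ hs
    have one_le : 1 ≤ c.nest σ := one_le_nest fun z hz => h₁ z (.inr hz)
    have round (i : ℕ) : c.cost ((s.iter c.run x i).setv x i) ≤ c.size * c.nest σ := by
      refine ih (fun z hz => (hc z (.inr hz)).2) (fun z hz => h₁ z (.inr hz)) fun z hz => ?_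
      rw [iter_setv_v (Ne.symm (hc z (.inr hz)).1) (hc z (.inr hz)).2]
      exact hs z (.inr hz)
    have one_le_loop : 1 ≤ σ y * c.nest σ := Nat.mul_pos (h₁ y (.inl rfl)) one_le
    calc (Cmd.loop x y c).cost s ≤ 1 + s.v y * (1 + c.size * c.nest σ) := cost_loop_le round
      _ ≤ σ y * c.nest σ + σ y * (c.nest σ + c.size * c.nest σ) := by
          gcongr
          exact hs y (.inl rfl)
      _ = (Cmd.loop x y c).size * (Cmd.loop x y c).nest σ := by simp only [size, nest]; ring
  | _ => exact Nat.le_of_ble_eq_true rfl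

end Cmd

/-! ### Compilation -/

section Compilation

/-- The code that computes the value of an expression in register `64 + d`, with the registers from
`64 + d` on as scratch space. -/
def Exp.code : Exp → ℕ → List Instr
  | c n, d => [.const (64 + d) n]
  | v x, d => [.copy (64 + d) x.reg]
  | add e f, d => e.code d ++ (f.code (d + 1) ++ [.add (64 + d) (64 + d) (64 + (d + 1))])
  | sub e f, d => e.code d ++ (f.code (d + 1) ++ [.sub (64 + d) (64 + d) (64 + (d + 1))])
  | get e, d => e.code d ++ [.load (64 + d) (64 + d)]

/-- The code of `M[e] := f`. -/
def storeCode (e f : Exp) (d : ℕ) : List Instr :=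
  e.code d ++ (f.code (d + 1) ++ [.store (64 + d) (64 + (d + 1))])

/-- The code of a loop at address `p`, for the code `L` of its body; the registers `64 + d` and
`64 + (d + 1)` hold the bound and the counter. -/
def loopCode (x y : Var) (L : List Instr) (d p : ℕ) : List Instr :=
  [.copy (64 + d) y.reg, .const (64 + (d + 1)) 0] ++
    ([.sub (64 + (d + 2)) (64 + d) (64 + (d + 1)), .jumpZero (64 + (d + 2)) (p + L.length + 8),
      .copy x.reg (64 + (d + 1))] ++
    (L ++ [.const (64 + (d + 2)) 1, .add (64 + (d + 1)) (64 + (d + 1)) (64 + (d + 2)),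
      .jump (p + 2)]))

/-- The code of a program, to be placed at address `p`, with the registers from `64 + d` on as
scratch space. -/
def Cmd.code : Cmd → ℕ → ℕ → List Instr
  | skip, _, _ => []
  | assign x e, d, _ => e.code d ++ [.copy x.reg (64 + d)]
  | store e f, d, _ => storeCode e f d
  | aset j e f, d, _ => storeCode (.addr j e) f d
  | seq c₁ c₂, d, p => c₁.code d p ++ c₂.code d (p + (c₁.code d p).length)
  | ite e c₁ c₂, d, p =>
      let p₁ := p + (e.code d).length + 1
      let p₂ := p₁ + (c₁.code d p₁).length + 1
      e.code d ++ ([.jumpZero (64 + d) p₂] ++ (c₁.code d p₁ ++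
        ([.jump (p₂ + (c₂.code d p₂).length)] ++ c₂.code d p₂)))
  | .loop x y c, d, p => loopCode x y (c.code (d + 2) (p + 5)) d p

namespace Program

/-- The code `L` is in the program `A` at address `p`. -/
def HasCode (A : Program) (p : ℕ) (L : List Instr) : Prop :=
  ∀ i (h : i < L.length), A[p + i]? = some L[i]

/-- From `k`, the program `A` reaches `k'` in at most `T` steps. -/
def Reaches (A : Program) (T : ℕ) (k k' : Config) : Prop := ∃ t ≤ T, A.step^[t] k = k'

variable {A : Program}

theorem HasCode.left {p : ℕ} {L L' : List Instr} (h : A.HasCode p (L ++ L')) : A.HasCode p L :=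
  fun i hi => by rw [h i (by simp; omega), List.getElem_append_left hi]

theorem HasCode.right {p p' : ℕ} {L L' : List Instr} (h : A.HasCode p (L ++ L'))
    (hp : p' = p + L.length := by rfl) : A.HasCode p' L' := by
  intro i hi
  subst hp
  rw [add_assoc, h (L.length + i) (by simp; omega), List.getElem_append_right (by omega)]
  simp

theorem Reaches.refl (k : Config) : A.Reaches 0 k k := ⟨0, le_rfl, rfl⟩

theorem Reaches.trans {T T' : ℕ} {k₁ k₂ k₃ : Config} (h : A.Reaches T k₁ k₂)
    (h' : A.Reaches T' k₂ k₃) : A.Reaches (T + T') k₁ k₃ := by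
  obtain ⟨t, ht, rfl⟩ := h
  obtain ⟨t', ht', rfl⟩ := h'
  exact ⟨t' + t, by omega, Function.iterate_add_apply _ _ _ _⟩

theorem Reaches.mono {T T' : ℕ} {k k' : Config} (h : A.Reaches T k k') (hT : T ≤ T') :
    A.Reaches T' k k' :=
  let ⟨t, ht, e⟩ := h
  ⟨t, ht.trans hT, e⟩

theorem HasCode.reaches {L : List Instr} {p : ℕ} (h : A.HasCode p L) (i : ℕ) (hi : i < L.length)
    {k k' : Config} (hp : k.pc = p + i) (hk : L[i].exec k = k') : A.Reaches 1 k k' := by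
  refine ⟨1, le_rfl, ?_⟩
  rw [Function.iterate_one, step, hp, h i hi, ← hk]

/-- Started at `p` in a configuration that represents `s`, the program `A` arrives at `p'` in a
configuration that represents `s'` after at most `T` steps, without a change to the registers
`64, …, 63 + d`. -/
def Executes (A : Program) (d p p' T : ℕ) (s s' : St) : Prop :=
  ∀ r : ℕ → ℕ, (∀ x : Var, r x.reg = s.v x) → ∃ r' : ℕ → ℕ, (∀ x : Var, r' x.reg = s'.v x) ∧
    A.Reaches T ⟨p, r, s.m⟩ ⟨p', r', s'.m⟩ ∧ ∀ i, 64 ≤ i → i < 64 + d → r' i = r i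

theorem Executes.trans {d p₁ p₂ p₃ T T' : ℕ} {s₁ s₂ s₃ : St} (h : A.Executes d p₁ p₂ T s₁ s₂)
    (h' : A.Executes d p₂ p₃ T' s₂ s₃) : A.Executes d p₁ p₃ (T + T') s₁ s₃ := by
  intro r₁ vars₁
  obtain ⟨r₂, vars₂, reach, keep⟩ := h r₁ vars₁
  obtain ⟨r₃, vars₃, reach', keep'⟩ := h' r₂ vars₂
  exact ⟨r₃, vars₃, reach.trans reach', fun i h64 hi => (keep' i h64 hi).trans (keep i h64 hi)⟩

theorem Executes.mono {d p p' T T' : ℕ} {s s' : St} (h : A.Executes d p p' T s s')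
    (hT : T ≤ T') : A.Executes d p p' T' s s' := fun r vars =>
  let ⟨r', vars', reach, keep⟩ := h r vars
  ⟨r', vars', reach.mono hT, keep⟩

end Program

open Program

theorem Var.reg_lt_add (x : Var) (d : ℕ) : x.reg < 64 + d :=
  x.reg_lt.trans_le (Nat.le_add_right _ _)

theorem Var.reg_ne (x : Var) (d : ℕ) : x.reg ≠ 64 + d := by
  have := x.reg_lt
  omega

/-- The program `A` computes the value of `e` in register `64 + d` on its way from `p` to `p'`. -/
def Program.Evaluates (A : Program) (e : Exp) (d p p' T : ℕ) (s : St) : Prop :=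
  ∀ r : ℕ → ℕ, (∀ x : Var, r x.reg = s.v x) → ∃ r' : ℕ → ℕ,
    A.Reaches T ⟨p, r, s.m⟩ ⟨p', r', s.m⟩ ∧ r' (64 + d) = e.eval s ∧ ∀ i < 64 + d, r' i = r i

theorem Exp.code_evaluates {A : Program} {s : St} (e : Exp) (d p : ℕ)
    (hA : A.HasCode p (e.code d)) :
    A.Evaluates e d p (p + (e.code d).length) (e.code d).length s := by
  induction e generalizing d p with
  | c n =>
    exact fun r _ => ⟨_, hA.reaches 0 Nat.one_pos rfl rfl, Function.update_self _ _ _,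
      fun i hi => Function.update_of_ne hi.ne _ _⟩
  | v x =>
    exact fun r vars => ⟨_, hA.reaches 0 Nat.one_pos rfl rfl,
      (Function.update_self _ _ _).trans (vars x),
      fun i hi => Function.update_of_ne hi.ne _ _⟩
  | add e f ihe ihf | sub e f ihe ihf =>
    simp only [code, List.length_append, List.length_singleton, ← add_assoc]
    intro r vars
    obtain ⟨r₁, reach₁, val₁, keep₁⟩ := ihe d p hA.left r vars
    obtain ⟨r₂, reach₂, val₂, keep₂⟩ := ihf (d + 1) _ hA.right.left r₁
      fun x => (keep₁ _ (x.reg_lt_add d)).trans (vars x)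
    refine ⟨_, (reach₁.trans reach₂).trans (hA.right.right.reaches 0 Nat.one_pos rfl rfl), ?_,
      fun i hi => ?_⟩
    · simp [val₁, val₂, keep₂ (64 + d) (by omega)]
    · exact (Function.update_of_ne hi.ne _ _).trans ((keep₂ i (by omega)).trans (keep₁ i hi))
  | get e ihe =>
    simp only [code, List.length_append, List.length_singleton, ← add_assoc]
    intro r vars
    obtain ⟨r₁, reach₁, val₁, keep₁⟩ := ihe d p hA.left r vars
    refine ⟨_, reach₁.trans (hA.right.reaches 0 Nat.one_pos rfl rfl), ?_, fun i hi => ?_⟩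
    · simp [val₁]
    · exact (Function.update_of_ne hi.ne _ _).trans (keep₁ i hi)

variable {A : Program}

theorem storeCode_executes {s : St} (e f : Exp) (d p : ℕ) (hA : A.HasCode p (storeCode e f d)) :
    A.Executes d p (p + (storeCode e f d).length) (storeCode e f d).length s
      (s.sto (e.eval s) (f.eval s)) := by
  simp only [storeCode, List.length_append, List.length_singleton] at hA ⊢
  rw [← add_assoc p, ← add_assoc (p + _), ← add_assoc (e.code d).length]
  intro r vars
  obtain ⟨r₁, reach₁, val₁, keep₁⟩ := e.code_evaluates d p hA.left r vars
  have vars₁ (x : Var) : r₁ x.reg = s.v x := (keep₁ _ (x.reg_lt_add d)).trans (vars x)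
  obtain ⟨r₂, reach₂, val₂, keep₂⟩ := f.code_evaluates (d + 1) _ hA.right.left r₁ vars₁
  refine ⟨r₂, fun x => (keep₂ _ (x.reg_lt_add _)).trans (vars₁ x),
    (reach₁.trans reach₂).trans (hA.right.right.reaches 0 Nat.one_pos rfl ?_),
    fun i _ hi => (keep₂ i (by omega)).trans (keep₁ i hi)⟩
  simp only [List.getElem_cons_zero, Instr.exec, St.sto, val₂, keep₂ (64 + d) (by omega), val₁]

theorem assignCode_executes {s : St} (x : Var) (e : Exp) (d p : ℕ)
    (hA : A.HasCode p (e.code d ++ [.copy x.reg (64 + d)])) :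
    A.Executes d p (p + (e.code d).length + 1) ((e.code d).length + 1) s
      (s.setv x (e.eval s)) := by
  intro r vars
  obtain ⟨r₁, reach₁, val₁, keep₁⟩ := e.code_evaluates d p hA.left r vars
  refine ⟨Function.update r₁ x.reg (e.eval s), fun y => ?_,
    reach₁.trans (hA.right.reaches 0 Nat.one_pos rfl ?_), fun i h64 hi => ?_⟩
  · rw [Function.update_apply, St.setv_v, keep₁ _ (y.reg_lt_add d), vars]
    simp only [Var.reg_injective.eq_iff]
  · simp [Instr.exec, val₁]
  · rw [Function.update_of_ne (x.reg_lt.trans_le h64).ne', keep₁ i hi]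

theorem iteCode_executes {s s' : St} {e : Exp} {L₁ L₂ : List Instr} {d p p₁ p₂ p₃ T : ℕ}
    (hA : A.HasCode p (e.code d ++ ([.jumpZero (64 + d) p₂] ++ (L₁ ++ ([.jump p₃] ++ L₂)))))
    (hp₁ : p₁ = p + (e.code d).length + 1) (hp₂ : p₂ = p₁ + L₁.length + 1)
    (h₁ : e.Holds s → A.Executes d p₁ (p₁ + L₁.length) T s s')
    (h₂ : ¬ e.Holds s → A.Executes d p₂ p₃ T s s') :
    A.Executes d p p₃ ((e.code d).length + 2 + T) s s' := by
  subst hp₁ hp₂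
  intro r vars
  obtain ⟨r₁, reach₁, val₁, keep₁⟩ := e.code_evaluates d p hA.left r vars
  have vars₁ (x : Var) : r₁ x.reg = s.v x := (keep₁ _ (x.reg_lt_add d)).trans (vars x)
  by_cases he : e.Holds s
  · obtain ⟨r₂, vars₂, reach₂, keep₂⟩ := h₁ he r₁ vars₁
    have test : A.Reaches 1 ⟨p + (e.code d).length, r₁, s.m⟩ ⟨_, r₁, s.m⟩ :=
      hA.right.left.reaches 0 Nat.one_pos rfl (by simp [Instr.exec, val₁, he]; rfl)
    have jump : A.Reaches 1 ⟨_, r₂, s'.m⟩ ⟨p₃, r₂, s'.m⟩ :=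
      hA.right.right.right.left.reaches 0 Nat.one_pos rfl (by simp [Instr.exec])
    exact ⟨r₂, vars₂, (((reach₁.trans test).trans reach₂).trans jump).mono (by omega),
      fun i h64 hi => (keep₂ i h64 hi).trans (keep₁ i hi)⟩
  · obtain ⟨r₂, vars₂, reach₂, keep₂⟩ := h₂ he r₁ vars₁
    have test : A.Reaches 1 ⟨p + (e.code d).length, r₁, s.m⟩ ⟨_, r₁, s.m⟩ :=
      hA.right.left.reaches 0 Nat.one_pos rfl (by simp [Instr.exec, val₁, not_not.mp he]; rfl)
    exact ⟨r₂, vars₂, ((reach₁.trans test).trans reach₂).mono (by omega),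
      fun i h64 hi => (keep₂ i h64 hi).trans (keep₁ i hi)⟩

theorem loopCode_round {x y : Var} {L : List Instr} {d p N i T : ℕ} {s s' : St} {r : ℕ → ℕ}
    (hA : A.HasCode p (loopCode x y L d p)) (hi : i < N)
    (body : A.Executes (d + 2) (p + 5) (p + 5 + L.length) T (s.setv x i) s')
    (vars : ∀ z : Var, r z.reg = s.v z) (bound : r (64 + d) = N) (counter : r (64 + (d + 1)) = i) :
    ∃ r' : ℕ → ℕ, A.Reaches (T + 6) ⟨p + 2, r, s.m⟩ ⟨p + 2, r', s'.m⟩ ∧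
      (∀ z : Var, r' z.reg = s'.v z) ∧ r' (64 + d) = N ∧ r' (64 + (d + 1)) = i + 1 ∧
      ∀ j, 64 ≤ j → j < 64 + d → r' j = r j := by
  have := x.reg_lt
  set r₁ := Function.update (Function.update r (64 + (d + 2)) (N - i)) x.reg i with hr₁
  have head : A.Reaches 3 ⟨p + 2, r, s.m⟩ ⟨p + 5, r₁, s.m⟩ := by
    have code := hA.right.left
    have test : A.Reaches 2 ⟨p + 2, r, s.m⟩
        ⟨p + 4, Function.update r (64 + (d + 2)) (N - i), s.m⟩ :=
      (code.reaches 0 (by simp) rfl rfl).trans (code.reaches 1 (by simp) rfl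
        (by simp [Instr.exec, bound, counter, Nat.sub_ne_zero_of_lt hi]))
    exact test.trans (code.reaches 2 (by simp) rfl (by simp [Instr.exec, hr₁, counter]))
  obtain ⟨r₂, vars₂, reach, keep⟩ := body r₁ fun z => by
    simp [hr₁, Function.update_apply, Var.reg_injective.eq_iff, z.reg_ne, vars]
  set r₃ := Function.update (Function.update r₂ (64 + (d + 2)) 1) (64 + (d + 1)) (i + 1) with hr₃
  have keep_counter : r₂ (64 + (d + 1)) = i := by
    rw [keep _ (by omega) (by omega), hr₁, Function.update_of_ne (by omega),
      Function.update_of_ne (by omega), counter]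
  have keep_lower (j : ℕ) (h64 : 64 ≤ j) (hj : j < 64 + (d + 1)) : r₃ j = r j := by
    rw [hr₃, Function.update_of_ne (by omega), Function.update_of_ne (by omega),
      keep _ h64 (by omega), hr₁, Function.update_of_ne (by omega),
      Function.update_of_ne (by omega)]
  have tail : A.Reaches 3 ⟨p + 5 + L.length, r₂, s'.m⟩ ⟨p + 2, r₃, s'.m⟩ := by
    have code := hA.right.right.right
    refine ((code.reaches 0 (by simp) rfl rfl).trans (code.reaches 1 (by simp) rfl rfl)).trans
      (code.reaches 2 (by simp) rfl ?_)
    simp [Instr.exec, hr₃, keep_counter]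
  exact ⟨r₃, ((head.trans reach).trans tail).mono (by omega),
    fun z => by simp [hr₃, z.reg_ne, vars₂],
    by rw [keep_lower _ (by omega) (by omega), bound], by simp [hr₃],
    fun j h64 hj => keep_lower j h64 (by omega)⟩

theorem loopCode_executes {x y : Var} {L : List Instr} {d p : ℕ} {s : St} {f : St → St} {T : ℕ → ℕ}
    (hA : A.HasCode p (loopCode x y L d p))
    (body : ∀ i, A.Executes (d + 2) (p + 5) (p + 5 + L.length) (T i) ((s.iter f x i).setv x i)
      (s.iter f x (i + 1))) :
    A.Executes d p (p + L.length + 8) (∑ i ∈ Finset.range (s.v y), (T i + 6) + 4) s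
      (s.iter f x (s.v y)) := by
  intro r vars
  set r₀ := Function.update (Function.update r (64 + d) (s.v y)) (64 + (d + 1)) 0 with hr₀
  have start : A.Reaches 2 ⟨p, r, s.m⟩ ⟨p + 2, r₀, s.m⟩ :=
    (hA.left.reaches 0 (by simp) rfl rfl).trans
      (hA.left.reaches 1 (by simp) rfl (by simp [Instr.exec, hr₀, vars]))
  have rounds (i : ℕ) (hi : i ≤ s.v y) : ∃ r' : ℕ → ℕ,
      A.Reaches (∑ i ∈ Finset.range i, (T i + 6)) ⟨p + 2, r₀, s.m⟩ ⟨p + 2, r', (s.iter f x i).m⟩ ∧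
      (∀ z : Var, r' z.reg = (s.iter f x i).v z) ∧ r' (64 + d) = s.v y ∧ r' (64 + (d + 1)) = i ∧
      ∀ j, 64 ≤ j → j < 64 + d → r' j = r j := by
    induction i with
    | zero =>
      refine ⟨r₀, .refl _, fun z => ?_, by simp [hr₀], by simp [hr₀], fun j _ hj => ?_⟩
      · simp [hr₀, z.reg_ne, vars, St.iter]
      · rw [hr₀, Function.update_of_ne (by omega), Function.update_of_ne (by omega)]
    | succ i ih =>
      obtain ⟨r₁, reach₁, vars₁, bound, counter, keep₁⟩ := ih (by omega)
      obtain ⟨r₂, reach₂, vars₂, bound₂, counter₂, keep₂⟩ :=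
        loopCode_round hA hi (body i) vars₁ bound counter
      rw [Finset.sum_range_succ]
      exact ⟨r₂, reach₁.trans reach₂, vars₂, bound₂, counter₂,
        fun j h64 hj => (keep₂ j h64 hj).trans (keep₁ j h64 hj)⟩
  obtain ⟨r₁, reach₁, vars₁, bound, counter, keep₁⟩ := rounds _ le_rfl
  have finish : A.Reaches 2 ⟨p + 2, r₁, (s.iter f x (s.v y)).m⟩
      ⟨p + L.length + 8, Function.update r₁ (64 + (d + 2)) 0, (s.iter f x (s.v y)).m⟩ :=
    (hA.right.left.reaches 0 (by simp) rfl rfl).trans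
      (hA.right.left.reaches 1 (by simp) rfl (by simp [Instr.exec, bound, counter]))
  refine ⟨_, fun z => ?_, ((start.trans reach₁).trans finish).mono (by omega), fun j h64 hj => ?_⟩
  · simp [z.reg_ne, vars₁]
  · rw [Function.update_of_ne (by omega), keep₁ j h64 hj]

theorem Cmd.code_executes {s : St} {M : ℕ} (c : Cmd) (d p : ℕ) (hA : A.HasCode p (c.code d p))
    (hM : (c.code d p).length ≤ M) :
    A.Executes d p (p + (c.code d p).length) (M * c.cost s) s (c.run s) := by
  induction c generalizing s d p with
  | skip => exact fun r vars => ⟨r, vars, .refl _, fun _ _ _ => rfl⟩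
  | assign x e =>
    simp only [code, List.length_append, List.length_singleton] at hA hM ⊢
    exact (assignCode_executes x e d p hA).mono (by simpa [cost] using hM)
  | store e f => exact (storeCode_executes e f d p hA).mono (hM.trans_eq (mul_one M).symm)
  | aset j e f =>
    have := storeCode_executes (s := s) (.addr j e) f d p hA
    rw [Exp.eval_addr] at this
    exact this.mono (hM.trans_eq (mul_one M).symm)
  | seq c₁ c₂ ih₁ ih₂ =>
    simp only [code, List.length_append, cost, mul_add, ← add_assoc] at hA hM ⊢
    exact (ih₁ d p hA.left (by omega)).trans (ih₂ d _ hA.right (by omega))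
  | ite e c₁ c₂ ih₁ ih₂ =>
    simp only [code, List.length_append, List.length_singleton] at hA hM
    have branches : A.Executes d p _ _ s ((ite e c₁ c₂).run s) :=
      iteCode_executes (T := M * (if e.Holds s then c₁.cost s else c₂.cost s)) hA rfl rfl
        (fun he => by simpa [he] using ih₁ d _ hA.right.right.left (by omega))
        (fun he => by
          simpa [he] using ih₂ d _ (hA.right.right.right.right (by simp [add_assoc])) (by omega))
    simp only [code, List.length_append, List.length_singleton, cost, mul_add, mul_one]
    convert branches.mono (T' := M + M * _) (by gcongr; omega) using 1
    omega
  | loop x y c ih =>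
    have hlen : (loopCode x y (c.code (d + 2) (p + 5)) d p).length =
        (c.code (d + 2) (p + 5)).length + 8 := by simp [loopCode]
    simp only [code, hlen, ← add_assoc] at hA hM ⊢
    have body (i : ℕ) := ih (s := (s.iter c.run x i).setv x i) (d + 2) (p + 5)
      (hA.right.right.left) (by omega)
    refine (loopCode_executes hA body).mono ?_
    simp only [cost, mul_add, Finset.mul_sum, mul_one]
    rw [add_comm]
    exact add_le_add (by omega) (Finset.sum_le_sum fun i _ => by omega)

/-- The state that represents the initial configuration. -/
def St.start (input : List ℕ) : St := ⟨fun _ => 0, fun i => input.getD i 0⟩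

/-- The random access machine program for a loop program. -/
def Cmd.compile (c : Cmd) : Program := c.code 0 0

theorem Cmd.compile_executes (c : Cmd) (input : List ℕ) :
    c.compile.Executes 0 0 c.compile.length (c.compile.length * c.cost (.start input))
      (.start input) (c.run (.start input)) := by
  have code : c.compile.HasCode 0 (c.code 0 0) := fun i hi => by
    rw [Nat.zero_add]
    exact List.getElem?_eq_getElem hi
  simpa only [Nat.zero_add, compile] using c.code_executes 0 0 code le_rfl

theorem Cmd.compile_decidesWithin {c : Cmd} {input : List ℕ} {yes : Prop} [Decidable yes] {T : ℕ}
    (hres : (c.run (.start input)).v .res = if yes then 1 else 0)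
    (hT : c.cost (.start input) ≤ T) :
    c.compile.DecidesWithin input yes (c.compile.length * T) := by
  obtain ⟨r, vars, ⟨t, ht, hk⟩, -⟩ := c.compile_executes input (fun _ => 0) fun _ => rfl
  have hk : c.compile.step^[t] (init input) = ⟨_, r, _⟩ := hk
  have reg_zero : r 0 = if yes then 1 else 0 := (vars .res).trans hres
  refine ⟨t, ht.trans (Nat.mul_le_mul_left _ hT), ?_⟩
  rw [hk]
  exact ⟨le_rfl, fun h => reg_zero.trans (if_pos h), fun h => reg_zero.trans (if_neg h)⟩

theorem Cmd.compile_computesWithin {c : Cmd} {input output : List ℕ} {T : ℕ}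
    (hlen : (c.run (.start input)).v .len = output.length)
    (hmem : ∀ (i : ℕ) (h : i < output.length),
      (c.run (.start input)).m ((c.run (.start input)).v .res + i) = output[i])
    (hT : c.cost (.start input) ≤ T) :
    c.compile.ComputesWithin input output (c.compile.length * T) := by
  obtain ⟨r, vars, ⟨t, ht, hk⟩, -⟩ := c.compile_executes input (fun _ => 0) fun _ => rfl
  have hk : c.compile.step^[t] (init input) = ⟨_, r, _⟩ := hk
  refine ⟨t, ht.trans (Nat.mul_le_mul_left _ hT), ?_⟩
  rw [hk]
  refine ⟨le_rfl, (vars .len).trans hlen, fun i h => ?_⟩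
  have reg_zero : r 0 = (c.run (.start input)).v .res := vars .res
  exact (congrArg (fun a => (c.run (.start input)).m (a + i)) reg_zero).trans (hmem i h)

end Compilation

open Cmd Exp

/-! ### Loops that descend -/

section Descends

variable {δ : Type*} {I : δ → Prop} {μ : δ → ℕ} {ψ : St → δ} {x y : Var} {c : Cmd} {s : St}

theorem run_loop_descends {R : ℕ → δ → Prop}
    (body : ∀ i < s.v y, ∀ s', Frame (.loop x y c) s s' →
      Descends I μ (R i) (ψ s') (ψ (c.run (s'.setv x i)))) :
    Descends I μ (fun d => ∀ i < s.v y, R i d) (ψ s) (ψ ((Cmd.loop x y c).run s)) := by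
  refine run_loop_induction (c := c) (x := x)
    (fun i s' => Descends I μ (fun d => ∀ j < i, R j d) (ψ s) (ψ s')) ?_ ?_
  · exact fun hI => ⟨hI, .inl ⟨by simp, rfl⟩⟩
  · intro i s' hi hF h
    exact (h.trans (body i hi s' hF)).congr Nat.forall_lt_succ_right.symm

theorem run_loop_of_descends {R : δ → Prop}
    (body : ∀ i s', Frame (.loop x y c) s s' → Descends I μ R (ψ s') (ψ (c.run (s'.setv x i))))
    (hI : I (ψ s)) (hμ : μ (ψ s) ≤ s.v y) :
    I (ψ ((Cmd.loop x y c).run s)) ∧ R (ψ ((Cmd.loop x y c).run s)) := by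
  have descent : I (ψ ((Cmd.loop x y c).run s)) ∧
      (R (ψ ((Cmd.loop x y c).run s)) ∨ μ (ψ ((Cmd.loop x y c).run s)) + s.v y ≤ μ (ψ s)) := by
    refine run_loop_induction (c := c) (x := x)
      (fun i s' => I (ψ s') ∧ (R (ψ s') ∨ μ (ψ s') + i ≤ μ (ψ s))) ⟨hI, .inr le_rfl⟩ ?_
    rintro i s' - hF ⟨hI', h⟩
    obtain ⟨hI'', ⟨hR, e⟩ | ⟨hR, lt⟩⟩ := body i s' hF hI'
    · exact ⟨hI'', .inl (e ▸ hR)⟩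
    · exact ⟨hI'', .inr (by have := h.resolve_left hR; omega)⟩
  refine ⟨descent.1, descent.2.elim id fun hμ' => ?_⟩
  obtain ⟨-, ⟨hR, -⟩ | ⟨-, lt⟩⟩ := body 0 _ (Frame.run _ s) descent.1
  exacts [hR, absurd lt (by omega)]

end Descends

/-! ### Searching -/

section Searching

/-- `found` becomes `1` if `e` holds for a value below `y` of the variable `x`, and `0` if not. -/
def existsBelow (x y : Var) (e : Exp) : Cmd :=
  block [assign .found (c 0), .loop x y (ite e (assign .found (c 1)) skip)]

variable {x y : Var} {e : Exp} {s : St}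

theorem found_run_existsBelow {r : ℕ → Prop} (hx : x ≠ .found) (hy : y ≠ .found)
    (holds : ∀ i < s.v y, ∀ s', Frame (existsBelow x y e) s s' → s'.v x = i →
      (e.Holds s' ↔ r i)) :
    ((existsBelow x y e).run s).v .found ≠ 0 ↔ ∃ i < s.v y, r i := by
  have y_eq : (s.setv .found 0).v y = s.v y := by simp [hy]
  rw [← y_eq]
  refine run_loop_induction (s := s.setv .found 0)
    (fun i s' => s'.v .found ≠ 0 ↔ ∃ i' < i, r i') (by simp) ?_
  intro i s' hi hF found
  have frame : Frame (existsBelow x y e) s (s'.setv x i) := by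
    refine .trans ((Frame.run (assign .found (c 0)) s).mono ?_ ?_ ?_)
      ((hF.loop_setv i).mono ?_ ?_ ?_) <;>
      simp +contextual [existsBelow, block, writes, raw, writesArr]
  have holds_i := holds i (y_eq ▸ hi) _ frame (by simp)
  simp only [Nat.lt_succ_iff_lt_or_eq, or_and_right, exists_or, exists_eq_left, ← holds_i, run_ite]
  split_ifs with h <;> simp [h, hx.symm, found]

end Searching

/-! ### Arithmetic -/

section Arithmetic

variable (s : St)

/-- `z := e + x * y` -/
def addMul (z : Var) (e : Exp) (x y : Var) : Cmd :=
  block [assign z e, .loop .aux y (assign z (add (v z) (v x))), assign .aux (c 0)]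

theorem run_addMul {z x y : Var} (e : Exp) (hx : x ≠ z ∧ x ≠ .aux) (hy : y ≠ z) (hz : z ≠ .aux) :
    (addMul z e x y).run s = (s.setv z (e.eval s + s.v x * s.v y)).setv .aux 0 := by
  have loop_spec (s₁ : St) : let s' := (Cmd.loop .aux y (assign z (add (v z) (v x)))).run s₁
      (∀ w, w ≠ z → w ≠ .aux → s'.v w = s₁.v w) ∧ s'.m = s₁.m ∧
        s'.v z = s₁.v z + s₁.v x * s₁.v y := by
    refine run_loop_induction (fun i s' => (∀ w, w ≠ z → w ≠ .aux → s'.v w = s₁.v w) ∧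
      s'.m = s₁.m ∧ s'.v z = s₁.v z + s₁.v x * i) ⟨fun _ _ _ => rfl, rfl, rfl⟩ ?_
    rintro i s' - - ⟨unchanged, mem, value⟩
    refine ⟨fun w hw hw' => ?_, mem, ?_⟩
    · simp [hw, hw', unchanged w hw hw']
    · simp [hz, hx.2, value, unchanged x hx.1 hx.2]
      ring
  obtain ⟨unchanged, mem, value⟩ := loop_spec (s.setv z (e.eval s))
  ext w
  · rcases eq_or_ne w .aux with rfl | hw
    · simp [addMul]
    rcases eq_or_ne w z with rfl | hw'
    · simpa [addMul, hw, hx.1, hy] using value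
    · simpa [addMul, hw, hw'] using unchanged w hw' hw
  · exact congrFun mem w

/-- `z := x ^ y` -/
def power (z x y : Var) : Cmd :=
  block [assign z (c 1), .loop .iQ y (block [addMul .cur (c 0) z x, assign z (v .cur)])]

theorem run_power_v (z x y : Var) (hz : z ≠ .aux ∧ z ≠ .cur ∧ z ≠ .iQ)
    (hx : x ≠ z ∧ x ≠ .aux ∧ x ≠ .cur ∧ x ≠ .iQ) (hy : y ≠ z) :
    ((power z x y).run s).v z = s.v x ^ s.v y := by
  have hy' : (s.setv z 1).v y = s.v y := by simp [hy]
  rw [← hy']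
  refine run_loop_induction (fun i s' => s'.v z = s.v x ^ i) (by simp) fun i s' _ hF h => ?_
  have x_eq : s'.v x = s.v x := (hF.v x (by
      simp [writes, addMul, block, hx.1.symm, hx.2.1.symm, hx.2.2.1.symm, hx.2.2.2.symm])).trans
    (by simp [hx])
  simp [run_addMul, hz, hx, h, x_eq, pow_succ]

end Arithmetic

/-! ### Matrices in memory -/

/-- Entry `(x, y)` of the matrix at address `off`; the entries of the array `t` are the multiples of
the row length, so that no multiplication is needed. -/
def entry (off : Var) (t : Arr) (x y : Exp) : Exp := get (add (add (v off) (aget t x)) y)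

/-- The truth values of a relation are stored in the memory as a `k × n` matrix at address `off`,
and the first `k` multiples of `n` in the array `t`. -/
structure HasMatrix (s : St) (off : Var) (t : Arr) (k n : ℕ) (r : ℕ → ℕ → Prop) : Prop where
  le_base : s.v off + k * n ≤ s.v .base
  table : ∀ i < k, s.arr t i = i * n
  mem : ∀ i < k, ∀ j < n, (s.m (s.v off + i * n + j) ≠ 0 ↔ r i j)

theorem mul_add_lt_mul {i j k n : ℕ} (hi : i < k) (hj : j < n) : i * n + j < k * n :=
  Nat.lt_of_lt_of_le (Nat.add_lt_add_left hj _)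
    ((Nat.succ_mul i n).symm.trans_le (Nat.mul_le_mul_right n hi))

namespace HasMatrix

variable {s s' : St} {off : Var} {t : Arr} {k n : ℕ} {r : ℕ → ℕ → Prop}

theorem holds_entry (h : HasMatrix s off t k n r) {e f : Exp} (he : e.eval s < k)
    (hf : f.eval s < n) : (entry off t e f).Holds s ↔ r (e.eval s) (f.eval s) := by
  simpa [Exp.Holds, entry, h.table _ he] using h.mem _ he _ hf

theorem congr (h : HasMatrix s off t k n r) (hv : s'.v off = s.v off)
    (hbase : s'.v .base = s.v .base) (hm : ∀ a < s.v .base, s'.m a = s.m a)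
    (ht : ∀ i < k, s'.arr t i = s.arr t i) : HasMatrix s' off t k n r where
  le_base := by rw [hv, hbase]; exact h.le_base
  table i hi := (ht i hi).trans (h.table i hi)
  mem i hi j hj := by
    have := mul_add_lt_mul hi hj
    have := h.le_base
    rw [hv, hm _ (by omega)]
    exact h.mem i hi j hj

theorem frame (h : HasMatrix s off t k n r) {c : Cmd} (hF : Frame c s s') (hc : c.raw = false)
    (hoff : c.writes off = false) (ht : c.writesArr t = false) : HasMatrix s' off t k n r :=
  h.congr (hF.v _ hoff) (hF.base hc) (hF.m hc) fun _ _ => by rw [hF.arr hc _ ht]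

end HasMatrix

/-- The first `k` multiples of `n` are stored in the array `t`. -/
def multiples (t : Arr) (k n : Var) : Cmd :=
  block [assign .cur (c 0),
    .loop .iR k (block [aset t (v .iR) (v .cur), assign .cur (add (v .cur) (v n))])]

theorem run_multiples (s : St) {t : Arr} {k n : Var} (hk : k ≠ .cur) (hn : n ≠ .cur ∧ n ≠ .iR) :
    ∀ i < s.v k, ((multiples t k n).run s).arr t i = i * s.v n := by
  have hk' : (s.setv .cur 0).v k = s.v k := by simp [hk]
  rw [← hk']
  refine (run_loop_induction (fun i s' => s'.v .cur = i * s.v n ∧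
    ∀ i' < i, s'.arr t i' = i' * s.v n) (by simp) fun i s' _ hF h => ?_).2
  have n_eq : s'.v n = s.v n := (hF.v n (by simp [writes, block, hn.1.symm, hn.2.symm])).trans
    (by simp [hn.1])
  refine ⟨by simp [h.1, hn.2, n_eq, Nat.succ_mul], fun i' hi' => ?_⟩
  rcases Nat.lt_succ_iff_lt_or_eq.mp hi' with hi' | rfl
  · simp [h.2 i' hi', hi'.ne]
  · simp [h.1]

end RAM

/-! ### Posets in memory -/

theorem getD_ofFn_matrix_ne_zero {k n : ℕ} (R : Fin k → Fin n → Prop) [∀ i j, Decidable (R i j)]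
    (i : Fin k) (j : Fin n) :
    (List.ofFn fun t : Fin (k * n) => if R t.divNat t.modNat then 1 else 0).getD (i * n + j) 0 ≠ 0 ↔
      R i j := by
  have lt := RAM.mul_add_lt_mul i.isLt j.isLt
  have divNat_modNat : (⟨i * n + j, lt⟩ : Fin (k * n)) = finProdFinEquiv (i, j) := by
    ext
    simp [Nat.add_comm, Nat.mul_comm]
  have index := finProdFinEquiv.symm_apply_apply (i, j)
  rw [finProdFinEquiv_symm_apply, Prod.mk.injEq] at index
  rw [List.getD_eq_getElem _ _ (by simpa using lt), List.getElem_ofFn]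
  simp [divNat_modNat, index]

theorem getD_append_append {l₁ l₂ l₃ : List ℕ} {off i : ℕ} (hoff : off = l₁.length)
    (hi : i < l₂.length) : (l₁ ++ (l₂ ++ l₃)).getD (off + i) 0 = l₂.getD i 0 := by
  rw [hoff, List.getD_append_right _ _ _ _ (Nat.le_add_right _ _), Nat.add_sub_cancel_left,
    List.getD_append _ _ _ _ hi]

namespace FinPoset

variable (P : FinPoset)

/-- The order relation on the labels of the elements. -/
def natLe : ℕ → ℕ → Prop :=
  Relation.Map (· ≤ ·) (fun a : P => (P.label a : ℕ)) (fun a : P => (P.label a : ℕ))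

/-- The strict order of `P` on the labels of its elements. -/
def natLt (i j : ℕ) : Prop := P.natLe i j ∧ i ≠ j

variable {P}

theorem label_val_injective : Function.Injective fun a : P => (P.label a : ℕ) :=
  Fin.val_injective.comp P.label.injective

theorem exists_label_eq {i : ℕ} (hi : i < P.size) : ∃ a : P, (P.label a : ℕ) = i :=
  ⟨P.label.symm ⟨i, hi⟩, by simp⟩

theorem natLe_label {a b : P} : P.natLe (P.label a) (P.label b) ↔ a ≤ b :=
  Relation.map_apply_apply label_val_injective label_val_injective _ a b

theorem lt_size_of_natLe {i j : ℕ} (h : P.natLe i j) : i < P.size ∧ j < P.size := by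
  obtain ⟨a, b, -, rfl, rfl⟩ := h
  exact ⟨Fin.is_lt _, Fin.is_lt _⟩

theorem natLt_label {a b : P} : P.natLt (P.label a) (P.label b) ↔ a < b := by
  rw [natLt, natLe_label, label_val_injective.ne_iff, lt_iff_le_and_ne]

instance : IsStrictOrder ℕ P.natLt where
  irrefl _ h := h.2 rfl
  trans i j k := by
    rintro ⟨⟨a, b, hab, rfl, rfl⟩, ne⟩ ⟨⟨b', d, hbd, hb', rfl⟩, ne'⟩
    obtain rfl := label_val_injective hb'
    rw [label_val_injective.ne_iff] at ne ne'
    exact natLt_label.mpr ((hab.lt_of_ne ne).trans (hbd.lt_of_ne ne'))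

theorem matrix_getD_ne_zero {i j : ℕ} (hi : i < P.size) (hj : j < P.size) :
    P.matrix.getD (i * P.size + j) 0 ≠ 0 ↔ P.natLe i j := by
  classical
  obtain ⟨a, rfl⟩ := exists_label_eq hi
  obtain ⟨b, rfl⟩ := exists_label_eq hj
  rw [natLe_label]
  simpa [matrix] using
    getD_ofFn_matrix_ne_zero (fun i j => P.label.symm i ≤ P.label.symm j) (P.label a) (P.label b)

theorem length_matrix : P.matrix.length = P.size * P.size := List.length_ofFn

end FinPoset

namespace RAM

open Cmd Exp

/-- The sizes and the order matrices of the posets `Q` and `P` are available. -/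
structure Loaded (Q P : FinPoset) (s : St) : Prop where
  nQ : s.v .nQ = Q.size
  nP : s.v .nP = P.size
  leQ : HasMatrix s .offQ .mulQ Q.size Q.size Q.natLe
  leP : HasMatrix s .offP .mulP P.size P.size P.natLe

/-- Does the program change what is needed to access the posets? -/
def Cmd.spoils (c : Cmd) : Bool :=
  c.raw || [.nQ, .nP, .offQ, .offP].any c.writes || [.mulQ, .mulP].any c.writesArr

theorem Loaded.frame {Q P : FinPoset} {s s' : St} (h : Loaded Q P s) {c : Cmd}
    (hF : Frame c s s') (hc : c.spoils = false) : Loaded Q P s' := by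
  simp only [Cmd.spoils, List.any_cons, List.any_nil, Bool.or_false, Bool.or_eq_false_iff] at hc
  obtain ⟨⟨raw, nQ, nP, offQ, offP⟩, mulQ, mulP⟩ := hc
  exact ⟨(hF.v _ nQ).trans h.nQ, (hF.v _ nP).trans h.nP, h.leQ.frame hF raw offQ mulQ,
    h.leP.frame hF raw offP mulP⟩

/-- The offsets of the order matrices in an input that starts with `header` numbers. -/
def offsets (header : ℕ) : Cmd :=
  block [assign .nQ (get (c 0)), assign .nP (get (c 1)), assign .offQ (c header),
    addMul .offP (v .offQ) .nQ .nQ, addMul .offC (v .offP) .nP .nP]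

/-- Computes tables of the multiples of the row lengths of the matrices. -/
def tables : Cmd :=
  block [multiples .mulQ .nQ .nQ, multiples .mulP .nP .nP, multiples .mulD .nQ .nP]

theorem run_tables (s : St) :
    (∀ i < s.v .nQ, (tables.run s).arr .mulQ i = i * s.v .nQ) ∧
      (∀ i < s.v .nP, (tables.run s).arr .mulP i = i * s.v .nP) ∧
      ∀ i < s.v .nQ, (tables.run s).arr .mulD i = i * s.v .nP := by
  let s₁ := (multiples .mulQ .nQ .nQ).run s
  let s₂ := (multiples .mulP .nP .nP).run s₁
  have run_eq : tables.run s = (multiples .mulD .nQ .nP).run s₂ := rfl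
  have nP₁ : s₁.v .nP = s.v .nP := run_v rfl
  have nP₂ : s₂.v .nP = s.v .nP := (run_v rfl).trans nP₁
  have nQ₂ : s₂.v .nQ = s.v .nQ := (run_v rfl).trans (run_v rfl)
  rw [run_eq]
  refine ⟨fun i hi => ?_, fun i hi => ?_, fun i hi => ?_⟩
  · rw [run_arr rfl rfl, run_arr rfl rfl, run_multiples s (by decide) (by decide) i hi]
  · rw [run_arr rfl rfl, run_multiples s₁ (by decide) (by decide) i (nP₁ ▸ hi), nP₁]
  · rw [run_multiples s₂ (by decide) (by decide) i (nQ₂ ▸ hi), nP₂]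

theorem loaded_run_tables {Q P : FinPoset} {s : St} (nQ : s.v .nQ = Q.size) (nP : s.v .nP = P.size)
    (hQ : s.v .offQ + Q.size * Q.size ≤ s.v .base) (hP : s.v .offP + P.size * P.size ≤ s.v .base)
    (mQ : ∀ i < Q.size * Q.size, s.m (s.v .offQ + i) = Q.matrix.getD i 0)
    (mP : ∀ i < P.size * P.size, s.m (s.v .offP + i) = P.matrix.getD i 0) :
    Loaded Q P (tables.run s) := by
  have hF := Frame.run tables s
  have offQ : (tables.run s).v .offQ = s.v .offQ := hF.v _ rfl
  have offP : (tables.run s).v .offP = s.v .offP := hF.v _ rfl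
  have base := hF.base rfl
  obtain ⟨mulQ, mulP, -⟩ := run_tables s
  refine ⟨(hF.v _ rfl).trans nQ, (hF.v _ rfl).trans nP, ⟨?_, nQ ▸ mulQ, fun i hi j hj => ?_⟩,
    ⟨?_, nP ▸ mulP, fun i hi j hj => ?_⟩⟩
  · rwa [offQ, base]
  · have lt := mul_add_lt_mul hi hj
    rw [offQ, Nat.add_assoc, hF.m rfl _ (by omega), mQ _ lt, FinPoset.matrix_getD_ne_zero hi hj]
  · rwa [offP, base]
  · have lt := mul_add_lt_mul hi hj
    rw [offP, Nat.add_assoc, hF.m rfl _ (by omega), mP _ lt, FinPoset.matrix_getD_ne_zero hi hj]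

/-- The first part of the decision algorithm: it makes the posets accessible. -/
def load : Cmd := block [offsets 2, assign .base (v .offC), tables]

theorem loaded_run_load (Q P : FinPoset) :
    let s := load.run (.start (embeddingProblem.encode (Q, P)))
    Loaded Q P s ∧ (∀ i < Q.size, s.arr .mulD i = i * P.size) ∧
      ∀ t, t ≠ .mulQ → t ≠ .mulP → t ≠ .mulD → s.arr t = 0 := by
  let s₀ := St.start (embeddingProblem.encode (Q, P))
  let s₁ := (block [offsets 2, assign .base (v .offC)]).run s₀
  have encode_eq : embeddingProblem.encode (Q, P) = [Q.size, P.size] ++ (Q.matrix ++ P.matrix) := by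
    simp [embeddingProblem]
  have m_eq : s₁.m = fun i => (embeddingProblem.encode (Q, P)).getD i 0 := by
    simp [s₁, s₀, offsets, run_addMul, St.start]
  have v_eq : s₁.v .nQ = Q.size ∧ s₁.v .nP = P.size ∧ s₁.v .offQ = 2 ∧
      s₁.v .offP = 2 + Q.size * Q.size ∧
      s₁.v .base = 2 + Q.size * Q.size + P.size * P.size := by
    simp [s₁, s₀, offsets, run_addMul, St.start, encode_eq]
  obtain ⟨nQ, nP, offQ, offP, base⟩ := v_eq
  have run_eq : load.run s₀ = tables.run s₁ := rfl
  have mQ : ∀ i < Q.size * Q.size, s₁.m (s₁.v .offQ + i) = Q.matrix.getD i 0 := by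
    intro i hi
    rw [m_eq, offQ, encode_eq]
    exact getD_append_append rfl (by rwa [FinPoset.length_matrix])
  have mP : ∀ i < P.size * P.size, s₁.m (s₁.v .offP + i) = P.matrix.getD i 0 := by
    intro i hi
    have entry_eq := getD_append_append (l₁ := [Q.size, P.size] ++ Q.matrix) (l₃ := [])
      (offP.trans (by rw [List.length_append, FinPoset.length_matrix]; rfl))
      (hi.trans_eq FinPoset.length_matrix.symm)
    rw [m_eq]
    rwa [List.append_nil, List.append_assoc, ← encode_eq] at entry_eq
  have mulD := (run_tables s₁).2.2
  rw [nQ, nP] at mulD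
  refine ⟨loaded_run_tables (s := s₁) nQ nP (by omega) (by omega) mQ mP, mulD,
    fun t h h' h'' => ?_⟩
  have unchanged : (tables.run s₁).arr t = s₁.arr t := run_arr rfl (by
    simp [tables, multiples, block, writesArr, h.symm, h'.symm, h''.symm])
  funext i
  rw [run_eq, unchanged, St.arr, m_eq, base, encode_eq]
  refine List.getD_eq_default _ _ ?_
  simp only [List.length_append, FinPoset.length_matrix, List.length_cons, List.length_nil]
  omega

/-! ### The auction -/

section Bidding

/-- The owners and the prices of the objects. Owner `a` is stored as `a + 1`. -/
def St.holdings (s : St) : (ℕ → Option ℕ) × (ℕ → ℕ) :=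
  (fun b => (s.arr .owner b).ppred, s.arr .price)

theorem St.mem_holdings {s : St} {a b : ℕ} : a ∈ s.holdings.1 b ↔ s.arr .owner b = a + 1 := by
  rw [Option.mem_def, St.holdings, Nat.ppred_eq_some, eq_comm]

theorem setv_holdings (s : St) {x : Var} (hx : x ≠ .base) (n : ℕ) :
    (s.setv x n).holdings = s.holdings := by
  simp only [St.holdings, St.setv_arr _ hx]

/-- Updates `own` (does `iP` own an object?) and `best`, `low` (the cheapest object for which `iP`
bids, plus one, and its price) for the object `jP`. -/
def inspect : Cmd :=
  block [
    ite (and (and (entry .offP .mulP (v .iP) (v .jP)) (not (eq (v .iP) (v .jP))))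
        (lt (aget .price (v .jP)) (v .low)))
      (block [assign .best (add (v .jP) (c 1)), assign .low (aget .price (v .jP))]) skip,
    ite (eq (aget .owner (v .jP)) (add (v .iP) (c 1))) (assign .own (c 1)) skip]

/-- Determines `own`, `best` and `low` for the bidder `iP`. -/
def search : Cmd :=
  block [assign .own (c 0), assign .best (c 0), assign .low (v .lim), .loop .jP .nP inspect]

/-- If `iP` does not own an object, it buys the cheapest one, if this is below `lim`. -/
def buy : Cmd :=
  ite (and (not (v .own)) (v .best))
    (block [aset .price (sub (v .best) (c 1)) (add (v .low) (c 1)),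
      aset .owner (sub (v .best) (c 1)) (add (v .iP) (c 1))]) skip

/-- One bid of `iP`, if it owns nothing and can afford an object. -/
def bid : Cmd := seq search buy

/-- The auction: every round gives every bidder one opportunity to bid. -/
def auction : Cmd :=
  block [assign .lim (add (v .nP) (c 1)), addMul .rounds (c 0) .lim .nP,
    .loop .iR .rounds (.loop .iP .nP bid)]

variable {Q P : FinPoset} {s : St}

/-- The knowledge about the bidder `iP` after the objects below `j` have been inspected. -/
structure Inspected (P : FinPoset) (s : St) (j : ℕ) : Prop where
  own : s.v .own ≠ 0 ↔ ∃ b < j, s.v .iP ∈ s.holdings.1 b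
  le_price : ∀ b < j, P.natLt (s.v .iP) b → s.v .low ≤ s.holdings.2 b
  best : s.v .best = 0 ∧ s.v .low = s.v .lim ∨ ∃ b, s.v .best = b + 1 ∧ P.natLt (s.v .iP) b ∧
    s.v .low = s.holdings.2 b ∧ s.v .low < s.v .lim

theorem run_inspect_own :
    (inspect.run s).v .own ≠ 0 ↔ s.v .own ≠ 0 ∨ s.v .iP ∈ s.holdings.1 (s.v .jP) := by
  rw [St.mem_holdings]
  simp only [inspect, run_block_cons, run_block_nil, run_ite, holds_eq]
  split_ifs <;> simp_all

theorem run_inspect_best (hL : Loaded Q P s) (hi : s.v .iP < P.size) (hj : s.v .jP < P.size) :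
    (P.natLt (s.v .iP) (s.v .jP) ∧ s.holdings.2 (s.v .jP) < s.v .low ∧
      (inspect.run s).v .best = s.v .jP + 1 ∧ (inspect.run s).v .low = s.holdings.2 (s.v .jP)) ∨
    ((P.natLt (s.v .iP) (s.v .jP) → s.v .low ≤ s.holdings.2 (s.v .jP)) ∧
      (inspect.run s).v .best = s.v .best ∧ (inspect.run s).v .low = s.v .low) := by
  have le_iff := hL.leP.holds_entry (e := v .iP) (f := v .jP) hi hj
  simp only [inspect, run_block_cons, run_block_nil, run_ite, holds_and, holds_not, holds_eq,
    le_iff, holds_lt, eval_v, eval_aget]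
  split_ifs with better <;> simp_all [FinPoset.natLt, St.holdings]

theorem Inspected.step {j : ℕ} (h : Inspected P s j) (hL : Loaded Q P s) (hi : s.v .iP < P.size)
    (hj : j < P.size) : Inspected P (inspect.run (s.setv .jP j)) (j + 1) := by
  set s₁ := s.setv .jP j with hs₁
  have hL₁ : Loaded Q P s₁ := hL.frame (Frame.run (assign .jP (c j)) s) rfl
  have iP : (inspect.run s₁).v .iP = s.v .iP := (run_v rfl).trans (by simp [s₁])
  have lim : (inspect.run s₁).v .lim = s.v .lim := (run_v rfl).trans (by simp [s₁])
  have holdings : (inspect.run s₁).holdings = s.holdings := by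
    simp only [St.holdings, run_arr (c := inspect) (j := .owner) rfl rfl,
      run_arr (c := inspect) (j := .price) rfl rfl]
    simp [s₁]
  have holdings₁ : s₁.holdings = s.holdings := by simp [s₁, St.holdings]
  have own := run_inspect_own (s := s₁)
  have best := run_inspect_best hL₁ (by simpa [s₁] using hi) (by simpa [s₁] using hj)
  have v₁ : s₁.v .iP = s.v .iP ∧ s₁.v .jP = j ∧ s₁.v .own = s.v .own ∧ s₁.v .low = s.v .low ∧
    s₁.v .best = s.v .best := by simp [s₁]
  obtain ⟨iP₁, jP₁, own₁, low₁, best₁⟩ := v₁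
  rw [iP₁, jP₁, holdings₁] at own best
  rw [own₁, h.own] at own
  rw [low₁, best₁] at best
  refine ⟨?_, ?_, ?_⟩ <;> rw [iP, holdings]
  · simp only [Nat.lt_succ_iff_lt_or_eq, or_and_right, exists_or, exists_eq_left]
    exact own
  · intro b hb hab
    rcases Nat.lt_succ_iff_lt_or_eq.mp hb with hb | rfl
    · have := h.le_price b hb hab
      omega
    · rcases best with ⟨-, -, -, low⟩ | ⟨le, -, low⟩
      exacts [low.le, low.trans_le (le hab)]
  · rw [lim]
    rcases best with ⟨hab, lt, best, low⟩ | ⟨-, best, low⟩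
    · refine .inr ⟨j, best, hab, low, ?_⟩
      obtain ⟨-, e⟩ | ⟨b, -, -, -, lt'⟩ := h.best <;> omega
    · rw [best, low]
      exact h.best

theorem inspected_run_search (hL : Loaded Q P s) (hi : s.v .iP < P.size) :
    Inspected P (search.run s) P.size := by
  let s₁ := (block [assign .own (c 0), assign .best (c 0), assign .low (v .lim)]).run s
  have hL₁ : Loaded Q P s₁ := hL.frame (Frame.run _ s) rfl
  have iP₁ : s₁.v .iP = s.v .iP := run_v rfl
  rw [← hL₁.nP]
  refine run_loop_induction (s := s₁) (fun j s' => Inspected P s' j) ?_ fun j s' hj hF h => ?_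
  · exact ⟨by simp [s₁], by simp, .inl (by simp [s₁])⟩
  · refine h.step (hL₁.frame hF rfl) ?_ (hL₁.nP ▸ hj)
    rwa [hF.v _ rfl, iP₁]

/-- The owners and the prices are an auction for `P`, with the price limit `|P| + 1`. -/
def IsAuctionFor (P : FinPoset) (d : (ℕ → Option ℕ) × (ℕ → ℕ)) : Prop :=
  IsAuction P.natLt (P.size + 1) d.1 d.2

/-- Bidder `a` is settled. -/
def SettledFor (P : FinPoset) (a : ℕ) (d : (ℕ → Option ℕ) × (ℕ → ℕ)) : Prop :=
  Settled P.natLt (P.size + 1) d.1 d.2 a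

/-- The sum of the possible raises decreases with each bid. -/
def raises (n : ℕ) (d : (ℕ → Option ℕ) × (ℕ → ℕ)) : ℕ := ∑ b ∈ Finset.range n, (n + 1 - d.2 b)

theorem raises_update_lt {n b : ℕ} {d : (ℕ → Option ℕ) × (ℕ → ℕ)} (hb : b < n) (lt : d.2 b < n + 1)
    (o : ℕ → Option ℕ) : raises n (o, Function.update d.2 b (d.2 b + 1)) < raises n d := by
  refine Finset.sum_lt_sum (fun b' _ => ?_) ⟨b, Finset.mem_range.mpr hb, ?_⟩
  · rcases eq_or_ne b' b with rfl | hne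
    · simp only [Function.update_self]
      omega
    · simp only [Function.update_of_ne hne, le_rfl]
  · simp only [Function.update_self]
    omega

theorem holdings_run_buy {b : ℕ} (own : s.v .own = 0) (best : s.v .best = b + 1)
    (low : s.v .low = s.holdings.2 b) :
    (buy.run s).holdings = (Function.update s.holdings.1 b (some (s.v .iP)),
      Function.update s.holdings.2 b (s.holdings.2 b + 1)) := by
  simp only [St.holdings] at low
  ext b' : 2
  · by_cases h : b' = b <;> simp [buy, own, best, low, St.holdings, Function.update_apply, h]
  · simp [buy, own, best, low, St.holdings]

theorem buy_descends (inspected : Inspected P s P.size) (hlim : s.v .lim = P.size + 1) :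
    Descends (IsAuctionFor P) (raises P.size) (SettledFor P (s.v .iP)) s.holdings
      (buy.run s).holdings := by
  intro hI
  obtain ⟨own, le_price, best⟩ := inspected
  rw [hlim] at best
  have priced (b : ℕ) (hab : P.natLt (s.v .iP) b) : s.v .low ≤ s.holdings.2 b :=
    le_price b (FinPoset.lt_size_of_natLe hab.1).2 hab
  have owner_lt {b : ℕ} (hb : s.v .iP ∈ s.holdings.1 b) : b < P.size :=
    (FinPoset.lt_size_of_natLe (hI.rel hb).1).2
  by_cases hown : s.v .own = 0
  · have not_owner (b : ℕ) : s.v .iP ∉ s.holdings.1 b := fun hb =>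
      own.mpr ⟨b, owner_lt hb, hb⟩ hown
    obtain ⟨hbest, low⟩ | ⟨b, hbest, hab, low, lt⟩ := best
    · have idle : buy.run s = s := by simp [buy, hbest]
      rw [idle]
      exact ⟨hI, .inl ⟨.inr fun b hab => low ▸ priced b hab, rfl⟩⟩
    · rw [holdings_run_buy hown hbest low]
      rw [low] at lt
      refine ⟨hI.bid not_owner hab lt fun b' hab' => low ▸ priced b' hab', .inr ⟨?_, ?_⟩⟩
      · rintro (⟨b', hb'⟩ | dear)
        exacts [not_owner b' hb', lt.not_ge (dear b hab)]
      · exact raises_update_lt (FinPoset.lt_size_of_natLe hab.1).2 lt _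
  · have idle : buy.run s = s := by simp [buy, hown]
    obtain ⟨b, -, hb⟩ := own.mp hown
    rw [idle]
    exact ⟨hI, .inl ⟨.inl ⟨b, hb⟩, rfl⟩⟩

theorem bid_descends (hL : Loaded Q P s) (hi : s.v .iP < P.size) (hlim : s.v .lim = P.size + 1) :
    Descends (IsAuctionFor P) (raises P.size) (SettledFor P (s.v .iP)) s.holdings
      (bid.run s).holdings := by
  let s₁ := search.run s
  have holdings : s₁.holdings = s.holdings := by
    simp only [St.holdings, s₁, run_arr (c := search) (j := .owner) rfl rfl,
      run_arr (c := search) (j := .price) rfl rfl]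
  have iP₁ : s₁.v .iP = s.v .iP := run_v rfl
  have lim₁ : s₁.v .lim = P.size + 1 := (run_v rfl).trans hlim
  have descends := buy_descends (inspected_run_search hL hi) lim₁
  rwa [holdings, iP₁] at descends

theorem run_auction (hL : Loaded Q P s) (howner : s.arr .owner = 0) (hprice : s.arr .price = 0) :
    IsAuctionFor P (auction.run s).holdings ∧
      ∀ a < P.size, SettledFor P a (auction.run s).holdings := by
  let s₁ := (block [assign .lim (add (v .nP) (c 1)), addMul .rounds (c 0) .lim .nP]).run s
  have hL₁ : Loaded Q P s₁ := hL.frame (Frame.run _ s) rfl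
  have lim₁ : s₁.v .lim = P.size + 1 := by simp [s₁, run_addMul, hL.nP]
  have rounds₁ : s₁.v .rounds = (P.size + 1) * P.size := by simp [s₁, run_addMul, hL.nP]
  have holdings₁ : s₁.holdings = (fun _ => none, 0) := by
    simp [St.holdings, s₁, run_addMul, howner, hprice]
  have run_eq : auction.run s = (Cmd.loop .iR .rounds (.loop .iP .nP bid)).run s₁ := rfl
  rw [run_eq]
  refine run_loop_of_descends (ψ := St.holdings) (I := IsAuctionFor P) (μ := raises P.size)
    (R := fun d => ∀ a < P.size, SettledFor P a d) (fun i s' hF => ?_) ?_ ?_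
  · have hL' : Loaded Q P (s'.setv .iR i) := hL₁.frame (hF.loop_setv i) rfl
    have lim' : (s'.setv .iR i).v .lim = P.size + 1 := ((hF.loop_setv i).v _ rfl).trans lim₁
    have nP' := hL'.nP
    have descends : Descends (IsAuctionFor P) (raises P.size)
        (fun d => ∀ a < (s'.setv .iR i).v .nP, SettledFor P a d) _ _ :=
      run_loop_descends (s := s'.setv .iR i) (x := .iP) (c := bid) fun a ha s'' hF' => by
        have descends := bid_descends (hL'.frame (hF'.loop_setv a) rfl)
          (by rw [nP'] at ha; simpa using ha) (((hF'.loop_setv a).v _ rfl).trans lim')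
        simpa [setv_holdings s'' (show Var.iP ≠ .base by decide)] using descends
    rwa [nP', setv_holdings s' (show Var.iR ≠ .base by decide)] at descends
  · rw [holdings₁]
    exact ⟨nofun, nofun, fun h => absurd rfl h, fun _ => Nat.zero_le _, nofun⟩
  · simp [holdings₁, rounds₁, raises, mul_comm]

end Bidding

end RAM
theorem FinPoset.natLe_refl {P : FinPoset} {i : ℕ} (hi : i < P.size) : P.natLe i i := by
  obtain ⟨a, rfl⟩ := exists_label_eq hi
  exact natLe_label.mpr le_rfl

theorem FinPoset.card_le_width {P : FinPoset} {S : Finset ℕ} (hS : S ⊆ Finset.range P.size)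
    (antichain : IsAntichain P.natLt (S : Set ℕ)) : S.card ≤ P.width := by
  classical
  have : Fintype P := Fintype.ofEquiv _ P.label.symm
  have image : (Finset.univ.filter fun a : P => (P.label a : ℕ) ∈ S).map
      ⟨_, label_val_injective⟩ = S := by
    ext i
    simp only [Finset.mem_map, Finset.mem_filter, Finset.mem_univ, true_and,
      Function.Embedding.coeFn_mk]
    refine ⟨fun ⟨_, ha, e⟩ => e ▸ ha, fun hi => ?_⟩
    obtain ⟨a, rfl⟩ := exists_label_eq (Finset.mem_range.mp (hS hi))
    exact ⟨a, hi, rfl⟩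
  refine le_csSup ⟨Fintype.card P, ?_⟩
    ⟨Finset.univ.filter fun a : P => (P.label a : ℕ) ∈ S, ?_, ?_⟩
  · rintro _ ⟨A, -, rfl⟩
    exact A.card_le_univ
  · intro a ha b hb hab hle
    exact antichain (by simpa using ha) (by simpa using hb) (label_val_injective.ne hab)
      (natLt_label.mpr (hle.lt_of_ne hab))
  · conv_rhs => rw [← image, Finset.card_map]

namespace RAM

open Cmd Exp

/-! ### The chains of owners -/

section OwnerChains

/-- `cur` becomes the owner of `cur`, if there is one. -/
def follow : Cmd :=
  ite (aget .owner (v .cur)) (assign .cur (sub (aget .owner (v .cur)) (c 1))) skip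

/-- The objects without owner become the heads of chains. -/
def collect : Cmd :=
  ite (aget .owner (v .iP)) skip
    (block [aset .head (v .nC) (v .iP), assign .nC (add (v .nC) (c 1))])

/-- Stores the head of the chain of `iP` as `root`: `nP` steps to the owner suffice. -/
def climb : Cmd :=
  block [assign .cur (v .iP), .loop .jP .nP follow, aset .root (v .iP) (v .cur)]

/-- Decomposes the objects into chains with `nC` heads. -/
def decompose : Cmd := block [assign .nC (c 0), .loop .iP .nP (seq climb collect)]

/-- The owner of an object, or the object itself if it has no owner. -/
def St.up (s : St) (b : ℕ) : ℕ := (s.holdings.1 b).getD b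

variable {Q P : FinPoset} {s : St}

theorem run_follow : follow.run s = s.setv .cur (s.up (s.v .cur)) := by
  have up_eq : s.up (s.v .cur) = if s.arr .owner (s.v .cur) = 0 then s.v .cur else
      s.arr .owner (s.v .cur) - 1 := by
    rcases h : s.arr .owner (s.v .cur) with _ | a <;> simp [St.up, St.holdings, h]
  rw [up_eq]
  ext <;> simp [follow] <;> split_ifs <;> simp_all

theorem up_setv {x : Var} (hx : x ≠ .base) (n : ℕ) : (s.setv x n).up = s.up := by
  funext b
  simp only [St.up, setv_holdings s hx]

theorem run_loop_follow :
    ((Cmd.loop .jP .nP follow).run s).v .cur = s.up^[s.v .nP] (s.v .cur) := by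
  refine run_loop_induction (fun j s' => s'.v .cur = s.up^[j] (s.v .cur)) rfl fun j s' _ hF h => ?_
  have up_eq : s'.up = s.up := by
    funext b
    simp only [St.up, St.holdings, hF.arr rfl .owner rfl]
  rw [run_follow, up_setv (by decide), up_eq]
  simp [h, Function.iterate_succ_apply']

/-- Two elements with the same `root` are comparable; the first `nC` entries of the array `head`
are the roots. -/
structure Decomposed (P : FinPoset) (s : St) : Prop where
  nC_le : s.v .nC ≤ P.width
  head : ∀ p < P.size, ∃ t < s.v .nC, s.arr .head t = s.arr .root p
  comparable : ∀ p < P.size, ∀ p' < P.size, s.arr .root p = s.arr .root p' →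
    P.natLe p p' ∨ P.natLe p' p

theorem run_climb : (climb.run s).arr .root =
    Function.update (s.arr .root) (s.v .iP) (s.up^[s.v .nP] (s.v .iP)) := by
  have cur := run_loop_follow (s := s.setv .cur (s.v .iP))
  rw [up_setv (by decide), St.setv_v, St.setv_v, if_neg (by decide), if_pos rfl] at cur
  simp [climb, run_v (c := .loop .jP .nP follow) (x := .iP) rfl,
    run_arr (c := .loop .jP .nP follow) (j := .root) rfl rfl, cur]

theorem run_collect : collect.run s = if s.arr .owner (s.v .iP) = 0 then
    (s.aset .head (s.v .nC) (s.v .iP)).setv .nC (s.v .nC + 1) else s := by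
  split_ifs with h <;> simp [collect, h]

theorem root_run_decompose : ∀ p < s.v .nP, (decompose.run s).arr .root p = s.up^[s.v .nP] p := by
  refine run_loop_induction (x := .iP) (y := .nP) (c := seq climb collect) (s := s.setv .nC 0)
    (fun i s' => ∀ p < i, s'.arr .root p = s.up^[s.v .nP] p) (by simp) ?_
  intro i s' _ hF root
  have owner : s'.arr .owner = s.arr .owner := (hF.arr rfl _ rfl).trans (by simp)
  have up_eq : s'.up = s.up := by
    funext b
    simp only [St.up, St.holdings, owner]
  have nP_eq : s'.v .nP = s.v .nP := hF.v _ rfl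
  have root_eq : ((seq climb collect).run (s'.setv .iP i)).arr .root =
      Function.update (s'.arr .root) i (s.up^[s.v .nP] i) := by
    refine (run_arr (c := collect) rfl rfl).trans ?_
    simp [run_climb, up_setv, up_eq, nP_eq]
  simp only [Nat.lt_succ_iff_lt_or_eq, or_imp, forall_and, forall_eq, root_eq]
  exact ⟨fun p hp => by rw [Function.update_of_ne hp.ne, root p hp], Function.update_self _ _ _⟩

theorem heads_run_decompose : let s' := decompose.run s
    s'.v .nC = ((Finset.range (s.v .nP)).filter fun b => s.holdings.1 b = none).card ∧
      ∀ p < s.v .nP, s.holdings.1 p = none → ∃ t < s'.v .nC, s'.arr .head t = p := by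
  refine run_loop_induction (s := s.setv .nC 0)
    (fun i s' => s'.v .nC = ((Finset.range i).filter fun b => s.holdings.1 b = none).card ∧
      ∀ p < i, s.holdings.1 p = none → ∃ t < s'.v .nC, s'.arr .head t = p) (by simp) ?_
  rintro i s' - hF ⟨nC, head⟩
  let s₁ := climb.run (s'.setv .iP i)
  have owner' : s'.arr .owner = s.arr .owner := (hF.arr rfl _ rfl).trans (by simp)
  have owner₁ : s₁.arr .owner = s.arr .owner :=
    (run_arr rfl rfl).trans ((congrFun (St.setv_arr s' (by decide) i) _).trans owner')
  have nC₁ : s₁.v .nC = s'.v .nC := (run_v rfl).trans (by simp)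
  have head₁ : s₁.arr .head = s'.arr .head := (run_arr rfl rfl).trans (by simp)
  have iP₁ : s₁.v .iP = i := (run_v rfl).trans (by simp)
  have free_iff : s₁.arr .owner (s₁.v .iP) = 0 ↔ s.holdings.1 i = none := by
    rw [iP₁, owner₁, St.holdings, Nat.ppred_eq_none]
  have run_eq : (seq climb collect).run (s'.setv .iP i) = collect.run s₁ := rfl
  simp only [run_eq, run_collect, free_iff, Finset.range_add_one, Finset.filter_insert,
    Nat.lt_succ_iff_lt_or_eq, or_imp, forall_and, forall_eq]
  split_ifs with free
  · simp only [ne_eq, reduceCtorEq, not_false_eq_true, St.setv_arr, St.setv_v, if_true,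
      St.aset_arr_self, head₁, nC₁, iP₁]
    refine ⟨by simp [nC], fun p hp hfree => ?_,
      fun _ => ⟨_, Nat.lt_succ_self _, Function.update_self _ _ _⟩⟩
    obtain ⟨t, ht, e⟩ := head p hp hfree
    exact ⟨t, Nat.lt_succ_of_lt ht, (Function.update_of_ne ht.ne _ _).trans e⟩
  · rw [nC₁, head₁]
    exact ⟨nC, head, fun h => absurd h free⟩

theorem decomposed_run_decompose (hL : Loaded Q P s) (auction : IsAuctionFor P s.holdings)
    (settled : ∀ a < P.size, SettledFor P a s.holdings) : Decomposed P (decompose.run s) := by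
  have root := root_run_decompose (s := s)
  obtain ⟨nC, head⟩ := heads_run_decompose (s := s)
  rw [hL.nP] at root nC head
  obtain ⟨S, hS, antichain, card_le⟩ := auction.exists_isAntichain
    (A := Finset.range P.size)
    (fun hab => (FinPoset.lt_size_of_natLe hab.1).imp Finset.mem_range.mpr Finset.mem_range.mpr)
    (by simp) (fun a ha => settled a (Finset.mem_range.mp ha))
  have up_natLt (b : ℕ) (hb : s.up b ≠ b) : P.natLt (s.up b) b := by
    rcases h : s.holdings.1 b with _ | a
    · simp [St.up, h] at hb
    · simpa [St.up, h] using auction.rel h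
  have up_lt {b : ℕ} (hb : b < P.size) : s.up b < P.size := by
    rcases eq_or_ne (s.up b) b with h | h
    exacts [h.symm ▸ hb, (FinPoset.lt_size_of_natLe (up_natLt b h).1).1]
  have iterate_lt (m : ℕ) {b : ℕ} (hb : b < P.size) : s.up^[m] b < P.size :=
    Function.Iterate.rec (· < P.size) hb (fun _ => up_lt) m
  refine ⟨nC.trans_le (card_le.trans (FinPoset.card_le_width hS antichain)), fun p hp => ?_,
    fun p hp p' hp' e => ?_⟩
  · have fixed := isFixedPt_iterate_card (A := Finset.range P.size) (f := s.up)
      (fun b hb => Finset.mem_range.mpr (up_lt (Finset.mem_range.mp hb))) up_natLt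
      (Finset.mem_range.mpr hp)
    rw [Finset.card_range] at fixed
    rw [root p hp]
    refine head _ (iterate_lt _ hp) (Option.eq_none_iff_forall_not_mem.mpr fun a ha => ?_)
    have self : s.up (s.up^[P.size] p) = s.up^[P.size] p := fixed
    rw [St.up, ha, Option.getD_some] at self
    exact irrefl _ (auction.rel (self ▸ ha))
  · rw [root p hp, root p' hp'] at e
    obtain rfl | h | h := auction.comparable_of_iterate_eq e
    · exact .inl (FinPoset.natLe_refl hp)
    · exact .inl h.1
    · exact .inr h.1

end OwnerChains

/-! ### Enforcing arc consistency -/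

section ArcConsistency

/-- Everything that is computed before the search for embeddings. -/
structure Prepared (Q P : FinPoset) (s : St) : Prop extends Loaded Q P s, Decomposed P s where
  mulD : ∀ i < Q.size, s.arr .mulD i = i * P.size

theorem Prepared.frame {Q P : FinPoset} {s s' : St} (h : Prepared Q P s) {c : Cmd}
    (hF : Frame c s s') (hc : c.spoils = false)
    (hc' : (c.writes .nC || [.mulD, .root, .head].any c.writesArr) = false) :
    Prepared Q P s' := by
  simp only [List.any_cons, List.any_nil, Bool.or_false, Bool.or_eq_false_iff] at hc'
  obtain ⟨nC, mulD, root, head⟩ := hc'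
  have raw : c.raw = false := (Bool.or_eq_false_iff.mp (Bool.or_eq_false_iff.mp hc).1).1
  refine ⟨h.toLoaded.frame hF hc, ⟨?_, ?_, ?_⟩, ?_⟩
  · rw [hF.v _ nC]; exact h.nC_le
  · rw [hF.v _ nC, hF.arr raw _ root, hF.arr raw _ head]; exact h.head
  · rw [hF.arr raw _ root]; exact h.comparable
  · rw [hF.arr raw _ mulD]; exact h.mulD

/-- The entry for the value `y` of the variable `x` in the table of the domains. -/
def domEntry (x y : Var) : Exp := aget .dom (add (aget .mulD (v x)) (v y))

/-- The domain of `x` becomes the chain with index `idx x`. -/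
def initDomains : Cmd :=
  .loop .iQ .nQ (.loop .iP .nP (aset .dom (add (aget .mulD (v .iQ)) (v .iP))
    (eq (aget .root (v .iP)) (aget .head (aget .idx (v .iQ))))))

/-- Does `jP` support the value `iP` of `iQ` on the order constraint for `iQ` and `jQ`? -/
def supports : Exp :=
  and (domEntry .jQ .jP)
    (and (iff (entry .offP .mulP (v .iP) (v .jP)) (entry .offQ .mulQ (v .iQ) (v .jQ)))
      (iff (entry .offP .mulP (v .jP) (v .iP)) (entry .offQ .mulQ (v .jQ) (v .iQ))))

/-- Removes the value `iP` of `iQ` if it has no support in the domain of `jQ`. -/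
def prune : Cmd :=
  block [existsBelow .jP .nP supports,
    ite (v .found) skip (aset .dom (add (aget .mulD (v .iQ)) (v .iP)) (c 0))]

/-- Prunes all domains once. -/
def sweep : Cmd := .loop .iQ .nQ (.loop .jQ .nQ (.loop .iP .nP prune))

/-- Prunes until all domains are arc consistent. -/
def propagate : Cmd := .loop .iR .sweeps sweep

variable {Q P : FinPoset} {s : St}

theorem mul_add_inj {i j p p' n : ℕ} (hp : p < n) (hp' : p' < n) (h : i * n + p = j * n + p') :
    i = j ∧ p = p' := by
  have quotient := congrArg (· / n) h
  have remainder := congrArg (· % n) h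
  have pos : 0 < n := Nat.zero_lt_of_lt hp
  simp only [Nat.mul_comm _ n, Nat.mul_add_div pos, Nat.div_eq_of_lt, hp, hp', Nat.add_zero]
    at quotient
  simp only [Nat.mul_comm _ n, Nat.mul_add_mod, Nat.mod_eq_of_lt, hp, hp'] at remainder
  exact ⟨quotient, remainder⟩

theorem run_initDomains (h : Prepared Q P s) : ∀ i < Q.size, ∀ p < P.size,
    ((initDomains.run s).arr .dom (i * P.size + p) ≠ 0 ↔
      s.arr .root p = s.arr .head (s.arr .idx i)) := by
  let n := P.size
  let Filled (m : ℕ) (d : ℕ → ℕ) : Prop := ∀ i < Q.size, ∀ p < n, i * n + p < m →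
    (d (i * n + p) ≠ 0 ↔ s.arr .root p = s.arr .head (s.arr .idx i))
  suffices filled : Filled (s.v .nQ * n) ((initDomains.run s).arr .dom) from
    fun i hi p hp => filled i hi p hp (h.nQ ▸ mul_add_lt_mul hi hp)
  refine run_loop_induction (fun i s' => Filled (i * n) (s'.arr .dom)) (by simp [Filled]) ?_
  intro i s' hi hF ih
  let s₁ := s'.setv .iQ i
  have hF₁ := hF.loop_setv i
  have nP₁ : s₁.v .nP = n := (hF₁.v _ rfl).trans h.nP
  suffices row : Filled (i * n + s₁.v .nP) _ by rwa [nP₁, ← Nat.succ_mul] at row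
  refine run_loop_induction (s := s₁) (fun p s' => Filled (i * n + p) (s'.arr .dom)) ih ?_
  intro p s'' hp hF' ih' i' hi' p' hp' lt
  let s₂ := s''.setv .iP p
  have hF₂ := hF'.loop_setv p
  have same (j : Arr) (hj : j ≠ .dom) : s₂.arr j = s.arr j :=
    (hF₂.arr rfl j (by simp [writesArr, hj.symm])).trans
      (hF₁.arr rfl j (by simp [writesArr, hj.symm]))
  have iQ₂ : s₂.v .iQ = i := (hF₂.v _ rfl).trans (by simp [s₁])
  have iP₂ : s₂.v .iP = p := by simp [s₂]
  have value := holds_eq s₂ (aget .root (v .iP)) (aget .head (aget .idx (v .iQ)))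
  simp only [eval_aget, eval_v, same _, ne_eq, reduceCtorEq, not_false_eq_true, iQ₂, iP₂] at value
  have index : (add (aget .mulD (v .iQ)) (v .iP)).eval s₂ = i * n + p := by
    simp only [eval_add, eval_aget, eval_v, same .mulD (by decide), iQ₂, iP₂,
      h.mulD _ (h.nQ ▸ hi), n]
  rw [run_aset, St.aset_arr_self, index, Function.update_apply]
  split_ifs with e
  · obtain ⟨rfl, rfl⟩ := mul_add_inj hp' (nP₁ ▸ hp) e
    exact value
  · rw [St.setv_arr _ (by decide)]
    exact ih' i' hi' p' hp' (by omega)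

/-- `(p, p')` is ordered in `P` in the same way as `(i, j)` is in `Q`. -/
def NatAlike (Q P : FinPoset) (i j p p' : ℕ) : Prop :=
  (P.natLe p p' ↔ Q.natLe i j) ∧ (P.natLe p' p ↔ Q.natLe j i)

theorem natAlike_label {x x' : Q} {a a' : P} :
    NatAlike Q P (Q.label x) (Q.label x') (P.label a) (P.label a') ↔ OrderedAlike a a' x x' := by
  simp only [NatAlike, OrderedAlike, FinPoset.natLe_label]

/-- The value `p` of `i` has a support in the domain of `j`. The table `d` of the domains has a row
for each element of `Q`. -/
def Supported (Q P : FinPoset) (i j p : ℕ) (d : ℕ → ℕ) : Prop :=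
  d (i * P.size + p) ≠ 0 → ∃ r < P.size, d (j * P.size + r) ≠ 0 ∧ NatAlike Q P i j p r

/-- The embedding takes its values in the domains `d`. -/
def Within (d : ℕ → ℕ) (e : Q ↪o P) : Prop := ∀ x, d (Q.label x * P.size + P.label (e x)) ≠ 0

/-- Only values of `d₀` that do not belong to an embedding have been removed. -/
def Refines (Q P : FinPoset) (d₀ d : ℕ → ℕ) : Prop :=
  (∀ i, d i ≠ 0 → d₀ i ≠ 0) ∧ ∀ e : Q ↪o P, Within d₀ e → Within d e

/-- The number of entries in the table `d` of the domains. -/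
def domSize (Q P : FinPoset) (d : ℕ → ℕ) : ℕ :=
  ((Finset.range (Q.size * P.size)).filter fun i => d i ≠ 0).card

theorem holds_supports (h : Prepared Q P s) (hi : s.v .iQ < Q.size) (hj : s.v .jQ < Q.size)
    (hp : s.v .iP < P.size) (hp' : s.v .jP < P.size) :
    supports.Holds s ↔ s.arr .dom (s.v .jQ * P.size + s.v .jP) ≠ 0 ∧
      NatAlike Q P (s.v .iQ) (s.v .jQ) (s.v .iP) (s.v .jP) := by
  have leP := h.leP.holds_entry (e := v .iP) (f := v .jP) hp hp'
  have leP' := h.leP.holds_entry (e := v .jP) (f := v .iP) hp' hp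
  have leQ := h.leQ.holds_entry (e := v .iQ) (f := v .jQ) hi hj
  have leQ' := h.leQ.holds_entry (e := v .jQ) (f := v .iQ) hj hi
  simp only [supports, domEntry, holds_and, holds_iff, leP, leP', leQ, leQ', eval_v]
  simp only [NatAlike, Holds, eval_aget, eval_add, eval_v, h.mulD _ hj]

theorem found_run_supports (h : Prepared Q P s) (hi : s.v .iQ < Q.size) (hj : s.v .jQ < Q.size)
    (hp : s.v .iP < P.size) :
    ((existsBelow .jP .nP supports).run s).v .found ≠ 0 ↔
      ∃ p' < P.size, s.arr .dom (s.v .jQ * P.size + p') ≠ 0 ∧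
        NatAlike Q P (s.v .iQ) (s.v .jQ) (s.v .iP) p' := by
  rw [← h.nP]
  refine found_run_existsBelow (by decide) (by decide) fun p' hp' s' hF jP => ?_
  have iQ : s'.v .iQ = s.v .iQ := hF.v _ rfl
  have jQ : s'.v .jQ = s.v .jQ := hF.v _ rfl
  have iP : s'.v .iP = s.v .iP := hF.v _ rfl
  have holds := holds_supports (h.frame hF rfl rfl) (iQ ▸ hi) (jQ ▸ hj) (iP ▸ hp)
    (jP ▸ h.nP ▸ hp')
  rwa [iQ, jQ, iP, jP, hF.arr rfl .dom rfl, ← h.nP] at holds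

theorem Refines.erase {d₀ d : ℕ → ℕ} (hd : Refines Q P d₀ d) {i j p : ℕ} (hi : i < Q.size)
    (hj : j < Q.size) (hp : p < P.size) (unsupported : ¬ Supported Q P i j p d) :
    Refines Q P d₀ (Function.update d (i * P.size + p) 0) ∧
      domSize Q P (Function.update d (i * P.size + p) 0) <
        domSize Q P d := by
  obtain ⟨hdom, hsupp⟩ := Classical.not_imp.mp unsupported
  refine ⟨⟨fun e he => hd.1 e ?_, fun e he x => ?_⟩, Finset.card_lt_card ?_⟩
  · rw [Function.update_apply] at he
    split_ifs at he with h
    exacts [absurd rfl he, he]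
  · rw [Function.update_apply]
    split_ifs with h
    · obtain ⟨y, rfl⟩ := FinPoset.exists_label_eq hj
      obtain ⟨rfl, rfl⟩ := mul_add_inj (Fin.is_lt _) hp h
      exact absurd ⟨P.label (e y), Fin.is_lt _, hd.2 e he y, natAlike_label.mpr
        ⟨e.le_iff_le, e.le_iff_le⟩⟩ hsupp
    · exact hd.2 e he x
  · refine Finset.ssubset_iff_of_subset (fun e he => ?_) |>.mpr ⟨i * P.size + p, ?_, ?_⟩
    · simp only [Finset.mem_filter, Function.update_apply] at he ⊢
      split_ifs at he with h
      exacts [absurd rfl he.2, he]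
    · exact Finset.mem_filter.mpr ⟨Finset.mem_range.mpr (mul_add_lt_mul hi hp), hdom⟩
    · simp

theorem prune_descends {d₀ : ℕ → ℕ} (h : Prepared Q P s) (hi : s.v .iQ < Q.size)
    (hj : s.v .jQ < Q.size) (hp : s.v .iP < P.size) :
    Descends (Refines Q P d₀) (domSize Q P)
      (Supported Q P (s.v .iQ) (s.v .jQ) (s.v .iP)) (s.arr .dom) ((prune.run s).arr .dom) := by
  intro hd
  let s₁ := (existsBelow .jP .nP supports).run s
  have found := found_run_supports h hi hj hp
  have iQ : s₁.v .iQ = s.v .iQ := run_v rfl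
  have iP : s₁.v .iP = s.v .iP := run_v rfl
  have mulD : s₁.arr .mulD = s.arr .mulD := run_arr rfl rfl
  have dom : s₁.arr .dom = s.arr .dom := run_arr rfl rfl
  have run_eq : (prune.run s).arr .dom = if s₁.v .found ≠ 0 then s.arr .dom else
      Function.update (s.arr .dom) (s.v .iQ * P.size + s.v .iP) 0 := by
    have run_eq : prune.run s = (ite (v .found) skip
      (.aset .dom (add (aget .mulD (v .iQ)) (v .iP)) (c 0))).run s₁ := rfl
    rw [run_eq, run_ite]
    split_ifs <;> simp_all [h.mulD]
  rw [run_eq]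
  split_ifs with hf
  · exact ⟨hd, .inl ⟨fun _ => found.mp hf, rfl⟩⟩
  · by_cases hs : Supported Q P (s.v .iQ) (s.v .jQ) (s.v .iP) (s.arr .dom)
    · have absent : s.arr .dom (s.v .iQ * P.size + s.v .iP) = 0 := by
        by_contra hdom
        exact hf (found.mpr (hs hdom))
      rw [← absent, Function.update_eq_self]
      exact ⟨hd, .inl ⟨hs, rfl⟩⟩
    · obtain ⟨refines, lt⟩ := hd.erase hi hj hp hs
      exact ⟨refines, .inr ⟨hs, lt⟩⟩

theorem prune_row_descends {d₀ : ℕ → ℕ} (h : Prepared Q P s) (hi : s.v .iQ < Q.size)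
    (hj : s.v .jQ < Q.size) :
    Descends (Refines Q P d₀) (domSize Q P)
      (fun d => ∀ p < P.size, Supported Q P (s.v .iQ) (s.v .jQ) p d)
      (s.arr .dom) (((Cmd.loop .iP .nP prune).run s).arr .dom) := by
  rw [← h.nP]
  refine run_loop_descends (ψ := (St.arr · .dom)) fun p hp s' hF => ?_
  have hF' := hF.loop_setv p
  have iQ : (s'.setv .iP p).v .iQ = s.v .iQ := hF'.v _ rfl
  have jQ : (s'.setv .iP p).v .jQ = s.v .jQ := hF'.v _ rfl
  have descends := prune_descends (d₀ := d₀) (h.frame hF' rfl rfl) (iQ ▸ hi) (jQ ▸ hj)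
    (by simpa [h.nP] using hp)
  rw [iQ, jQ, St.setv_arr _ (by decide)] at descends
  simpa using descends

theorem prune_rows_descends {d₀ : ℕ → ℕ} (h : Prepared Q P s) (hi : s.v .iQ < Q.size) :
    Descends (Refines Q P d₀) (domSize Q P)
      (fun d => ∀ j < Q.size, ∀ p < P.size, Supported Q P (s.v .iQ) j p d)
      (s.arr .dom) (((Cmd.loop .jQ .nQ (.loop .iP .nP prune)).run s).arr .dom) := by
  rw [← h.nQ]
  refine run_loop_descends (ψ := (St.arr · .dom)) fun j hj s' hF => ?_
  have hF' := hF.loop_setv j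
  have iQ : (s'.setv .jQ j).v .iQ = s.v .iQ := hF'.v _ rfl
  have descends := prune_row_descends (d₀ := d₀) (h.frame hF' rfl rfl) (iQ ▸ hi)
    (by simpa [h.nQ] using hj)
  rw [iQ, St.setv_arr _ (by decide)] at descends
  simpa using descends

theorem sweep_descends {d₀ : ℕ → ℕ} (h : Prepared Q P s) :
    Descends (Refines Q P d₀) (domSize Q P)
      (fun d => ∀ i < Q.size, ∀ j < Q.size, ∀ p < P.size, Supported Q P i j p d)
      (s.arr .dom) ((sweep.run s).arr .dom) := by
  rw [← h.nQ]
  refine run_loop_descends (ψ := (St.arr · .dom)) fun i hi s' hF => ?_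
  have descends := prune_rows_descends (d₀ := d₀) (h.frame (hF.loop_setv i) rfl rfl)
    (by simpa [h.nQ] using hi)
  rw [St.setv_arr _ (by decide)] at descends
  simpa [h.nQ] using descends

theorem run_propagate (h : Prepared Q P s) (hs : Q.size * P.size ≤ s.v .sweeps) :
    Refines Q P (s.arr .dom) ((propagate.run s).arr .dom) ∧ ∀ i < Q.size, ∀ j < Q.size,
      ∀ p < P.size, Supported Q P i j p ((propagate.run s).arr .dom) := by
  refine run_loop_of_descends (ψ := (St.arr · .dom)) (μ := domSize Q P)
    (R := fun d => ∀ i < Q.size, ∀ j < Q.size, ∀ p < P.size, Supported Q P i j p d)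
    (fun i s' hF => ?_) ⟨fun _ => id, fun _ => id⟩ ?_
  · have descends := sweep_descends (d₀ := s.arr .dom) (h.frame (hF.loop_setv i) rfl rfl)
    rwa [St.setv_arr _ (by decide)] at descends
  · exact ((Finset.card_filter_le _ _).trans_eq (Finset.card_range _)).trans hs

end ArcConsistency

/-! ### The search for an embedding -/

section Search

/-- Are all domains nonempty? -/
def check : Cmd :=
  block [assign .full (c 1),
    .loop .iQ .nQ (seq (existsBelow .iP .nP (domEntry .iQ .iP))
      (ite (v .found) skip (assign .full (c 0))))]

/-- Is there an embedding that maps every `x` to the chain with index `idx x`? -/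
def attempt : Cmd :=
  block [initDomains, propagate, check, ite (v .full) (assign .res (c 1)) skip]

variable {Q P : FinPoset} {s : St}

theorem full_run_check (h : Prepared Q P s) : (check.run s).v .full ≠ 0 ↔
    ∀ i < Q.size, ∃ p < P.size, s.arr .dom (i * P.size + p) ≠ 0 := by
  rw [← h.nQ]
  refine run_loop_induction (s := s.setv .full 1)
    (fun i s' => s'.v .full ≠ 0 ↔ ∀ i' < i, ∃ p < P.size, s.arr .dom (i' * P.size + p) ≠ 0)
    (by simp) fun i s' hi hF full => ?_
  have h' := (h.frame (Frame.run (assign .full (c 1)) s) rfl rfl).frame (hF.loop_setv i) rfl rfl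
  have dom : (s'.setv .iQ i).arr .dom = s.arr .dom :=
    ((hF.loop_setv i).arr rfl _ rfl).trans (by simp)
  have found := found_run_existsBelow (s := s'.setv .iQ i) (x := .iP) (y := .nP)
    (e := domEntry .iQ .iP) (r := fun p => s.arr .dom (i * P.size + p) ≠ 0) (by decide) (by decide)
    fun p _ s'' hF' iP => by
      have iQ : s''.v .iQ = i := (hF'.v _ rfl).trans (by simp)
      have mulD := (h'.frame hF' rfl rfl).mulD i (h.nQ ▸ hi)
      simp only [domEntry, Holds, eval_aget, eval_add, eval_v, iQ, iP, mulD, hF'.arr rfl .dom rfl,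
        dom]
  rw [h'.nP] at found
  have full' : ((existsBelow .iP .nP (domEntry .iQ .iP)).run (s'.setv .iQ i)).v .full =
      s'.v .full := (run_v rfl).trans (by simp)
  have run_eq : (seq (existsBelow .iP .nP (domEntry .iQ .iP))
      (ite (v .found) skip (assign .full (c 0)))).run (s'.setv .iQ i) =
    (ite (v .found) skip (assign .full (c 0))).run
      ((existsBelow .iP .nP (domEntry .iQ .iP)).run (s'.setv .iQ i)) := rfl
  rw [Nat.forall_lt_succ_right, ← found, ← full, run_eq, run_ite]
  split_ifs with hf
  · rw [run_skip, full']
    exact (and_iff_left hf).symm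
  · simpa using fun _ => not_not.mp hf

/-- The embedding `e` maps every `x` to the chain with index `idx x`. -/
def Follows (Q P : FinPoset) (s : St) (e : Q ↪o P) : Prop :=
  ∀ x, s.arr .root (P.label (e x)) = s.arr .head (s.arr .idx (Q.label x))

theorem nonempty_orderEmbedding (h : Decomposed P s) {d : ℕ → ℕ}
    (chain : ∀ i < Q.size, ∀ p < P.size, d (i * P.size + p) ≠ 0 →
      s.arr .root p = s.arr .head (s.arr .idx i))
    (supported : ∀ i < Q.size, ∀ j < Q.size, ∀ p < P.size, Supported Q P i j p d)
    (full : ∀ i < Q.size, ∃ p < P.size, d (i * P.size + p) ≠ 0) : Nonempty (Q ↪o P) := by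
  have : Finite P := .of_equiv _ P.label.symm
  let D (x : Q) : Set P := {a | d (Q.label x * P.size + P.label a) ≠ 0}
  have ne (x : Q) : (D x).Nonempty := by
    obtain ⟨p, hp, hd⟩ := full (Q.label x) (Fin.is_lt _)
    obtain ⟨a, rfl⟩ := FinPoset.exists_label_eq hp
    exact ⟨a, hd⟩
  have isChain (x : Q) : IsChain (· ≤ ·) (D x) := fun a ha b hb _ => by
    have same_root := (chain _ (Fin.is_lt _) _ (Fin.is_lt _) ha).trans
      (chain _ (Fin.is_lt _) _ (Fin.is_lt _) hb).symm
    simpa only [FinPoset.natLe_label] using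
      h.comparable _ (Fin.is_lt _) _ (Fin.is_lt _) same_root
  have arcConsistent (x x' : Q) (a : P) (ha : a ∈ D x) : ∃ a' ∈ D x', OrderedAlike a a' x x' := by
    obtain ⟨p', hp', hd, alike⟩ :=
      supported _ (Q.label x).isLt _ (Q.label x').isLt _ (P.label a).isLt ha
    obtain ⟨a', rfl⟩ := FinPoset.exists_label_eq hp'
    exact ⟨a', hd, natAlike_label.mp alike⟩
  obtain ⟨e, -⟩ := exists_orderEmbedding_of_arcConsistent D (fun x => Set.toFinite _) ne isChain
    arcConsistent
  exact ⟨e⟩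

theorem run_attempt (h : Prepared Q P s) (hs : Q.size * P.size ≤ s.v .sweeps) :
    ((attempt.run s).v .res = 1 ∧ Nonempty (Q ↪o P)) ∨
      ((attempt.run s).v .res = s.v .res ∧ ∀ e : Q ↪o P, ¬ Follows Q P s e) := by
  let s₁ := initDomains.run s
  let s₂ := propagate.run s₁
  let s₃ := check.run s₂
  have h₁ : Prepared Q P s₁ := h.frame (Frame.run _ s) rfl rfl
  have h₂ : Prepared Q P s₂ := h₁.frame (Frame.run _ s₁) rfl rfl
  have init := run_initDomains h
  obtain ⟨⟨shrinks, within⟩, supported⟩ := run_propagate h₁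
    (hs.trans_eq (run_v (c := initDomains) rfl).symm)
  have full := full_run_check h₂
  have run_eq : attempt.run s = (ite (v .full) (assign .res (c 1)) skip).run s₃ := rfl
  rw [run_eq, run_ite]
  split_ifs with hfull
  · refine .inl ⟨by simp, nonempty_orderEmbedding h.toDecomposed (d := s₂.arr .dom)
      (fun i hi p hp hd => (init i hi p hp).mp (shrinks _ hd)) supported (full.mp hfull)⟩
  · have res_eq : s₃.v .res = s.v .res :=
      (run_v (c := check) rfl).trans ((run_v (c := propagate) rfl).trans (run_v rfl))
    refine .inr ⟨res_eq, fun e he => hfull (full.mpr fun i hi => ?_)⟩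
    obtain ⟨x, rfl⟩ := FinPoset.exists_label_eq hi
    exact ⟨P.label (e x), Fin.is_lt _,
      within e (fun x => (init _ (Fin.is_lt _) _ (Fin.is_lt _)).mpr (he x)) x⟩

/-! ### The odometer -/

/-- Adds `carry` to the digit `iQ` to the base `nC`. -/
def addCarry : Cmd :=
  ite (v .carry)
    (ite (lt (add (aget .idx (v .iQ)) (c 1)) (v .nC))
      (block [aset .idx (v .iQ) (add (aget .idx (v .iQ)) (c 1)), assign .carry (c 0)])
      (aset .idx (v .iQ) (c 0))) skip

/-- The digits of the number `t` to the base `nC` in the array `idx` become those of `t + 1`. -/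
def increment : Cmd := block [assign .carry (c 1), .loop .iQ .nQ addCarry]

/-- The first `q` digits of `t` to the base `k` are stored in the array `idx`. -/
def Odometer (q k t : ℕ) (s : St) : Prop := ∀ i < q, s.arr .idx i = t / k ^ i % k

theorem succ_div_mod (k m b : ℕ) (hk : 0 < k) (hb : b ≤ 1) :
    (m + b) / k = m / k + (if m % k + b < k then 0 else 1) ∧
      (m + b) % k = if m % k + b < k then m % k + b else 0 := by
  have lt := Nat.mod_lt m hk
  have decomposition := Nat.div_add_mod m k
  have sum_eq : m + b = k * (m / k) + (m % k + b) := by omega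
  split_ifs with h
  · rw [sum_eq, Nat.mul_add_div hk, Nat.mul_add_mod, Nat.div_eq_of_lt h, Nat.mod_eq_of_lt h]
    exact ⟨rfl, rfl⟩
  · have top : m % k + b = k := by omega
    rw [sum_eq, top, Nat.mul_add_div hk, Nat.mul_add_mod, Nat.div_self hk, Nat.mod_self]
    exact ⟨rfl, rfl⟩

theorem run_addCarry (hcarry : s.v .carry ≤ 1) (hidx : s.arr .idx (s.v .iQ) < s.v .nC) :
    let sum := s.arr .idx (s.v .iQ) + s.v .carry
    (addCarry.run s).v .carry = (if sum < s.v .nC then 0 else 1) ∧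
      (addCarry.run s).arr .idx =
        Function.update (s.arr .idx) (s.v .iQ) (if sum < s.v .nC then sum else 0) := by
  simp only [addCarry, run_ite, holds_lt, eval_add, eval_aget, eval_v, eval_c]
  rcases Nat.le_one_iff_eq_zero_or_eq_one.mp hcarry with h | h
  · simp [h, hidx]
  · simp only [Holds, eval_v, h]
    split_ifs <;> simp_all

theorem odometer_run_increment {t : ℕ} (hk : 0 < s.v .nC)
    (h : Odometer (s.v .nQ) (s.v .nC) t s) :
    Odometer (s.v .nQ) (s.v .nC) (t + 1) (increment.run s) := by
  let k := s.v .nC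
  have loop_spec : let s' := increment.run s
      s'.v .carry ≤ 1 ∧ (t + 1) / k ^ s.v .nQ = t / k ^ s.v .nQ + s'.v .carry ∧
        (∀ j < s.v .nQ, s'.arr .idx j = (t + 1) / k ^ j % k) ∧
        ∀ j, s.v .nQ ≤ j → s'.arr .idx j = s.arr .idx j := by
    refine run_loop_induction (s := s.setv .carry 1)
      (fun i s' => s'.v .carry ≤ 1 ∧ (t + 1) / k ^ i = t / k ^ i + s'.v .carry ∧
        (∀ j < i, s'.arr .idx j = (t + 1) / k ^ j % k) ∧ ∀ j, i ≤ j → s'.arr .idx j = s.arr .idx j)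
      (by simp) ?_
    rintro i s' hi hF ⟨carry_le, quotient, below, above⟩
    have nC : s'.v .nC = k := hF.v _ rfl
    have idx : s'.arr .idx i = t / k ^ i % k := (above i le_rfl).trans (h i hi)
    obtain ⟨carry', idx'⟩ := run_addCarry (s := s'.setv .iQ i) (by simpa using carry_le)
      (by simpa [nC, idx] using Nat.mod_lt _ hk)
    obtain ⟨div_eq, mod_eq⟩ := succ_div_mod k (t / k ^ i) (s'.v .carry) hk carry_le
    simp only [St.setv_v, ne_eq, reduceCtorEq, not_false_eq_true, St.setv_arr, if_true, if_false,
      idx, nC] at carry' idx'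
    rw [← mod_eq, ← quotient] at idx'
    rw [← carry', ← quotient, Nat.div_div_eq_div_mul, Nat.div_div_eq_div_mul, ← pow_succ] at div_eq
    refine ⟨carry'.trans_le (by split_ifs <;> decide), div_eq, fun j hj => ?_, fun j hj => ?_⟩
    · rw [idx', Function.update_apply]
      split_ifs with e
      exacts [e ▸ rfl, below j (by omega)]
    · rw [idx', Function.update_of_ne (by omega), above j (by omega)]
  exact loop_spec.2.2.1

theorem exists_digits {q k : ℕ} (f : Fin q → Fin k) :
    ∃ t < k ^ q, ∀ i : Fin q, t / k ^ (i : ℕ) % k = f i := by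
  refine ⟨finFunctionFinEquiv f, Fin.is_lt _, fun i => ?_⟩
  rw [← finFunctionFinEquiv_symm_apply_val, Equiv.symm_apply_apply]

end Search

/-! ### The decision algorithm -/

section Decision

/-- Computes how often the search has to be tried, and how often the domains have to be pruned. -/
def limits : Cmd := block [power .total .nC .nQ, addMul .sweeps (c 0) .nQ .nP]

/-- Everything that precedes the search for embeddings. -/
def prepare : Cmd := block [load, auction, decompose, limits]

/-- Runs through all maps from `Q` to the chains. -/
def attempts : Cmd := .loop .iT .total (seq attempt increment)

/-- The decision algorithm for the embedding problem. -/
def embed : Cmd :=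
  ite (get (c 0)) (ite (get (c 1)) (seq prepare attempts) skip) (assign .res (c 1))

variable {Q P : FinPoset} {s : St}

theorem Decomposed.nC_pos (h : Decomposed P s) (hP : 0 < P.size) : 0 < s.v .nC := by
  obtain ⟨t, ht, -⟩ := h.head 0 hP
  exact Nat.zero_lt_of_lt ht

theorem run_limits (h : Prepared Q P s) : let s' := limits.run s
    s'.v .total = s'.v .nC ^ Q.size ∧ s'.v .sweeps = Q.size * P.size := by
  have total := run_power_v s .total .nC .nQ (by decide) (by decide) (by decide)
  have nC : ((power .total .nC .nQ).run s).v .nC = s.v .nC := run_v rfl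
  have h' : Prepared Q P ((power .total .nC .nQ).run s) := h.frame (Frame.run _ s) rfl rfl
  simp [limits, run_addMul, total, nC, h.nQ, h'.nQ, h'.nP]

theorem prepared_run_prepare (Q P : FinPoset) :
    let s := prepare.run (.start (embeddingProblem.encode (Q, P)))
    Prepared Q P s ∧ s.v .total = s.v .nC ^ Q.size ∧ s.v .sweeps = Q.size * P.size ∧
      s.v .res = 0 ∧ s.arr .idx = 0 := by
  obtain ⟨loaded, mulD, zero⟩ := loaded_run_load Q P
  have res : (load.run (.start (embeddingProblem.encode (Q, P)))).v .res = 0 := run_v rfl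
  have run_eq (s : St) : prepare.run s =
    limits.run (decompose.run (auction.run (load.run s))) := rfl
  rw [run_eq]
  generalize load.run (.start (embeddingProblem.encode (Q, P))) = s at loaded mulD zero res ⊢
  obtain ⟨isAuction, settled⟩ := run_auction loaded (zero .owner nofun nofun nofun)
    (zero .price nofun nofun nofun)
  have auctioned : Loaded Q P (auction.run s) := loaded.frame (Frame.run _ s) rfl
  have mulD' : (decompose.run (auction.run s)).arr .mulD = s.arr .mulD :=
    (run_arr rfl rfl).trans (run_arr rfl rfl)
  have prepared : Prepared Q P (decompose.run (auction.run s)) :=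
    ⟨auctioned.frame (Frame.run _ _) rfl, decomposed_run_decompose auctioned isAuction settled,
      by rwa [mulD']⟩
  obtain ⟨total, sweeps⟩ := run_limits prepared
  refine ⟨prepared.frame (Frame.run limits _) rfl rfl, total, sweeps, ?_, ?_⟩
  · exact (run_v rfl).trans ((run_v rfl).trans ((run_v rfl).trans res))
  · exact (run_arr rfl rfl).trans ((run_arr rfl rfl).trans ((run_arr rfl rfl).trans
      (zero .idx nofun nofun nofun)))

theorem run_attempts (h : Prepared Q P s) (nC : 0 < s.v .nC)
    (hsweeps : s.v .sweeps = Q.size * P.size) (hres : s.v .res = 0) (hidx : s.arr .idx = 0) :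
    ((attempts.run s).v .res = 1 ∧ Nonempty (Q ↪o P)) ∨
      ((attempts.run s).v .res = 0 ∧ ∀ t < s.v .total, ∀ e : Q ↪o P, ∃ x,
        s.arr .root (P.label (e x)) ≠ s.arr .head (t / s.v .nC ^ (Q.label x : ℕ) % s.v .nC)) := by
  refine (run_loop_induction (s := s) (fun t s' => Odometer Q.size (s.v .nC) t s' ∧
    ((s'.v .res = 1 ∧ Nonempty (Q ↪o P)) ∨ (s'.v .res = 0 ∧ ∀ t' < t, ∀ e : Q ↪o P, ∃ x,
      s.arr .root (P.label (e x)) ≠ s.arr .head (t' / s.v .nC ^ (Q.label x : ℕ) % s.v .nC))))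
    ⟨fun i _ => by simp [hidx], .inr ⟨hres, nofun⟩⟩ ?_).2
  rintro t s' - hF ⟨odometer, outcome⟩
  have hF := hF.loop_setv t
  have h' := h.frame hF rfl rfl
  let s₁ := attempt.run (s'.setv .iT t)
  have h₁ : Prepared Q P s₁ := h'.frame (Frame.run attempt _) rfl rfl
  have nC₁ : s₁.v .nC = s.v .nC := (run_v rfl).trans (hF.v _ rfl)
  have idx₁ : s₁.arr .idx = s'.arr .idx := (run_arr rfl rfl).trans (by simp)
  have odometer₁ : Odometer (s₁.v .nQ) (s₁.v .nC) t s₁ := by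
    rw [Odometer, h₁.nQ, nC₁, idx₁]
    exact odometer
  have odometer' := odometer_run_increment (by rwa [nC₁]) odometer₁
  rw [h₁.nQ, nC₁] at odometer'
  refine ⟨odometer', ?_⟩
  have run_eq : (seq attempt increment).run (s'.setv .iT t) = increment.run s₁ := rfl
  have res' : (increment.run s₁).v .res = s₁.v .res := run_v rfl
  rw [run_eq, res']
  obtain success | ⟨res₁, none_follows⟩ :=
    run_attempt h' (hsweeps.symm.trans (hF.v .sweeps rfl).symm).le
  · exact .inl success
  have res₁ : s₁.v .res = s'.v .res := res₁.trans (by simp)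
  rw [res₁]
  refine outcome.imp_right (And.imp_right fun missed => Nat.forall_lt_succ_right.mpr
    ⟨missed, fun e => ?_⟩)
  simpa only [Follows, not_forall, hF.arr rfl .root rfl, hF.arr rfl .head rfl,
    St.setv_arr s' (show Var.iT ≠ .base by decide), odometer _ (Fin.is_lt _)] using none_follows e

theorem run_embed (Q P : FinPoset) [Decidable (Nonempty (Q ↪o P))] :
    (embed.run (.start (embeddingProblem.encode (Q, P)))).v .res =
      if Nonempty (Q ↪o P) then 1 else 0 := by
  have size_eq : (St.start (embeddingProblem.encode (Q, P))).m 0 = Q.size ∧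
      (St.start (embeddingProblem.encode (Q, P))).m 1 = P.size := ⟨rfl, rfl⟩
  simp only [embed, run_ite, Holds, eval_get, eval_c, size_eq]
  by_cases hQ : Q.size = 0
  · have : IsEmpty Q := Q.label.isEmpty_congr.mpr (hQ ▸ Fin.isEmpty')
    have : Nonempty (Q ↪o P) := ⟨.ofIsEmpty⟩
    simp [hQ, this]
  by_cases hP : P.size = 0
  · have : IsEmpty P := P.label.isEmpty_congr.mpr (hP ▸ Fin.isEmpty')
    have hne : ¬ Nonempty (Q ↪o P) := fun ⟨e⟩ =>
      isEmptyElim (e (Q.label.symm ⟨0, Nat.pos_of_ne_zero hQ⟩))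
    simp [hQ, hP, hne, St.start]
  rw [if_pos hQ, if_pos hP]
  obtain ⟨h, total, sweeps, res, idx⟩ := prepared_run_prepare Q P
  set s := prepare.run (.start (embeddingProblem.encode (Q, P)))
  have head := h.head
  have nC := h.nC_pos (Nat.pos_of_ne_zero hP)
  have run_eq : (seq prepare attempts).run (.start (embeddingProblem.encode (Q, P))) =
    attempts.run s := rfl
  rw [run_eq]
  obtain ⟨res', ne⟩ | ⟨res', missed⟩ := run_attempts h nC sweeps res idx
  · rw [res', if_pos ne]
  rw [res', if_neg]
  rintro ⟨e⟩
  choose f hf head_f using fun i : Fin Q.size => head _ (P.label (e (Q.label.symm i))).isLt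
  obtain ⟨t, ht, digits⟩ := exists_digits fun i => (⟨f i, hf i⟩ : Fin (s.v .nC))
  obtain ⟨x, hx⟩ := missed t (total ▸ ht) e
  exact hx (by rw [digits (Q.label x), head_f, Equiv.symm_apply_apply])

end Decision

/-! ### The running time of the decision algorithm -/

section Cost

variable {c d : Cmd} {s : St} {N : ℕ}

theorem Cmd.cost_seq_le (hc : c.cost s ≤ c.size * N) (hd : d.cost (c.run s) ≤ d.size * N) :
    (seq c d).cost s ≤ (seq c d).size * N :=
  (add_le_add hc hd).trans_eq (add_mul _ _ _).symm

theorem Cmd.cost_ite_le {e : Exp} (hN : 1 ≤ N) (hc : e.Holds s → c.cost s ≤ c.size * N)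
    (hd : ¬ e.Holds s → d.cost s ≤ d.size * N) :
    (ite e c d).cost s ≤ (ite e c d).size * N := by
  have branch : (if e.Holds s then c.cost s else d.cost s) ≤ c.size * N + d.size * N := by
    split_ifs with h
    exacts [le_add_right (hc h), le_add_left (hd h)]
  exact (add_le_add hN branch).trans_eq (by simp only [size]; ring)

theorem Cmd.cost_le_of_nest_le {σ : Var → ℕ} (L : List Var)
    (hc : ∀ y, c.bounds y = true → y ∈ L ∧ c.writes y = false)
    (hs : ∀ y ∈ L, 1 ≤ σ y ∧ s.v y ≤ σ y) (hN : c.nest σ ≤ N) : c.cost s ≤ c.size * N :=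
  (cost_le (fun y hy => (hc y hy).2) (fun y hy => (hs y (hc y hy).1).1)
    fun y hy => (hs y (hc y hy).1).2).trans (Nat.mul_le_mul_left _ hN)

theorem cost_offsets_le (header : ℕ) (hN : 1 ≤ N) (hQ : s.m 0 ≤ N) (hP : s.m 1 ≤ N) :
    (offsets header).cost s ≤ (offsets header).size * N := by
  have one {x e} {s : St} : (assign x e).cost s ≤ (assign x e).size * N := by simpa [cost, size]
  refine cost_seq_le one (cost_seq_le one (cost_le_of_nest_le (σ := fun _ => N) [.nQ, .nP]
    (fun y => ?_) (by simp [hN, hQ, hP]) ?_))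
  · cases y <;> simp [bounds, writes, addMul, block]
  · simp [nest, addMul, block, hN]

theorem cost_tables_le (hN : 1 ≤ N) (hQ : s.v .nQ ≤ N) (hP : s.v .nP ≤ N) :
    tables.cost s ≤ tables.size * N := by
  refine cost_le_of_nest_le (σ := fun _ => N) [.nQ, .nP] (fun y => ?_) (by simp [hN, hQ, hP]) ?_
  · cases y <;> decide
  · simp [nest, tables, multiples, block, hN]

theorem cost_auction_le {n : ℕ} (hn : 1 ≤ n) (hs : s.v .nP = n) :
    auction.cost s ≤ auction.size * (2 * n ^ 4) := by
  have n_le : n ≤ 2 * n ^ 4 :=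
    (Nat.le_self_pow (by norm_num) n).trans (Nat.le_mul_of_pos_left _ two_pos)
  refine cost_seq_le ?_ (cost_seq_le ?_ ?_)
  · simpa [cost, size] using hn.trans n_le
  · refine cost_le_of_nest_le (σ := fun _ => n) [.nP] (fun y => ?_) ?_ ?_
    · cases y <;> decide
    · simp [hn, hs]
    · simpa [nest, addMul, block] using ⟨n_le, hn.trans n_le⟩
  · refine cost_le_of_nest_le (σ := fun y => if y = .rounds then (n + 1) * n else n) [.nP, .rounds]
      (fun y => ?_) ?_ ?_
    · cases y <;> decide
    · have rounds_pos : 1 ≤ (n + 1) * n := Nat.mul_pos n.succ_pos hn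
      simp [run_addMul, hs, hn, rounds_pos]
    · have nest_le : (n + 1) * n * (n * n) ≤ 2 * n ^ 4 := by
        calc (n + 1) * n * (n * n) ≤ (n + n) * n * (n * n) := by gcongr
          _ = 2 * n ^ 4 := by ring
      simpa [nest, search, inspect, buy, bid, block, hn] using ⟨nest_le, hn.trans n_le⟩

theorem cost_decompose_le {n : ℕ} (hn : 1 ≤ n) (hs : s.v .nP = n) :
    decompose.cost s ≤ decompose.size * n ^ 2 := by
  refine cost_le_of_nest_le (σ := fun _ => n) [.nP] (fun y => ?_) ?_ ?_
  · cases y <;> decide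
  · simp [hn, hs]
  · simpa [nest, decompose, climb, follow, collect, block, hn, ← sq] using Nat.one_le_pow 2 n hn

theorem cost_limits_le {n q w : ℕ} (hn : 1 ≤ n) (hq : 1 ≤ q) (hw : 1 ≤ w) (nP : s.v .nP = n)
    (nQ : s.v .nQ = q) (nC : s.v .nC ≤ w) :
    limits.cost s ≤ limits.size * (w ^ q * q * n) := by
  refine cost_le_of_nest_le (σ := fun y => if y = .nP then n else if y = .nQ then q else w)
    [.nP, .nQ, .nC] (fun y => ?_) ?_ ?_
  · cases y <;> decide
  · simp [*]
  · have w_le : w ≤ w ^ q := Nat.le_self_pow (Nat.one_le_iff_ne_zero.mp hq) w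
    have pos := Nat.pow_pos (n := q) hw
    have power_le : q * w ≤ w ^ q * q * n := by
      calc q * w ≤ q * w ^ q := by gcongr
        _ = w ^ q * q := mul_comm _ _
        _ ≤ w ^ q * q * n := Nat.le_mul_of_pos_right _ hn
    have n_le : n ≤ w ^ q * q * n := Nat.le_mul_of_pos_left _ (Nat.mul_pos pos hq)
    simpa [nest, limits, power, addMul, block, hw] using ⟨power_le, n_le, hn.trans n_le⟩

theorem cost_attempts_le {n q w : ℕ} (hn : 1 ≤ n) (hq : 1 ≤ q) (hw : 1 ≤ w) (nP : s.v .nP = n)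
    (nQ : s.v .nQ = q) (sweeps : s.v .sweeps = q * n) (total : s.v .total ≤ w ^ q) :
    attempts.cost s ≤ attempts.size * (w ^ q * q ^ 3 * n ^ 3) := by
  refine cost_le_of_nest_le (σ := fun y => if y = .nP then n else if y = .nQ then q else
    if y = .total then w ^ q else q * n) [.nP, .nQ, .sweeps, .total] (fun y => ?_) ?_ ?_
  · cases y <;> decide
  · have := Nat.mul_pos hq hn
    have := Nat.pow_pos (n := q) hw
    simp_all [Nat.one_le_iff_ne_zero]
  · have le_self (a : ℕ) : a ≤ a ^ 3 := Nat.le_self_pow (by norm_num) a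
    have one_le : 1 ≤ n ^ 3 := Nat.pow_pos hn
    have init_le : q * n ≤ q ^ 3 * n ^ 3 := Nat.mul_le_mul (le_self q) (le_self n)
    have propagate_le : q * n * (q * (q * (n * n))) ≤ q ^ 3 * n ^ 3 := le_of_eq (by ring)
    have increment_le : q ≤ q ^ 3 * n ^ 3 := (le_self q).trans (Nat.le_mul_of_pos_right _ one_le)
    have nest_le := max_le propagate_le (max_le init_le increment_le)
    simpa [nest, attempts, attempt, increment, addCarry, initDomains, propagate, sweep, prune,
      check, existsBelow, block, hn, hq, mul_assoc (w ^ q)] using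
      Nat.mul_le_mul_left (w ^ q) nest_le

variable {Q P : FinPoset}

theorem cost_load_le (hN : 1 ≤ N) (hQ : Q.size ≤ N) (hP : P.size ≤ N) :
    load.cost (.start (embeddingProblem.encode (Q, P))) ≤ load.size * N := by
  let s₀ := St.start (embeddingProblem.encode (Q, P))
  let s₁ := (offsets 2).run s₀
  have loaded := (loaded_run_load Q P).1
  have nQ : (s₁.setv .base (s₁.v .offC)).v .nQ = Q.size :=
    (run_v (c := tables) rfl).symm.trans loaded.nQ
  have nP : (s₁.setv .base (s₁.v .offC)).v .nP = P.size :=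
    (run_v (c := tables) rfl).symm.trans loaded.nP
  refine cost_seq_le (cost_offsets_le 2 hN hQ hP) (cost_seq_le ?_ (cost_seq_le
    (cost_tables_le hN (nQ.trans_le hQ) (nP.trans_le hP)) (Nat.zero_le _)))
  simpa [cost, size]

theorem cost_prepare_le (hw : 1 ≤ P.width) (hQ : 1 ≤ Q.size) (hP : 1 ≤ P.size)
    (auction_le : 2 * P.size ^ 4 ≤ N) (limits_le : P.width ^ Q.size * Q.size * P.size ≤ N) :
    prepare.cost (.start (embeddingProblem.encode (Q, P))) ≤ prepare.size * N := by
  have pow_pos : 1 ≤ P.width ^ Q.size := Nat.one_le_pow _ _ hw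
  have q_le : Q.size ≤ N := limits_le.trans' <|
    (Nat.le_mul_of_pos_left _ pow_pos).trans (Nat.le_mul_of_pos_right _ hP)
  have n_le : P.size ≤ N := limits_le.trans' (Nat.le_mul_of_pos_left _ (Nat.mul_pos pow_pos hQ))
  have sq_le : P.size ^ 2 ≤ N := auction_le.trans' <|
    (Nat.pow_le_pow_right hP (by decide)).trans (Nat.le_mul_of_pos_left _ two_pos)
  have load_le := cost_load_le (Q := Q) (P := P) (hP.trans n_le) q_le n_le
  have nC_le := (prepared_run_prepare Q P).1.nC_le
  have loaded := (loaded_run_load Q P).1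
  have run_eq (s : St) : prepare.run s =
    limits.run (decompose.run (auction.run (load.run s))) := rfl
  rw [run_eq, run_v (c := limits) rfl] at nC_le
  refine cost_seq_le load_le ?_
  generalize load.run (.start (embeddingProblem.encode (Q, P))) = s at loaded nC_le ⊢
  have nP : (auction.run s).v .nP = P.size := (run_v rfl).trans loaded.nP
  have nP' : (decompose.run (auction.run s)).v .nP = P.size := (run_v rfl).trans nP
  have nQ' : (decompose.run (auction.run s)).v .nQ = Q.size :=
    (run_v rfl).trans ((run_v rfl).trans loaded.nQ)
  refine cost_seq_le ((cost_auction_le hP loaded.nP).trans (Nat.mul_le_mul_left _ auction_le))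
    (cost_seq_le ((cost_decompose_le hP nP).trans (Nat.mul_le_mul_left _ sq_le))
      (cost_seq_le ((cost_limits_le hP hQ hw nP' nQ' nC_le).trans (Nat.mul_le_mul_left _ limits_le))
        (Nat.zero_le _)))

theorem cost_embed_le (Q P : FinPoset) :
    embed.cost (.start (embeddingProblem.encode (Q, P))) ≤
      embed.size * (2 * (P.width ^ Q.size * Q.size ^ 4 * P.size ^ 4) + 1) := by
  have size_eq : (St.start (embeddingProblem.encode (Q, P))).m 0 = Q.size ∧
      (St.start (embeddingProblem.encode (Q, P))).m 1 = P.size := ⟨rfl, rfl⟩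
  have one_le (N : ℕ) : 1 ≤ N + 1 := Nat.le_add_left 1 N
  refine cost_ite_le (one_le _) (fun hQ => cost_ite_le (one_le _) (fun hP => ?_) fun _ => ?_)
    fun _ => ?_
  rotate_left
  · exact Nat.zero_le _
  · simp [cost, size]
  simp only [Holds, eval_get, eval_c, size_eq, ← Nat.one_le_iff_ne_zero] at hQ hP
  obtain ⟨prepared, total, sweeps, -⟩ := prepared_run_prepare Q P
  have nC_pos := prepared.nC_pos hP
  have nC_le := prepared.nC_le
  have hw : 1 ≤ P.width := nC_pos.trans_le nC_le
  have pow_pos : 1 ≤ P.width ^ Q.size := Nat.one_le_pow _ _ hw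
  have monomial_le {a b : ℕ} (ha : a ≤ 4) (hb : b ≤ 4) :
      P.width ^ Q.size * Q.size ^ a * P.size ^ b ≤
        P.width ^ Q.size * Q.size ^ 4 * P.size ^ 4 :=
    Nat.mul_le_mul (Nat.mul_le_mul_left _ (Nat.pow_le_pow_right hQ ha))
      (Nat.pow_le_pow_right hP hb)
  have n_le : P.size ^ 4 ≤ P.width ^ Q.size * Q.size ^ 4 * P.size ^ 4 :=
    Nat.le_mul_of_pos_left _ (Nat.mul_pos pow_pos (Nat.one_le_pow _ _ hQ))
  have limits_le := monomial_le (a := 1) (b := 1) (by decide) (by decide)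
  have attempts_le := monomial_le (a := 3) (b := 3) (by decide) (by decide)
  rw [pow_one, pow_one] at limits_le
  refine cost_seq_le (cost_prepare_le hw hQ hP (by omega) (by omega)) ?_
  generalize prepare.run (.start (embeddingProblem.encode (Q, P))) = s at *
  exact (cost_attempts_le hP hQ hw prepared.nP prepared.nQ sweeps
    (total.trans_le (Nat.pow_le_pow_left nC_le _))).trans (Nat.mul_le_mul_left _ (by omega))

end Cost

end RAM
theorem RAM.Program.DecidesWithin.mono {A : Program} {input : List ℕ} {yes : Prop} {T T' : ℕ}
    (h : A.DecidesWithin input yes T) (hT : T ≤ T') : A.DecidesWithin input yes T' :=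
  h.imp fun _ => And.imp_left fun ht => ht.trans hT

theorem exists_decidesWithin_embedding : ∃ (A : RAM.Program) (K : ℕ), ∀ Q P : FinPoset,
    A.DecidesWithin (embeddingProblem.encode (Q, P)) (Nonempty (Q ↪o P))
      (K * (P.width ^ Q.size * Q.size ^ 4 * P.size ^ 4 + 1)) := by
  classical
  refine ⟨RAM.embed.compile, RAM.embed.compile.length * (2 * RAM.embed.size), fun Q P => ?_⟩
  rw [mul_assoc, mul_comm 2, mul_assoc]
  exact RAM.Cmd.compile_decidesWithin (RAM.run_embed Q P)
    ((RAM.cost_embed_le Q P).trans (Nat.mul_le_mul_left _ (by omega)))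

theorem fixedParameterTractable_embeddingProblem : embeddingProblem.FixedParameterTractable := by
  obtain ⟨A, K, decides⟩ := exists_decidesWithin_embedding
  have primrec_pow : Primrec₂ fun a b : ℕ => a ^ b := Primrec₂.unpaired'.1 Nat.Primrec.pow
  have computable : Computable fun p : ℕ × ℕ => K * (p.1 ^ p.2 * p.2 ^ 4 + 1) :=
    (Primrec.nat_mul.comp (Primrec.const K) (Primrec.succ.comp (Primrec.nat_mul.comp
      (primrec_pow.comp Primrec.fst Primrec.snd)
      (primrec_pow.comp Primrec.snd (Primrec.const 4))))).to_comp
  refine ⟨A, _, 4, computable, fun ⟨Q, P⟩ => (decides Q P).mono ?_⟩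
  have length_eq : (embeddingProblem.encode (Q, P)).length =
      2 + Q.size * Q.size + P.size * P.size := by
    simp only [embeddingProblem, List.length_append, List.length_cons, List.length_nil,
      FinPoset.length_matrix]
  have size_le : P.size ≤ (embeddingProblem.encode (Q, P)).length := by
    have := Nat.le_mul_self P.size
    omega
  have one_le : 1 ≤ (embeddingProblem.encode (Q, P)).length := by omega
  calc K * (P.width ^ Q.size * Q.size ^ 4 * P.size ^ 4 + 1)
      ≤ K * (P.width ^ Q.size * Q.size ^ 4 * (embeddingProblem.encode (Q, P)).length ^ 4 +
          (embeddingProblem.encode (Q, P)).length ^ 4) := by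
        gcongr
        exact Nat.one_le_pow _ _ one_le
    _ = K * (P.width ^ Q.size * Q.size ^ 4 + 1) * (embeddingProblem.encode (Q, P)).length ^ 4 := by
        ring
namespace RAM

open Cmd Exp

/-! ### Writing lists into the memory -/

/-- From `s` to `s'`, the list `L` has been written to the addresses from `out` on. -/
structure Appends (L : List ℕ) (s s' : St) : Prop where
  out : s'.v .out = s.v .out + L.length
  keep : ∀ a < s.v .out, s'.m a = s.m a
  written : ∀ (i : ℕ) (h : i < L.length), s'.m (s.v .out + i) = L[i]

/-- From `s` to `s'`, the lists in `T` have been written, and they have been counted by `x`. -/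
structure Emits (x : Var) (T : List (List ℕ)) (s s' : St) : Prop where
  appends : Appends T.flatten s s'
  count : s'.v x = s.v x + T.length

/-- Between `s` and `s'`, only variables assigned by `c` have changed, and the memory has only
changed from the address `out` on. -/
structure Grows (c : Cmd) (s s' : St) : Prop where
  v : ∀ x, c.writes x = false → s'.v x = s.v x
  out_le : s.v .out ≤ s'.v .out
  keep : ∀ a < s.v .out, s'.m a = s.m a

section

variable {L L' : List ℕ} {T T' : List (List ℕ)} {s s' s₁ s₂ s₃ : St} {x y : Var} {c d : Cmd}

theorem Appends.refl (s : St) : Appends [] s s := ⟨rfl, fun _ _ => rfl, nofun⟩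

theorem Appends.append (h : Appends L s₁ s₂) (h' : Appends L' s₂ s₃) :
    Appends (L ++ L') s₁ s₃ where
  out := by rw [h'.out, h.out, List.length_append, add_assoc]
  keep a ha := (h'.keep a (by rw [h.out]; omega)).trans (h.keep a ha)
  written i hi := by
    rw [List.length_append] at hi
    have out₂ := h.out
    rcases lt_or_ge i L.length with lt | ge
    · rw [h'.keep _ (by omega), h.written i lt, List.getElem_append_left lt]
    · rw [List.getElem_append_right ge, ← h'.written _ (by omega), out₂]
      congr 1
      omega

theorem Appends.congr (h : Appends L s s₁) (hv : s₂.v .out = s₁.v .out) (hm : s₂.m = s₁.m) :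
    Appends L s s₂ :=
  ⟨hv.trans h.out, hm ▸ h.keep, hm ▸ h.written⟩

theorem Appends.cons_sto (h : Appends L s₂ s₃) (hv : s₂.v .out = s₁.v .out + 1) (hm : s₂.m = s₁.m)
    (n : ℕ) : Appends (n :: L) s₁ (s₃.sto (s₁.v .out) n) where
  out := by
    rw [St.sto_v, h.out, hv, List.length_cons]
    omega
  keep a ha := by rw [St.sto_m, if_neg ha.ne, h.keep a (by omega), hm]
  written i hi := by
    cases i with
    | zero => simp
    | succ i =>
      have written := h.written i (by simpa using hi)
      rw [hv] at written
      rw [St.sto_m, if_neg (by omega), List.getElem_cons_succ, ← written, add_assoc, add_comm 1]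

theorem Emits.refl (x : Var) (s : St) : Emits x [] s s := ⟨.refl s, rfl⟩

theorem Emits.append (h : Emits x T s₁ s₂) (h' : Emits x T' s₂ s₃) :
    Emits x (T ++ T') s₁ s₃ where
  appends := List.flatten_append ▸ h.appends.append h'.appends
  count := by rw [h'.count, h.count, List.length_append, add_assoc]

theorem Grows.of_appends (h : Appends L s s') (hv : ∀ x, c.writes x = false → s'.v x = s.v x) :
    Grows c s s' :=
  ⟨hv, h.out ▸ Nat.le_add_right _ _, h.keep⟩

theorem emits_dite {p : Prop} [Decidable p] {T : p → List (List ℕ)} {e : Exp} (he : e.Holds s ↔ p)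
    (hc : ∀ h, Emits x (T h) s (c.run s)) :
    Emits x (if h : p then T h else []) s ((ite e c skip).run s) := by
  by_cases h : p
  · rw [run_ite, if_pos (he.mpr h), dif_pos h]
    exact hc h
  · rw [run_ite, if_neg (mt he.mp h), dif_neg h]
    exact .refl x s

theorem emits_ite {p : Prop} [Decidable p] {e : Exp} (he : e.Holds s ↔ p)
    (hc : p → Emits x T s (c.run s)) :
    Emits x (if p then T else []) s ((ite e c skip).run s) :=
  emits_dite he hc

theorem emits_loop {P : FinPoset} {T : P → List (List ℕ)} (hx : x ≠ .out) {z : Var} (hz : x ≠ z)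
    (hy : s.v y = P.size)
    (body : ∀ (p : P) (s' : St), Grows (.loop x y c) s s' → s'.v x = P.label p →
      Emits z (T p) s' (c.run s')) :
    Emits z (P.elems.flatMap T) s ((Cmd.loop x y c).run s) := by
  have length_elems : P.elems.length = s.v y := by simp [FinPoset.elems, hy]
  rw [← List.take_length (l := P.elems), length_elems]
  refine run_loop_induction (fun i s' => Emits z ((P.elems.take i).flatMap T) s s')
    (by simpa using .refl z s) fun i s' hi hF ih => ?_
  let p := P.label.symm ⟨i, hy ▸ hi⟩
  have elems_i : P.elems[i]? = some p := by simp [FinPoset.elems, p, ← hy, hi]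
  have grows : Grows (.loop x y c) s (s'.setv x i) :=
    .of_appends (ih.appends.congr (by simp [hx.symm]) (by simp)) (hF.loop_setv i).v
  have emits := body p (s'.setv x i) grows (by simp [p])
  rw [List.take_add_one, elems_i, Option.toList_some, List.flatMap_append, List.flatMap_singleton]
  exact ih.append ⟨⟨by simpa [hx.symm] using emits.appends.out,
    by simpa [hx.symm] using emits.appends.keep, by simpa [hx.symm] using emits.appends.written⟩,
    by simpa [hz.symm] using emits.count⟩

/-- Writes the values of expressions. -/
def write : List Exp → Cmd
  | [] => skip
  | e :: l => block [store (v .out) e, assign .out (add (v .out) (.c 1)), write l]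

theorem write_writes (l : List Exp) (hx : x ≠ .out) : (write l).writes x = false := by
  induction l with
  | nil => rfl
  | cons e l ih => simp [write, block, writes, ih, hx.symm]

theorem appends_write {l : List Exp}
    (hl : ∀ s', (∀ x, x ≠ .out → s'.v x = s.v x) → l.map (eval s') = L) :
    Appends L s ((write l).run s) := by
  induction l generalizing s L with
  | nil =>
    obtain rfl : [] = L := hl s fun _ _ => rfl
    exact .refl s
  | cons e l ih =>
    obtain rfl : e.eval s :: l.map (eval s) = L := hl s fun _ _ => rfl
    let s₁ := (s.sto (s.v .out) (e.eval s)).setv .out (s.v .out + 1)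
    have appends₁ : Appends [e.eval s] s s₁ := by
      refine ⟨by simp [s₁], fun a ha => by simp [s₁, ha.ne], fun i hi => ?_⟩
      obtain rfl : i = 0 := by simpa using hi
      simp [s₁]
    refine appends₁.append (ih fun s' hs' => ?_)
    exact (List.cons.inj (hl s' fun x hx => (hs' x hx).trans (by simp [s₁, hx]))).2

/-- Runs `c` and counts the list written by it. -/
def item (x : Var) (c : Cmd) : Cmd := seq c (assign x (add (v x) (.c 1)))

theorem emits_item (hx : x ≠ .out) (hc : c.writes x = false) (h : Appends L s (c.run s)) :
    Emits x [L] s ((item x c).run s) where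
  appends := by
    rw [List.flatten_singleton]
    exact h.congr (by simp [item, run, hx.symm]) (by simp [item, run])
  count := by simp [item, run, run_v hc]

/-- Writes a header, and then the lists written by `c` preceded by their number. This number is
only known in the end; until then, its address is kept in `y`. -/
def record (x y : Var) (header : List Exp) (c : Cmd) : Cmd :=
  block [write header, assign y (v .out), assign .out (add (v .out) (.c 1)), assign x (.c 0), c,
    store (v y) (v x)]

theorem appends_record {header : List Exp} (hx : x ≠ .out) (hy : y ≠ .out) (hxy : x ≠ y)
    (hc : c.writes y = false)
    (hl : ∀ s', (∀ x, x ≠ .out → s'.v x = s.v x) → header.map (eval s') = L)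
    (body : ∀ s', Grows (record x y header c) s s' → Emits x T s' (c.run s')) :
    Appends (L ++ T.length :: T.flatten) s ((record x y header c).run s) := by
  set s₁ := (write header).run s with hs₁
  set s₂ := ((s₁.setv y (s₁.v .out)).setv .out (s₁.v .out + 1)).setv x 0 with hs₂
  have header_appends : Appends L s s₁ := appends_write hl
  have v₂ (z : Var) (hz : z ≠ .out) (hzx : z ≠ x) (hzy : z ≠ y) : s₂.v z = s.v z := by
    simp [hs₂, hz, hzx, hzy, hs₁, run_v (write_writes header hz)]
  have m₂ : s₂.m = s₁.m := rfl
  have out₂ : s₂.v .out = s₁.v .out + 1 := by simp [hs₂, hx.symm]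
  have grows : Grows (record x y header c) s s₂ := by
    refine ⟨fun z hz => ?_, by have := header_appends.out; omega, header_appends.keep⟩
    simp only [record, block, writes, Bool.or_false, Bool.or_eq_false_iff,
      decide_eq_false_iff_not] at hz
    exact v₂ z (Ne.symm hz.2.2.1) (Ne.symm hz.2.2.2.1) (Ne.symm hz.2.1)
  obtain ⟨appends, count⟩ := body s₂ grows
  set s₃ := c.run s₂ with hs₃
  have x₃ : s₃.v x = T.length := by simpa [hs₂] using count
  have y₃ : s₃.v y = s₁.v .out := by
    rw [hs₃, run_v hc]
    simp [hs₂, hxy.symm, hy]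
  have run_eq : (record x y header c).run s = s₃.sto (s₁.v .out) T.length := by
    rw [← x₃, ← y₃]
    simp [record, hs₃, hs₂, hs₁, hy.symm]
  rw [run_eq]
  exact header_appends.append (appends.cons_sto out₂ m₂ _)

end

end RAM

/-! ### Computing the constraint satisfaction instance -/

namespace ChainPartition

variable {P : FinPoset} {k : ℕ} (C : ChainPartition P k)

/-- Membership in the chains, as a relation between numbers of chains and labels of elements. -/
def natMem : ℕ → ℕ → Prop :=
  Relation.Map (fun i a => a ∈ C.part i) Fin.val fun a : P => (P.label a : ℕ)

theorem natMem_label {i : Fin k} {a : P} : C.natMem i (P.label a) ↔ a ∈ C.part i :=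
  Relation.map_apply_apply Fin.val_injective FinPoset.label_val_injective _ i a

theorem le_size (C : ChainPartition P k) : k ≤ P.size := by
  choose a ha using C.nonempty
  have injective : Function.Injective (P.label ∘ a) := P.label.injective.comp fun i j h => by
    by_contra ne
    exact Set.disjoint_left.mp (C.disjoint i j ne) (ha i) (h ▸ ha j)
  simpa using Fintype.card_le_of_injective _ injective

end ChainPartition

theorem map_filter_eq_flatMap {α β : Type*} (p : α → Prop) [DecidablePred p] (g : α → β)
    (l : List α) : (l.filter p).map g = l.flatMap fun a => if p a then [g a] else [] := by
  induction l with
  | nil => rfl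
  | cons a l ih => by_cases h : p a <;> simp [h, ih]

theorem flatMap_product {α β γ : Type*} (l : List α) (l' : List β) (g : α × β → List γ) :
    (l ×ˢ l').flatMap g = l.flatMap fun a => l'.flatMap fun b => g (a, b) := by
  induction l with
  | nil => rfl
  | cons a l ih => simp [ih, List.flatMap_map]

section Encoding

variable (Q P : FinPoset) {k : ℕ} (C : ChainPartition P k) (f : Q → Fin k)

open Classical in
/-- The tuples of a domain constraint, in terms of labels. -/
noncomputable def domainTuples (q : Q) : List (List ℕ) :=
  P.elems.flatMap fun p => if p ∈ C.part (f q) then [[(P.label p : ℕ)]] else []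

open Classical in
/-- The tuples of an order constraint, in terms of labels. -/
noncomputable def orderTuples (q q' : Q) : List (List ℕ) :=
  P.elems.flatMap fun p => P.elems.flatMap fun p' =>
    if p ∈ C.part (f q) ∧ p' ∈ C.part (f q') ∧ (p ≤ p' ↔ q ≤ q') ∧ (p' ≤ p ↔ q' ≤ q) then
      [[(P.label p : ℕ), (P.label p' : ℕ)]] else []

open Classical in
/-- The encodings of the constraints. -/
noncomputable def constraintCodes : List (List ℕ) :=
  (Q.elems.flatMap fun q => [(domainConstraint Q P C f q).encode Q.label P.label]) ++
    Q.elems.flatMap fun q => Q.elems.flatMap fun q' =>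
      if h : q ≠ q' then [(orderConstraint Q P C f q q' h).encode Q.label P.label] else []

theorem encode_domainConstraint (q : Q) :
    (domainConstraint Q P C f q).encode Q.label P.label = [1, (Q.label q : ℕ)] ++
      (domainTuples Q P C f q).length :: (domainTuples Q P C f q).flatten := by
  have tuples_eq : domainTuples Q P C f q = (domainConstraint Q P C f q).rel.map fun t =>
      List.ofFn fun j => (P.label (t j) : ℕ) := by
    rw [domainTuples, ← map_filter_eq_flatMap, domainConstraint, List.map_map]
    simp [Function.comp_def]
  rw [tuples_eq, List.length_map, ← List.flatMap_def, Constraint.encode]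
  simp [domainConstraint]

theorem encode_orderConstraint (q q' : Q) (h : q ≠ q') :
    (orderConstraint Q P C f q q' h).encode Q.label P.label =
      [2, (Q.label q : ℕ), (Q.label q' : ℕ)] ++
        (orderTuples Q P C f q q').length :: (orderTuples Q P C f q q').flatten := by
  have tuples_eq : orderTuples Q P C f q q' = (orderConstraint Q P C f q q' h).rel.map fun t =>
      List.ofFn fun j => (P.label (t j) : ℕ) := by
    rw [orderConstraint, List.map_map, map_filter_eq_flatMap, flatMap_product]
    simp [orderTuples]
  rw [tuples_eq, List.length_map, ← List.flatMap_def, Constraint.encode]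
  simp [orderConstraint]

theorem encode_assignmentCSP :
    (assignmentCSP Q P C f).encode Q.label P.label = [Q.size, P.size] ++
      (constraintCodes Q P C f).length :: (constraintCodes Q P C f).flatten := by
  have codes_eq : constraintCodes Q P C f =
      (assignmentCSP Q P C f).constraints.map (Constraint.encode Q.label P.label) := by
    rw [assignmentCSP, List.map_append, List.map_map, List.filterMap_eq_flatMap_toList,
      List.map_flatMap, flatMap_product, List.map_eq_flatMap]
    refine congrArg _ (List.flatMap_congr fun q _ => List.flatMap_congr fun q' _ => ?_)
    split_ifs <;> rfl
  rw [codes_eq, List.length_map, ← List.flatMap_def, CSP.encode]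
  rfl

end Encoding

namespace RAM

open Cmd Exp

section Assigned

variable {Q P : FinPoset} {k : ℕ} {C : ChainPartition P k} {f : Q → Fin k} {s s' : St}

variable (C f) in
/-- The posets, the chains and the chain assignment are available, and lie below the output. -/
structure Assigned (s : St) : Prop extends Loaded Q P s where
  chains : HasMatrix s .offC .mulP k P.size C.natMem
  choice : ∀ q : Q, s.m (s.v .offF + Q.label q) = f q
  offF_le : s.v .offF + Q.size ≤ s.v .base
  base_le : s.v .base + 16 * (Q.size + P.size) ≤ s.v .out

theorem Assigned.grows (h : Assigned C f s) {c : Cmd} (hG : Grows c s s')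
    (hc : [.nQ, .nP, .offQ, .offP, .offC, .offF, .base].all (!c.writes ·)) : Assigned C f s' := by
  simp only [List.all_cons, List.all_nil, Bool.and_true, Bool.and_eq_true, Bool.not_eq_true'] at hc
  obtain ⟨nQ, nP, offQ, offP, offC, offF, base⟩ := hc
  have base := hG.v _ base
  have base_le := h.base_le
  have out_le := hG.out_le
  have mem (a : ℕ) (ha : a < s.v .base) : s'.m a = s.m a := hG.keep a (by omega)
  have arr (t : Arr) (i : ℕ) (hi : i < Q.size + P.size) : s'.arr t i = s.arr t i := by
    have := t.offset_lt
    rw [St.arr, base]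
    exact hG.keep _ (by omega)
  have offF := hG.v _ offF
  refine ⟨⟨(hG.v _ nQ).trans h.nQ, (hG.v _ nP).trans h.nP,
    h.leQ.congr (hG.v _ offQ) base mem fun i hi => arr _ i (by omega),
    h.leP.congr (hG.v _ offP) base mem fun i hi => arr _ i (by omega)⟩,
    h.chains.congr (hG.v _ offC) base mem fun i hi => arr _ i ?_, fun q => ?_, ?_, ?_⟩
  · have := C.le_size
    omega
  · have := h.offF_le
    rw [offF, mem _ (by have := (Q.label q).isLt; omega), h.choice]
  · rw [offF, base]
    exact h.offF_le
  · omega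

/-- The label `y` belongs to the chain that is assigned to the label `x`. -/
def inChain (x y : Var) : Exp := entry .offC .mulP (get (add (v .offF) (v x))) (v y)

theorem holds_inChain (h : Assigned C f s) {x y : Var} {q : Q} {p : P} (hx : s.v x = Q.label q)
    (hy : s.v y = P.label p) : (inChain x y).Holds s ↔ p ∈ C.part (f q) := by
  have chain_eq : (get (add (v .offF) (v x))).eval s = f q := by
    rw [eval_get, eval_add, eval_v, eval_v, hx, h.choice]
  have holds := h.chains.holds_entry (e := get (add (v .offF) (v x))) (f := v y)
    (chain_eq ▸ (f q).isLt) (hy.trans_lt (P.label p).isLt)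
  rwa [chain_eq, eval_v, hy, C.natMem_label] at holds

/-- The elements with the labels `x`, `x'` are related like those with the labels `y`, `y'`. -/
def sameOrder (x x' y y' : Var) : Exp :=
  iff (entry .offP .mulP (v x) (v x')) (entry .offQ .mulQ (v y) (v y'))

theorem holds_sameOrder (h : Loaded Q P s) {x x' y y' : Var} {q q' : Q} {p p' : P}
    (hx : s.v x = P.label p) (hx' : s.v x' = P.label p') (hy : s.v y = Q.label q)
    (hy' : s.v y' = Q.label q') : (sameOrder x x' y y').Holds s ↔ (p ≤ p' ↔ q ≤ q') := by
  have holds_P := h.leP.holds_entry (e := v x) (f := v x') (hx.trans_lt (Fin.is_lt _))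
    (hx'.trans_lt (Fin.is_lt _))
  have holds_Q := h.leQ.holds_entry (e := v y) (f := v y') (hy.trans_lt (Fin.is_lt _))
    (hy'.trans_lt (Fin.is_lt _))
  rw [eval_v, eval_v, hx, hx', FinPoset.natLe_label] at holds_P
  rw [eval_v, eval_v, hy, hy', FinPoset.natLe_label] at holds_Q
  rw [sameOrder, holds_iff, holds_P, holds_Q]

/-- Writes the constraint that the value of `iQ` lies in its chain. -/
def writeDomain : Cmd :=
  record .count .start [c 1, v .iQ]
    (.loop .iP .nP (ite (inChain .iQ .iP) (item .count (write [v .iP])) skip))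

theorem appends_writeDomain (h : Assigned C f s) {q : Q} (hq : s.v .iQ = Q.label q) :
    Appends ((domainConstraint Q P C f q).encode Q.label P.label) s (writeDomain.run s) := by
  classical
  rw [encode_domainConstraint]
  refine appends_record (by decide) (by decide) (by decide) rfl
    (fun s' hs' => by simp [hs', hq]) fun s₁ h₁ => ?_
  have h₁' := h.grows h₁ rfl
  refine emits_loop (by decide) (by decide) h₁'.nP fun p s₂ h₂ hp => ?_
  have q_eq : s₂.v .iQ = Q.label q := (h₂.v _ rfl).trans ((h₁.v _ rfl).trans hq)
  exact emits_ite (holds_inChain (h₁'.grows h₂ rfl) q_eq hp) fun _ => emits_item (by decide) rfl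
    (appends_write fun s' hs' => by simp [hs', hp])

/-- Writes the constraint on the pair `iQ`, `jQ`. -/
def writeOrder : Cmd :=
  record .count .start [c 2, v .iQ, v .jQ]
    (.loop .iP .nP (.loop .jP .nP
      (ite (and (inChain .iQ .iP) (and (inChain .jQ .jP)
          (and (sameOrder .iP .jP .iQ .jQ) (sameOrder .jP .iP .jQ .iQ))))
        (item .count (write [v .iP, v .jP])) skip)))

theorem appends_writeOrder (h : Assigned C f s) {q q' : Q} (hq : s.v .iQ = Q.label q)
    (hq' : s.v .jQ = Q.label q') (ne : q ≠ q') :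
    Appends ((orderConstraint Q P C f q q' ne).encode Q.label P.label) s (writeOrder.run s) := by
  classical
  rw [encode_orderConstraint]
  refine appends_record (by decide) (by decide) (by decide) rfl
    (fun s' hs' => by simp [hs', hq, hq']) fun s₁ h₁ => ?_
  have h₁' := h.grows h₁ rfl
  refine emits_loop (by decide) (by decide) h₁'.nP fun p s₂ h₂ hp => ?_
  have h₂' := h₁'.grows h₂ rfl
  refine emits_loop (by decide) (by decide) h₂'.nP fun p' s₃ h₃ hp' => ?_
  have h₃' := h₂'.grows h₃ rfl
  have iQ : s₃.v .iQ = Q.label q := by rw [h₃.v _ rfl, h₂.v _ rfl, h₁.v _ rfl, hq]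
  have jQ : s₃.v .jQ = Q.label q' := by rw [h₃.v _ rfl, h₂.v _ rfl, h₁.v _ rfl, hq']
  have iP : s₃.v .iP = P.label p := (h₃.v _ rfl).trans hp
  refine emits_ite ?_ fun _ => emits_item (by decide) rfl
    (appends_write fun s' hs' => by simp [hs', iP, hp'])
  rw [holds_and, holds_and, holds_and, holds_inChain h₃' iQ iP, holds_inChain h₃' jQ hp',
    holds_sameOrder h₃'.toLoaded iP hp' iQ jQ, holds_sameOrder h₃'.toLoaded hp' iP jQ iQ]

/-- Writes the domain constraints. -/
def writeDomains : Cmd := .loop .iQ .nQ (item .num writeDomain)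

/-- Writes the order constraints. -/
def writeOrders : Cmd :=
  .loop .iQ .nQ (.loop .jQ .nQ (ite (not (eq (v .iQ) (v .jQ))) (item .num writeOrder) skip))

/-- Writes the constraint satisfaction instance. -/
def writeCSP : Cmd := record .num .mark [v .nQ, v .nP] (seq writeDomains writeOrders)

theorem emits_writeDomains (h : Assigned C f s) :
    Emits .num (Q.elems.flatMap fun q => [(domainConstraint Q P C f q).encode Q.label P.label]) s
      (writeDomains.run s) :=
  emits_loop (by decide) (by decide) h.nQ fun _ _ h₁ hq =>
    emits_item (by decide) rfl (appends_writeDomain (h.grows h₁ rfl) hq)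

open Classical in
theorem emits_writeOrders (h : Assigned C f s) :
    Emits .num (Q.elems.flatMap fun q => Q.elems.flatMap fun q' =>
      if ne : q ≠ q' then [(orderConstraint Q P C f q q' ne).encode Q.label P.label] else []) s
      (writeOrders.run s) := by
  refine emits_loop (by decide) (by decide) h.nQ fun q s₁ h₁ hq => ?_
  have h₁' := h.grows h₁ rfl
  refine emits_loop (by decide) (by decide) h₁'.nQ fun q' s₂ h₂ hq' => ?_
  have hq : s₂.v .iQ = Q.label q := (h₂.v _ rfl).trans hq
  refine emits_dite ?_ fun ne => emits_item (by decide) rfl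
    (appends_writeOrder (h₁'.grows h₂ rfl) hq hq' ne)
  rw [holds_not, holds_eq, eval_v, eval_v, hq, hq', FinPoset.label_val_injective.eq_iff]

theorem appends_writeCSP (h : Assigned C f s) :
    Appends ((assignmentCSP Q P C f).encode Q.label P.label) s (writeCSP.run s) := by
  rw [encode_assignmentCSP]
  refine appends_record (by decide) (by decide) (by decide) rfl
    (fun s' hs' => by simp [hs', h.nQ, h.nP]) fun s₁ h₁ => ?_
  have domains := emits_writeDomains (h.grows h₁ rfl)
  exact domains.append (emits_writeOrders ((h.grows h₁ rfl).grows
    (.of_appends domains.appends fun _ => run_v) rfl))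

end Assigned

section Computation

variable (Q P : FinPoset) {k : ℕ} (C : ChainPartition P k) (f : Q → Fin k)

open Classical in
/-- The rows of the membership matrix of the chains, one after the other. -/
noncomputable def chainMatrix : List ℕ :=
  List.ofFn fun t : Fin (k * P.size) => if P.label.symm t.modNat ∈ C.part t.divNat then 1 else 0

theorem length_chainMatrix : (chainMatrix P C).length = k * P.size := List.length_ofFn

theorem chainMatrix_getD_ne_zero {i j : ℕ} (hi : i < k) (hj : j < P.size) :
    (chainMatrix P C).getD (i * P.size + j) 0 ≠ 0 ↔ C.natMem i j := by
  classical
  obtain ⟨a, rfl⟩ := FinPoset.exists_label_eq hj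
  have entry_iff := getD_ofFn_matrix_ne_zero (fun i j => P.label.symm j ∈ C.part i) ⟨i, hi⟩
    (P.label a)
  rw [P.label.symm_apply_apply] at entry_iff
  exact entry_iff.trans (C.natMem_label (i := ⟨i, hi⟩)).symm

/-- Finds the addresses of the parts of the encoding of a chain assignment, and of free memory. -/
def locate : Cmd :=
  block [offsets 3, assign .nC (get (c 2)), addMul .offF (v .offC) .nC .nP,
    assign .base (add (v .offF) (v .nQ)),
    assign .out (add (v .base) (double (double (double (double (add (v .nQ) (v .nP)))))))]

/-- The positions of the parts of the encoding of a chain assignment. -/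
structure Located (s : St) : Prop where
  nQ : s.v .nQ = Q.size
  nP : s.v .nP = P.size
  offQ : s.v .offQ = 3
  offP : s.v .offP = 3 + Q.size * Q.size
  offC : s.v .offC = 3 + Q.size * Q.size + P.size * P.size
  offF : s.v .offF = 3 + Q.size * Q.size + P.size * P.size + k * P.size
  base : s.v .base = s.v .offF + Q.size
  out : s.v .out = s.v .base + 16 * (Q.size + P.size)
  m : s.m = fun i => (encodeAssignment Q P C f).getD i 0

theorem located_run_locate : Located Q P C f (locate.run (.start (encodeAssignment Q P C f))) := by
  constructor <;>
    simp [locate, offsets, run_addMul, St.start, encodeAssignment, double]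
  ring

variable {Q P C f} {s : St}

theorem Located.getD_matrix (h : Located Q P C f s) {off i : ℕ} {l₁ l₂ l₃ : List ℕ}
    (encode_eq : encodeAssignment Q P C f = l₁ ++ l₂ ++ l₃) (hoff : off = l₁.length)
    (hi : i < l₂.length) : s.m (off + i) = l₂.getD i 0 := by
  rw [h.m, encode_eq, List.append_assoc]
  exact getD_append_append hoff hi

theorem Located.loaded_run_tables (h : Located Q P C f s) : Loaded Q P (tables.run s) := by
  have := h.base
  have := h.offF
  refine RAM.loaded_run_tables h.nQ h.nP (by rw [h.offQ]; omega) (by rw [h.offP]; omega)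
    (fun i hi => ?_) fun i hi => ?_
  · refine h.getD_matrix (l₁ := [Q.size, P.size, k]) (l₃ := P.matrix ++ (chainMatrix P C ++
      Q.elems.map fun q => (f q : ℕ))) ?_ h.offQ (by rwa [FinPoset.length_matrix])
    simp [encodeAssignment, chainMatrix]
  · refine h.getD_matrix (l₁ := [Q.size, P.size, k] ++ Q.matrix) (l₃ := chainMatrix P C ++
      Q.elems.map fun q => (f q : ℕ)) ?_ ?_ (by rwa [FinPoset.length_matrix])
    · simp [encodeAssignment, chainMatrix]
    · simp only [h.offP, List.length_append, FinPoset.length_matrix, List.length_cons,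
        List.length_nil]

theorem Located.hasMatrix_chains (h : Located Q P C f s) :
    HasMatrix (tables.run s) .offC .mulP k P.size C.natMem := by
  have offC : (tables.run s).v .offC = s.v .offC := run_v rfl
  have base := (Frame.run tables s).base rfl
  have offF_eq := h.offF
  have base_eq := h.base
  have offC_eq := h.offC
  refine ⟨by omega, fun i hi => ?_, fun i hi j hj => ?_⟩
  · rw [← h.nP]
    exact (run_tables s).2.1 i (hi.trans_le (C.le_size.trans_eq h.nP.symm))
  · have lt := mul_add_lt_mul hi hj
    rw [offC, Nat.add_assoc, run_m rfl (by omega), h.getD_matrix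
      (l₁ := [Q.size, P.size, k] ++ Q.matrix ++ P.matrix) rfl ?_ (lt.trans_eq ?_)]
    · exact chainMatrix_getD_ne_zero P C hi hj
    · simp only [h.offC, List.length_append, FinPoset.length_matrix, List.length_cons,
        List.length_nil]
    · exact (length_chainMatrix P C).symm

theorem Located.assigned_run_tables (h : Located Q P C f s) : Assigned C f (tables.run s) := by
  have offF : (tables.run s).v .offF = s.v .offF := run_v rfl
  have base := (Frame.run tables s).base rfl
  have out : (tables.run s).v .out = s.v .out := run_v rfl
  refine ⟨h.loaded_run_tables, h.hasMatrix_chains, fun q => ?_, ?_, ?_⟩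
  · have lt := (Q.label q).isLt
    have choice := h.getD_matrix (l₁ := [Q.size, P.size, k] ++ Q.matrix ++ P.matrix ++
      chainMatrix P C) (l₂ := Q.elems.map fun q => (f q : ℕ)) (l₃ := []) (off := s.v .offF)
      (i := Q.label q) (List.append_nil _).symm ?_ ?_
    · rw [offF, run_m rfl (by rw [h.base]; omega), choice]
      simp [FinPoset.elems]
    · simp only [h.offF, List.length_append, FinPoset.length_matrix, length_chainMatrix,
        List.length_cons, List.length_nil]
    · simp [FinPoset.elems]
  · rw [offF, base, h.base]
  · rw [base, out, h.out]

/-- In the state `s`, the list `L` is the output. -/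
def Presents (L : List ℕ) (s : St) : Prop :=
  s.v .len = L.length ∧ ∀ (i : ℕ) (h : i < L.length), s.m (s.v .res + i) = L[i]

/-- Writes a list, and presents it as the output. -/
def present (c : Cmd) : Cmd :=
  block [assign .res (v .out), c, assign .len (sub (v .out) (v .res))]

theorem presents_run_present {c : Cmd} {L : List ℕ} (hc : c.writes .res = false)
    (h : Appends L (s.setv .res (s.v .out)) (c.run (s.setv .res (s.v .out)))) :
    Presents L ((present c).run s) := by
  have res : (c.run (s.setv .res (s.v .out))).v .res = s.v .out := (run_v hc).trans (by simp)
  refine ⟨?_, fun i hi => ?_⟩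
  · simp [present, h.out, res]
  · simpa [present, res] using h.written i hi

/-- Presents the instance without variables, which is the output if `Q` is empty; the first two
entries of the input, `0` and the size of `P`, are kept. -/
def presentEmptyCSP : Cmd := block [store (c 2) (c 0), assign .len (c 3)]

/-- The algorithm that computes the constraint satisfaction instance of a chain assignment. -/
def computeCSP : Cmd :=
  ite (get (c 0)) (block [locate, tables, present writeCSP]) presentEmptyCSP

theorem Assigned.presents (h : Assigned C f s) :
    Presents ((assignmentCSP Q P C f).encode Q.label P.label) ((present writeCSP).run s) :=
  presents_run_present rfl (appends_writeCSP (h.grows (c := assign .res (v .out))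
    ⟨fun _ => run_v (c := assign .res (v .out)), le_rfl, fun _ _ => rfl⟩ rfl))

theorem encode_assignmentCSP_of_size_eq_zero (h : Q.size = 0) :
    (assignmentCSP Q P C f).encode Q.label P.label = [0, P.size, 0] := by
  have elems_eq : Q.elems = [] := List.eq_nil_of_length_eq_zero (by simp [FinPoset.elems, h])
  simp [CSP.encode, assignmentCSP, elems_eq, h]

variable (Q P C f)

theorem presents_run_computeCSP :
    Presents ((assignmentCSP Q P C f).encode Q.label P.label)
      (computeCSP.run (.start (encodeAssignment Q P C f))) := by
  have m_eq : (St.start (encodeAssignment Q P C f)).m 0 = Q.size ∧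
      (St.start (encodeAssignment Q P C f)).m 1 = P.size := by
    simp [St.start, encodeAssignment]
  rw [computeCSP, run_ite]
  split_ifs with hQ
  · exact (located_run_locate Q P C f).assigned_run_tables.presents
  · have size_zero : Q.size = 0 := by simpa [Holds, m_eq] using hQ
    rw [encode_assignmentCSP_of_size_eq_zero size_zero]
    refine ⟨by simp [presentEmptyCSP], fun i hi => ?_⟩
    rw [List.length_cons, List.length_cons, List.length_singleton] at hi
    have res : (St.start (encodeAssignment Q P C f)).v .res = 0 := rfl
    interval_cases i <;> simp [presentEmptyCSP, m_eq, size_zero, res]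

variable {Q P C f} in
theorem cost_locate_le {N : ℕ} (hN : 1 ≤ N) (hQ : Q.size ≤ N) (hP : P.size ≤ N) :
    locate.cost (.start (encodeAssignment Q P C f)) ≤ locate.size * N := by
  have nP : ((offsets 3).run (.start (encodeAssignment Q P C f))).v .nP = P.size := by
    simp [offsets, run_addMul, St.start, encodeAssignment]
  refine cost_seq_le (cost_offsets_le 3 hN (by simpa [St.start, encodeAssignment])
    (by simpa [St.start, encodeAssignment])) (cost_le_of_nest_le (σ := fun _ => N) [.nP]
    (fun y => ?_) (by simp [hN, hP, nP]) ?_)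
  · cases y <;> simp [bounds, writes, addMul, block]
  · simp [nest, addMul, block, hN]

theorem cost_present_writeCSP_le {n q : ℕ} (hn : 1 ≤ n) (hq : 1 ≤ q) (nP : s.v .nP = n)
    (nQ : s.v .nQ = q) :
    (present writeCSP).cost s ≤ (present writeCSP).size * (q * n) ^ 2 := by
  refine cost_le_of_nest_le (σ := fun y => if y = .nP then n else q) [.nP, .nQ]
    (fun y => ?_) (by simp [*]) ?_
  · cases y <;> decide
  · have sq_pos : 1 ≤ n * n := Nat.mul_pos hn hn
    have orders_pos : 1 ≤ q * (n * n) := Nat.mul_pos hq sq_pos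
    have domain_le : n ≤ q * (n * n) :=
      (Nat.le_mul_self n).trans (Nat.le_mul_of_pos_left _ hq)
    have orders_eq : q * (q * (n * n)) = (q * n) ^ 2 := by ring
    have nest_eq : q * max n (max 1 (q * max (n * n) 1)) = (q * n) ^ 2 := by
      rw [max_eq_left sq_pos, max_eq_right orders_pos, max_eq_right domain_le, orders_eq]
    simpa [nest, present, writeCSP, writeDomains, writeOrders, writeDomain, writeOrder, record,
      item, write, block, nest_eq] using Nat.one_le_pow 2 (q * n) (Nat.mul_pos hq hn)

theorem cost_computeCSP_le :
    computeCSP.cost (.start (encodeAssignment Q P C f)) ≤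
      computeCSP.size * ((Q.size * P.size) ^ 2 + 1) := by
  have size_eq : (St.start (encodeAssignment Q P C f)).m 0 = Q.size := by
    simp [St.start, encodeAssignment]
  refine cost_ite_le (Nat.le_add_left 1 _) (fun hQ => ?_) fun _ => ?_
  · have hQ : 1 ≤ Q.size := Nat.one_le_iff_ne_zero.mpr (by rwa [← size_eq])
    have hP : 1 ≤ P.size := (Fin.pos (f (Q.label.symm ⟨0, hQ⟩))).trans_le C.le_size
    have located := located_run_locate Q P C f
    have sq_le : Q.size * P.size ≤ (Q.size * P.size) ^ 2 := Nat.le_self_pow two_ne_zero _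
    have Q_le : Q.size ≤ Q.size * P.size := Nat.le_mul_of_pos_right _ hP
    have P_le : P.size ≤ Q.size * P.size := Nat.le_mul_of_pos_left _ hQ
    refine cost_seq_le (cost_locate_le (Nat.le_add_left 1 _) (by omega) (by omega)) ?_
    generalize locate.run (.start (encodeAssignment Q P C f)) = s at located
    refine cost_seq_le (cost_tables_le (Nat.le_add_left 1 _)
      (located.nQ.trans_le (by omega)) (located.nP.trans_le (by omega)))
      (cost_seq_le ?_ (Nat.zero_le _))
    exact (cost_present_writeCSP_le hP hQ ((run_v rfl).trans located.nP)
      ((run_v rfl).trans located.nQ)).trans (Nat.mul_le_mul_left _ (Nat.le_succ _))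
  · simp [presentEmptyCSP, block, cost, size]
    omega

end Computation

end RAM

theorem exists_computesWithin_assignmentCSP : ∃ (A : RAM.Program) (K : ℕ),
    ∀ (Q P : FinPoset) (k : ℕ) (C : ChainPartition P k) (f : Q → Fin k),
      A.ComputesWithin (encodeAssignment Q P C f)
        ((assignmentCSP Q P C f).encode Q.label P.label)
        (K * ((Q.size * P.size) ^ 2 + 1)) := by
  refine ⟨RAM.computeCSP.compile, RAM.computeCSP.compile.length * RAM.computeCSP.size,
    fun Q P k C f => ?_⟩
  rw [mul_assoc]
  obtain ⟨len, mem⟩ := RAM.presents_run_computeCSP Q P C f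
  exact RAM.Cmd.compile_computesWithin len mem (RAM.cost_computeCSP_le Q P C f)

/-! ### Solutions and polymorphisms -/

section Solutions

variable {Q P : FinPoset} {k : ℕ} {C : ChainPartition P k} {f : Q → Fin k}

theorem FinPoset.mem_elems (p : P) : p ∈ P.elems :=
  List.mem_map.mpr ⟨P.label p, List.mem_finRange _, P.label.symm_apply_apply p⟩

theorem mem_domainConstraint {q : Q} {t : Fin 1 → P} :
    t ∈ (domainConstraint Q P C f q).rel ↔ t 0 ∈ C.part (f q) := by
  refine List.mem_map.trans ?_
  simp [FinPoset.mem_elems, funext_iff, Fin.forall_fin_one]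

theorem mem_orderConstraint {q q' : Q} {ne : q ≠ q'} {t : Fin 2 → P} :
    t ∈ (orderConstraint Q P C f q q' ne).rel ↔
      t 0 ∈ C.part (f q) ∧ t 1 ∈ C.part (f q') ∧ OrderedAlike (t 0) (t 1) q q' := by
  refine List.mem_map.trans ?_
  simp [FinPoset.mem_elems, funext_iff, Fin.forall_fin_two, OrderedAlike]

theorem forall_mem_constraints {p : Constraint Q P → Prop} :
    (∀ c ∈ (assignmentCSP Q P C f).constraints, p c) ↔
      (∀ q, p (domainConstraint Q P C f q)) ∧
        ∀ q q' (ne : q ≠ q'), p (orderConstraint Q P C f q q' ne) := by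
  simp only [assignmentCSP, List.forall_mem_append, List.forall_mem_map, FinPoset.mem_elems,
    forall_const, List.forall_mem_filterMap, Prod.forall]
  simp [FinPoset.mem_elems]

theorem isSolution_assignmentCSP_iff (τ : Q → P) :
    (assignmentCSP Q P C f).IsSolution τ ↔ ∃ e : Q ↪o P, CompatibleWith C f e ∧ ⇑e = τ := by
  rw [CSP.IsSolution, forall_mem_constraints]
  constructor
  · rintro ⟨domains, orders⟩
    have le_iff (q q' : Q) : τ q ≤ τ q' ↔ q ≤ q' := by
      rcases eq_or_ne q q' with rfl | ne
      · simp
      · exact (mem_orderConstraint.mp (orders q q' ne)).2.2.1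
    exact ⟨.ofMapLEIff τ le_iff, fun q => mem_domainConstraint.mp (domains q), rfl⟩
  · rintro ⟨e, compatible, rfl⟩
    exact ⟨fun q => mem_domainConstraint.mpr (compatible q), fun q q' _ =>
      mem_orderConstraint.mpr ⟨compatible q, compatible q', e.le_iff_le, e.le_iff_le⟩⟩

theorem FinPoset.IsLinearExtension.minOp_cases {L : LinearOrder P} (hL : P.IsLinearExtension L)
    {s : Set P} (chain : IsChain (· ≤ ·) s) {x : Fin 2 → P} (hx : ∀ i, x i ∈ s) :
    minOp L x = x 0 ∧ x 0 ≤ x 1 ∨ minOp L x = x 1 ∧ x 1 ≤ x 0 := by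
  rcases chain.total (hx 0) (hx 1) with le | le
  · exact .inl ⟨@min_eq_left _ L _ _ (hL _ _ le), le⟩
  · exact .inr ⟨@min_eq_right _ L _ _ (hL _ _ le), le⟩

theorem closedUnder_minOp {L : LinearOrder P} (hL : P.IsLinearExtension L) :
    (assignmentCSP Q P C f).ClosedUnder (minOp L) := by
  refine forall_mem_constraints.mpr ⟨fun q t ht => ?_, fun q q' ne t ht => ?_⟩
  · have mem (i : Fin 2) := mem_domainConstraint.mp (ht i)
    refine mem_domainConstraint.mpr ?_
    rcases hL.minOp_cases (C.chain (f q)) mem with ⟨eq, -⟩ | ⟨eq, -⟩ <;> rw [eq]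
    exacts [mem 0, mem 1]
  · have mem (i : Fin 2) := mem_orderConstraint.mp (ht i)
    obtain ⟨mem₀, mem₀', alike₀⟩ := mem 0
    obtain ⟨mem₁, mem₁', alike₁⟩ := mem 1
    refine mem_orderConstraint.mpr ?_
    rcases hL.minOp_cases (C.chain (f q)) fun i => (mem i).1 with ⟨eq, le⟩ | ⟨eq, le⟩ <;>
      rcases hL.minOp_cases (C.chain (f q')) fun i => (mem i).2.1 with ⟨eq', le'⟩ | ⟨eq', le'⟩ <;>
      rw [eq, eq']
    · exact ⟨mem₀, mem₀', alike₀⟩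
    · exact ⟨mem₀, mem₁', alike₀.mix alike₁ le le'⟩
    · exact ⟨mem₁, mem₀', alike₁.mix alike₀ le le'⟩
    · exact ⟨mem₁, mem₁', alike₁⟩

theorem FinPoset.exists_isLinearExtension (P : FinPoset) :
    ∃ L : LinearOrder P, P.IsLinearExtension L :=
  ⟨(inferInstance : LinearOrder (LinearExtension P)), fun _ _ h => toLinearExtension.monotone h⟩

end Solutions

theorem mainTheorem3 :
    -- the embedding problem is fixed-parameter tractable
    embeddingProblem.FixedParameterTractable ∧
    -- it is solved in time `O(width(P) ^ |Q| * |Q| ^ 4 * |P| ^ 4)`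
    (∃ (A : RAM.Program) (K : ℕ), ∀ Q P : FinPoset,
      A.DecidesWithin (embeddingProblem.encode (Q, P)) (Nonempty (Q ↪o P))
        (K * (P.width ^ Q.size * Q.size ^ 4 * P.size ^ 4 + 1))) ∧
    -- for a chain assignment `f`, a CSP instance is computed in time `O((|Q| * |P|) ^ 2)`
    (∃ (A : RAM.Program) (K : ℕ), ∀ (Q P : FinPoset) (k : ℕ) (C : ChainPartition P k)
      (f : Q → Fin k),
      A.ComputesWithin (encodeAssignment Q P C f)
        ((assignmentCSP Q P C f).encode Q.label P.label)
        (K * ((Q.size * P.size) ^ 2 + 1))) ∧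
    -- its solutions are the compatible embeddings, and it is closed under min polymorphisms
    (∀ (Q P : FinPoset) (k : ℕ) (C : ChainPartition P k) (f : Q → Fin k),
      (∀ τ : Q → P, (assignmentCSP Q P C f).IsSolution τ ↔
        ∃ e : Q ↪o P, CompatibleWith C f e ∧ ⇑e = τ) ∧
      (∃ φ : (Fin 2 → P) → P, IsMinOp φ ∧ (assignmentCSP Q P C f).ClosedUnder φ) ∧
      (∀ L : LinearOrder P, P.IsLinearExtension L →
        (assignmentCSP Q P C f).ClosedUnder (minOp L))) := by
  refine ⟨fixedParameterTractable_embeddingProblem, exists_decidesWithin_embedding,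
    exists_computesWithin_assignmentCSP, fun Q P k C f =>
      ⟨isSolution_assignmentCSP_iff, ?_, fun _ => closedUnder_minOp⟩⟩
  obtain ⟨L, hL⟩ := P.exists_isLinearExtension
  exact ⟨minOp L, ⟨L, rfl⟩, closedUnder_minOp hL⟩
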